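/- Let $l$ be a prime number, $L$ a finite extension of $\mathbb{Q}_l$ with ring of integers $\mathfrak{o}_L$, normalized valuation $v_L$ and uniformizer $\ell$. Let $\Gamma\cong\mathbb{Z}_l$ be written multiplicatively with topological generator $\gamma$, let $w\ge 1$ be an integer and $\Gamma^{w}=\{g^w : g\in\Gamma\}$. Let $\Lambda\Gamma^{w}=\mathbb{Z}_l[[\Gamma^{w}]]$ be the completed group ring, $\mathcal{Q}\Gamma^{w}=\mathrm{Quot}(\Lambda\Gamma^{w})$, $\Lambda^{\mathfrak{o}_L}\Gamma^{w}=\mathfrak{o}_L\otimes_{\mathbb{Z}_l}\Lambda\Gamma^{w}$ and $\mathcal{Q}^L\Gamma^{w}=L\otimes_{\mathbb{Q}_l}\mathcal{Q}\Gamma^{w}$, and put $T=\gamma^{w}-1\in\Lambda^{\mathfrak{o}_L}\Gamma^{w}$. Let $\mathfrak{p}$ be one of the ideals $(T)$, $(f(T))$ or $(\ell)$ of $\Lambda^{\mathfrak{o}_L}\Gamma^{w}$, where $f\in\mathfrak{o}_L[T]$ is an irreducible distinguished polynomial (monic, with all other coefficients in $(\ell)$). Then $\mathfrak{p}$ is a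 prime ideal; the $\mathfrak{p}$-adic valuation of $\mathcal{Q}^L\Gamma^{w}$ (the normalized discrete valuation whose valuation ring is the localization of $\Lambda^{\mathfrak{o}_L}\Gamma^{w}$ at $\mathfrak{p}$) exists; and the completion $\mathcal{Q}^L_\wedge\Gamma^{w}$ of $\mathcal{Q}^L\Gamma^{w}$ with respect to it is a $2$-dimensional local field, that is, a complete discrete valuation field whose residue field is a complete discrete valuation field with finite residue field. Moreover, there are ring isomorphisms, compatible with the embeddings of $L$ and mapping the valuation ring of the completion onto the valuation ring of the right-hand side, as follows. (i) If $\mathfrak{p}=(T)$, then $\mathcal{Q}^L_\wedge\Gamma^{w}\cong L((X))$. (ii) If $\mathfrak{p}=(f(T))$, then $E=(L\otimes_{\mathbb{Z}_l}\mathbb{Z}_l[[T]])/(f)$ is a field, where $f=\sum_i a_iT^i$ is read as $\sum_i a_i\otimes T^i$, and $\mathcal{Q}^L_\wedge\Gamma^{w}\cong E((X))$. (iii) If $\mathfrak{p}=(\ell)$, then $\mathcal{Q}^L_\wedge\Gamma^{w}\cong L\{\{T\}\}$, with $T=\gamma^w-1$ corresponding to $T$. Here $$L\{\{T\}\}=\Big\{\sum_{i\in\mathbb{Z}}a_iT^i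 : a_i\in L,\ \inf_i v_L(a_i)>-\infty,\ \lim_{i\to-\infty}v_L(a_i)=\infty\Big\}$$ with coefficientwise addition, the Cauchy product, and valuation ring given by the condition $v_L(a_i)\ge 0$ for all $i$. (In (i) and (ii), the valuation rings of $L((X))$ and $E((X))$ are $L[[X]]$ and $E[[X]]$.) -/

import Mathlib

open scoped WithZero TensorProduct Polynomial PowerSeries LaurentSeries

noncomputable section

universe u

/-! ### Complete discrete valuations and higher local fields -/

/-- `Q` is an `n`-dimensional local field: for `n = 0` this means a finite field, and for `n + 1`
a field, complete with respect to a (normalized) discrete valuation `w`, whose residue field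
`{w ≤ 1} / {w < 1}` is an `n`-dimensional local field. -/
def IsLocalFieldOfDim : ℕ → ∀ (Q : Type u) [CommRing Q], Prop
  | 0, Q, _ => IsField Q ∧ Finite Q
  | n + 1, Q, _ => IsField Q ∧ ∃ w : Valuation Q ℤᵐ⁰, Function.Surjective w ∧
      CompleteSpace (WithVal w) ∧ IsLocalFieldOfDim n (w.integer ⧸ w.ltIdeal 1)

/-- Let `φ : R → K` be a ring homomorphism (the inclusion of a domain into its quotient field) and
`𝔭` a prime ideal of `R`. Then `v` is the `𝔭`-adic valuation of `K`: the normalized discrete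
valuation (value group `ℤ`) whose valuation ring is the localization `R_𝔭 ⊆ K`. -/
def IsAdicValuation {R K : Type*} [CommRing R] [CommRing K] (φ : R →+* K) (𝔭 : Ideal R)
    (v : Valuation K ℤᵐ⁰) : Prop :=
  Function.Surjective v ∧ ∀ x : K, v x ≤ 1 ↔ ∃ r s : R, s ∉ 𝔭 ∧ φ s * x = φ r

/-- The valuation ring of the completion of `(K, v)`, as the closure of the valuation ring of
`v`. -/
def completedValuationRing {K : Type*} [CommRing K] (v : Valuation K ℤᵐ⁰) : Set v.Completion :=
  closure ((fun x : K => (x : v.Completion)) '' {x | v x ≤ 1})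

/-! ### The field `F{{T}}` -/

/-- `F{{T}}`: doubly infinite series `∑ aᵢ Tⁱ` with bounded coefficients such that
`aᵢ → 0` for `i → -∞`. -/
@[ext]
structure TwoSidedSeries {F : Type*} [Field F] (v : Valuation F ℤᵐ⁰) where
  coeff : ℤ → F
  bounded : ∃ c : ℤᵐ⁰, ∀ i, v (coeff i) ≤ c
  tendsto : ∀ c : ℤᵐ⁰, c ≠ 0 → ∃ N : ℤ, ∀ i ≤ N, v (coeff i) < c

namespace TwoSidedSeries

variable {F : Type*} [Field F] {v : Valuation F ℤᵐ⁰}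

instance : Add (TwoSidedSeries v) where
  add a b :=
    { coeff := fun i => a.coeff i + b.coeff i
      bounded := by
        obtain ⟨c, hc⟩ := a.bounded
        obtain ⟨d, hd⟩ := b.bounded
        exact ⟨max c d, fun i => (v.map_add _ _).trans (max_le_max (hc i) (hd i))⟩
      tendsto := fun c h0 => by
        obtain ⟨M, hM⟩ := a.tendsto c h0
        obtain ⟨N, hN⟩ := b.tendsto c h0
        exact ⟨min M N, fun i hi => v.map_add_lt (hM i (hi.trans (min_le_left _ _)))
          (hN i (hi.trans (min_le_right _ _)))⟩ }

/-- The sum of a series in `F`, in the topology of the valuation `v`. -/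
def vsum (v : Valuation F ℤᵐ⁰) (t : ℤ → F) : F :=
  (∑' i, WithVal.toVal v (t i)).ofVal

theorem vsum_lt {t : ℤ → F} {c : ℤᵐ⁰} (hc : c ≠ 0) (h : ∀ i, v (t i) < c) :
    v (vsum v t) < c := by
  let A : AddSubgroup (WithVal v) :=
    { carrier := {x | v x.ofVal < c}
      zero_mem' := by simpa using zero_lt_iff.mpr hc
      add_mem' := fun {a b} ha hb => by
        have := v.map_add_lt ha hb
        simpa using this
      neg_mem' := fun {a} ha => by simpa using ha }
  have hcl : IsClosed (A : Set (WithVal v)) := by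
    rw [← isOpen_compl_iff, isOpen_iff_mem_nhds]
    intro x hx
    have hx' : c ≤ v x.ofVal := not_lt.mp hx
    have hx0 : v x.ofVal ≠ 0 := fun h0 => hc (le_zero_iff.mp (h0 ▸ hx'))
    have hy : Valued.v.restrict x ≠ 0 := by
      intro h0
      exact hx0 (by simpa [WithVal.apply_ofVal] using h0)
    rw [Valued.mem_nhds]
    refine ⟨Units.mk0 _ hy, fun y hyx => ?_⟩
    have h1 : Valued.v.restrict (y - x) < Valued.v.restrict x := hyx
    have h2 : v (y.ofVal - x.ofVal) < v x.ofVal := by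
      have h4 : Valued.v (y - x) < Valued.v x := by simpa [Valuation.restrict_lt_iff] using h1
      exact h4
    have h3 : v y.ofVal = v x.ofVal := Valuation.map_eq_of_sub_lt v h2
    exact not_lt.mpr (h3 ▸ hx')
  exact tsum_mem (s := A) hcl (fun i => h i)

/-- The Cauchy product: `(a * b)ₙ = ∑ᵢ aᵢ bₙ₋ᵢ`, a convergent series if `F` is complete. -/
instance : Mul (TwoSidedSeries v) where
  mul a b :=
    { coeff := fun n => vsum v fun i => a.coeff i * b.coeff (n - i)
      bounded := by
        obtain ⟨c, hc⟩ := a.bounded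
        obtain ⟨d, hd⟩ := b.bounded
        obtain ⟨e, he⟩ : ∃ e, c * d < e :=
          ⟨max (c * d) 1 * WithZero.exp 1, (le_max_left (c * d) 1).trans_lt
            (lt_mul_of_one_lt_right (zero_lt_one.trans_le (le_max_right _ _)) (by
              rw [← WithZero.exp_zero, WithZero.exp_lt_exp]; exact zero_lt_one))⟩
        refine ⟨e, fun n => (vsum_lt (ne_zero_of_lt he) fun i => ?_).le⟩
        rw [map_mul]
        exact (mul_le_mul' (hc i) (hd _)).trans_lt he
      tendsto := fun c h0 => by
        obtain ⟨A, hA⟩ := a.bounded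
        obtain ⟨B, hB⟩ := b.bounded
        have hA0 : max A 1 ≠ 0 := (zero_lt_one.trans_le (le_max_right A 1)).ne'
        have hB0 : max B 1 ≠ 0 := (zero_lt_one.trans_le (le_max_right B 1)).ne'
        obtain ⟨M, hM⟩ := a.tendsto (c / max B 1) (div_ne_zero h0 hB0)
        obtain ⟨N, hN⟩ := b.tendsto (c / max A 1) (div_ne_zero h0 hA0)
        refine ⟨M + N, fun n hn => vsum_lt h0 fun i => ?_⟩
        rw [map_mul]
        rcases le_or_gt i M with hi | hi
        · calc v (a.coeff i) * v (b.coeff (n - i)) ≤ v (a.coeff i) * max B 1 :=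
                mul_le_mul' le_rfl ((hB _).trans (le_max_left _ _))
            _ < c / max B 1 * max B 1 :=
                mul_lt_mul_of_pos_right (hM i hi) (zero_lt_iff.mpr hB0)
            _ = c := div_mul_cancel₀ c hB0
        · calc v (a.coeff i) * v (b.coeff (n - i)) ≤ max A 1 * v (b.coeff (n - i)) :=
                mul_le_mul' ((hA _).trans (le_max_left _ _)) le_rfl
            _ < max A 1 * (c / max A 1) :=
                mul_lt_mul_of_pos_left (hN _ (by lia)) (zero_lt_iff.mpr hA0)
            _ = c := mul_div_cancel₀ c hA0 }

/-- The monomial `a Tⁿ`. -/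
def monomial (v : Valuation F ℤᵐ⁰) (n : ℤ) (a : F) : TwoSidedSeries v where
  coeff := Pi.single n a
  bounded := by
    refine ⟨v a, fun i => ?_⟩
    by_cases h : i = n
    · subst h; simp
    · simp [Pi.single_eq_of_ne h]
  tendsto := fun c hc => by
    refine ⟨n - 1, fun i hi => ?_⟩
    have h : i ≠ n := by lia
    simpa [Pi.single_eq_of_ne h] using zero_lt_iff.mpr hc

end TwoSidedSeries

/-! ### Completed group rings and the algebras `𝒬^L Γ` -/

/-- The completed group ring `O[[G]] = lim O[G/U]` of an abelian topological group `G`, where `U`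
runs through the open subgroups of `G`. -/
def completedGroupRing (O G : Type*) [CommRing O] [CommGroup G] [TopologicalSpace G] :
    Subalgebra O (∀ U : OpenSubgroup G, MonoidAlgebra O (G ⧸ U.toSubgroup)) where
  carrier := {x | ∀ (U V : OpenSubgroup G) (h : U.toSubgroup ≤ V.toSubgroup),
    MonoidAlgebra.mapDomainAlgHom O O
      (QuotientGroup.map U.toSubgroup V.toSubgroup (MonoidHom.id G) h) (x U) = x V}
  mul_mem' hx hy U V h := by simp only [Pi.mul_apply, map_mul, hx U V h, hy U V h]
  add_mem' hx hy U V h := by simp only [Pi.add_apply, map_add, hx U V h, hy U V h]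
  algebraMap_mem' r U V h := by simp only [Pi.algebraMap_apply, AlgHom.commutes]

/-- The group element `g`, as an element of `O[[G]]`. -/
def completedGroupRing.of (O : Type*) {G : Type*} [CommRing O] [CommGroup G] [TopologicalSpace G]
    (g : G) : completedGroupRing O G :=
  ⟨fun U => MonoidAlgebra.single (g : G ⧸ U.toSubgroup) 1, fun U V h => by simp; rfl⟩

/-- The Iwasawa algebra `ΛG = ℤ_l[[G]]`. -/
abbrev Iwasawa (l : ℕ) [Fact l.Prime] (G : Type*) [CommGroup G] [TopologicalSpace G] : Type _ :=
  completedGroupRing ℤ_[l] G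

/-- The total ring of fractions `𝒬G = Quot(ΛG)`. -/
abbrev QuotIwasawa (l : ℕ) [Fact l.Prime] (G : Type*) [CommGroup G] [TopologicalSpace G] :
    Type _ :=
  FractionRing (Iwasawa l G)

section

variable (l : ℕ) [Fact l.Prime] (G : Type*) [CommGroup G] [TopologicalSpace G]

theorem isUnit_algebraMap_quotIwasawa (y : nonZeroDivisors ℤ_[l]) :
    IsUnit (algebraMap ℤ_[l] (QuotIwasawa l G) y) := by
  have hy : (y : ℤ_[l]) ≠ 0 := nonZeroDivisors.ne_zero y.2
  rw [IsScalarTower.algebraMap_apply ℤ_[l] (Iwasawa l G) (QuotIwasawa l G)]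
  refine IsLocalization.map_units (M := nonZeroDivisors (Iwasawa l G)) (QuotIwasawa l G)
    ⟨algebraMap ℤ_[l] (Iwasawa l G) y, ?_⟩
  rw [mem_nonZeroDivisors_iff_right]
  intro x hx
  have hx' : (y : ℤ_[l]) • x = 0 := by rw [Algebra.smul_def, mul_comm]; exact hx
  apply Subtype.ext
  funext U
  ext g
  have h1 := congrArg (fun z : Iwasawa l G => (z.1 U).coeff g) hx'
  have h2 : (y : ℤ_[l]) * (x.1 U).coeff g = 0 := h1
  exact (mul_eq_zero.mp h2).resolve_left hy

/-- As `l` is invertible in `𝒬G`, this ring is a `ℚ_l`-algebra. -/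
instance : Algebra ℚ_[l] (QuotIwasawa l G) :=
  (IsLocalization.lift (M := nonZeroDivisors ℤ_[l]) (S := ℚ_[l])
    (isUnit_algebraMap_quotIwasawa l G)).toAlgebra

instance : IsScalarTower ℤ_[l] ℚ_[l] (QuotIwasawa l G) :=
  IsScalarTower.of_algebraMap_eq fun x =>
    (IsLocalization.lift_eq (isUnit_algebraMap_quotIwasawa l G) x).symm

variable (L : Type*) [Field L] [Algebra ℚ_[l] L] [Algebra ℤ_[l] L] [IsScalarTower ℤ_[l] ℚ_[l] L]

/-- `𝒬^L G = L ⊗_{ℚ_l} 𝒬G`. -/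
def QuotIwasawaOver : Type _ := L ⊗[ℚ_[l]] QuotIwasawa l G

instance : CommRing (QuotIwasawaOver l G L) :=
  inferInstanceAs (CommRing (L ⊗[ℚ_[l]] QuotIwasawa l G))

instance : Algebra L (QuotIwasawaOver l G L) :=
  inferInstanceAs (Algebra L (L ⊗[ℚ_[l]] QuotIwasawa l G))

/-- `Λ^{𝔬_L} G = 𝔬_L ⊗_{ℤ_l} ΛG`, where `𝔬_L` is the ring of integers of `L`. -/
def IwasawaOver : Type _ := integralClosure ℤ_[l] L ⊗[ℤ_[l]] Iwasawa l G

instance : CommRing (IwasawaOver l G L) :=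
  inferInstanceAs (CommRing (integralClosure ℤ_[l] L ⊗[ℤ_[l]] Iwasawa l G))

instance : Algebra (integralClosure ℤ_[l] L) (IwasawaOver l G L) :=
  inferInstanceAs (Algebra (integralClosure ℤ_[l] L)
    (integralClosure ℤ_[l] L ⊗[ℤ_[l]] Iwasawa l G))

/-- The canonical map `𝔬_L ⊗ ΛG → L ⊗ 𝒬G`, `a ⊗ x ↦ a ⊗ x`. -/
def tensorIwasawaToQuot :
    integralClosure ℤ_[l] L ⊗[ℤ_[l]] Iwasawa l G →ₐ[ℤ_[l]] L ⊗[ℚ_[l]] QuotIwasawa l G :=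
  Algebra.TensorProduct.lift
    ((Algebra.TensorProduct.includeLeft : L →ₐ[ℤ_[l]] L ⊗[ℚ_[l]] QuotIwasawa l G).comp
      (integralClosure ℤ_[l] L).val)
    (((Algebra.TensorProduct.includeRight :
        QuotIwasawa l G →ₐ[ℚ_[l]] L ⊗[ℚ_[l]] QuotIwasawa l G).restrictScalars ℤ_[l]).comp
      (IsScalarTower.toAlgHom ℤ_[l] (Iwasawa l G) (QuotIwasawa l G)))
    (fun _ _ => Commute.all _ _)

/-- The canonical map `Λ^{𝔬_L} G → 𝒬^L G`. -/
def iwasawaOverToQuot : IwasawaOver l G L →+* QuotIwasawaOver l G L :=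
  (tensorIwasawaToQuot l G L).toRingHom

variable {G} in
/-- The element `T = g - 1` of `Λ^{𝔬_L} G`, for `g ∈ G`. -/
def iwasawaVar (g : G) : IwasawaOver l G L :=
  (1 : integralClosure ℤ_[l] L) ⊗ₜ[ℤ_[l]] (completedGroupRing.of ℤ_[l] g - 1 : Iwasawa l G)

variable {l L}

/-- The algebra `(L ⊗_{ℤ_l} ℤ_l[[T]]) / (f)` for a polynomial `f = ∑ aᵢ Tⁱ` over `𝔬_L`; here `f` is
read as the element `∑ aᵢ ⊗ Tⁱ`. -/
def ResidueAlgebra (f : (integralClosure ℤ_[l] L)[X]) : Type _ :=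
  (L ⊗[ℤ_[l]] ℤ_[l]⟦X⟧) ⧸ Ideal.span
    {Polynomial.aeval ((1 : L) ⊗ₜ[ℤ_[l]] (PowerSeries.X : ℤ_[l]⟦X⟧)) f}

instance (f : (integralClosure ℤ_[l] L)[X]) : CommRing (ResidueAlgebra f) :=
  inferInstanceAs (CommRing (_ ⧸ Ideal.span _))

instance (f : (integralClosure ℤ_[l] L)[X]) : Algebra L (ResidueAlgebra f) :=
  inferInstanceAs (Algebra L (_ ⧸ Ideal.span _))

end

end

noncomputable section

/-! ### Rings with a discrete valuation -/

namespace Valuation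

open Filter Topology Uniformity

variable {M : Type*} [CommRing M] (w : Valuation M ℤᵐ⁰)

/-! Write `A` for the ring of integers of `L`. The proof rests on two facts.

First, `Λ^{𝔬_L} Γ^w` is the power series ring `A⟦X⟧`, with `X` corresponding to `T`, and `𝒬^L Γ^w`
is its field of fractions (`IsProcyclicSystem.exists_powerSeries_algEquiv`). Over `ℤ_l` this is
Serre's isomorphism: Weierstrass division by `(1 + X) ^ l ^ n - 1` identifies `ℤ_l⟦X⟧` modulo this
polynomial with the group ring of the cyclic quotient of order `l ^ n`; Nakayama's lemma and
compactness give injectivity and surjectivity in the limit. Since `A` is finite free over `ℤ_l`,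
coefficients extend to `A`, and by integrality denominators from `ℤ_l⟦X⟧` suffice.

Second, a completion can be recognised from outside (`Valuation.exists_adicCompletion_ringEquiv`).
Let a domain `R` embed in a field `M` complete for a discrete valuation `w ≤ 1` on `R`, and let `π`
in `R` be a uniformizer of `M` dividing every element of `R` with `w < 1`. If `R` generates the
residue field of `M` as a field, then `w` restricts to the `π`-adic valuation and `M` is the
completion of `Frac R`. It remains to exhibit `M`.

For an irreducible distinguished `f` with a zero `θ` generating `E` over `L`, take `M = E⸨X⸩` and
the Taylor expansion `X ↦ θ + X`. By Weierstrass division a power series vanishing at `θ` is a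
multiple of `f`, and `f(θ + X)` has a simple zero because the characteristic is zero. The ideal
`(T)` is the case `f = X`, `θ = 0`, `E = L`. For `(ℓ)`, take `M = L{{T}}` with the Gauss valuation
and the coefficientwise inclusion. The residue fields are `E`, finite over `ℚ_l`, and `k⸨X⸩` with
`k` the finite residue field of `L`; both are one-dimensional local fields. -/

theorem exists_exp_neg_le {c : ℤᵐ⁰} (hc : c ≠ 0) : ∃ n : ℕ, WithZero.exp (-(n : ℤ)) ≤ c := by
  refine ⟨(-WithZero.log c).toNat, ?_⟩
  rw [← WithZero.exp_log hc, WithZero.exp_le_exp]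
  simp only [WithZero.log_exp]
  omega

theorem lt_exp_iff_le {c : ℤᵐ⁰} {n : ℤ} : c < WithZero.exp n ↔ c ≤ WithZero.exp (n - 1) := by
  rcases eq_or_ne c 0 with rfl | hc
  · simp
  · rw [← WithZero.exp_log hc, WithZero.exp_le_exp, WithZero.exp_lt_exp]
    omega

theorem lt_one_iff_le {c : ℤᵐ⁰} : c < 1 ↔ c ≤ WithZero.exp (-1) := by
  rw [← WithZero.exp_zero, lt_exp_iff_le, zero_sub]

theorem eq_zero_of_forall_le_exp_neg {c : ℤᵐ⁰} (h : ∀ n : ℕ, c ≤ WithZero.exp (-(n : ℤ))) :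
    c = 0 := by
  by_contra hc
  obtain ⟨n, hn⟩ := exists_exp_neg_le hc
  have h1 := (h (n + 1)).trans_lt (b := WithZero.exp (-((n + 1 : ℕ) : ℤ)))
    (c := WithZero.exp (-(n : ℤ))) (by rw [WithZero.exp_lt_exp]; push_cast; omega)
  exact absurd (hn.trans_lt h1) (lt_irrefl _)

variable {w}

/-- Reduces the uniformity to integer thresholds. Surjectivity makes each `exp (-n)` an actual value
of `w`, hence an admissible radius. -/
theorem hasBasis_uniformity_withVal (hw : Function.Surjective w) :
    (𝓤 (WithVal w)).HasBasis (fun _ : ℕ => True)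
      fun n => {p | w (p.2.ofVal - p.1.ofVal) ≤ WithZero.exp (-(n : ℤ))} := by
  refine (Valued.hasBasis_uniformity (WithVal w) ℤᵐ⁰).to_hasBasis (fun γ _ => ?_) fun n _ => ?_
  · have h0 : MonoidWithZeroHom.ValueGroup₀.embedding γ.1 ≠ 0 := by
      simp
    obtain ⟨n, hn⟩ := exists_exp_neg_le h0
    refine ⟨n + 1, trivial, fun p hp => ?_⟩
    simp only [Set.mem_ofPred_eq] at hp ⊢
    rw [Valuation.restrict_lt_iff_lt_embedding]
    refine lt_of_lt_of_le (lt_of_le_of_lt hp ?_) hn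
    rw [WithZero.exp_lt_exp]; push_cast; omega
  · obtain ⟨x, hx⟩ := hw (WithZero.exp (-(n : ℤ)))
    have h0 : (Valued.v (R := WithVal w)).restrict (WithVal.toVal w x) ≠ 0 := by
      rw [Ne, Valuation.restrict_eq_zero_iff, WithVal.valued_toVal, hx]
      exact WithZero.exp_ne_zero
    refine ⟨Units.mk0 _ h0, trivial, fun p hp => ?_⟩
    simp only [Set.mem_ofPred_eq, Units.val_mk0] at hp ⊢
    rw [Valuation.restrict_lt_iff, WithVal.valued_toVal w x, hx] at hp
    exact le_of_lt hp

theorem hasBasis_nhds_withVal (hw : Function.Surjective w) (x : WithVal w) :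
    (𝓝 x).HasBasis (fun _ : ℕ => True)
      fun n => {y | w (y.ofVal - x.ofVal) ≤ WithZero.exp (-(n : ℤ))} :=
  nhds_basis_uniformity' (hasBasis_uniformity_withVal hw)

/-- The countable basis allows completeness to be tested on sequences of prescribed speed;
coefficientwise limits satisfy exactly this criterion. -/
theorem completeSpace_withVal (hw : Function.Surjective w)
    (h : ∀ x : ℕ → M, (∀ n, w (x (n + 1) - x n) ≤ WithZero.exp (-(n : ℤ))) →
      ∃ y, ∀ n, w (y - x n) ≤ WithZero.exp (-(n : ℤ))) : CompleteSpace (WithVal w) := by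
  have hb := hasBasis_uniformity_withVal hw
  have : (𝓤 (WithVal w)).IsCountablyGenerated := hb.isCountablyGenerated
  refine UniformSpace.complete_of_convergent_controlled_sequences
    (fun n => {p | w (p.2.ofVal - p.1.ofVal) ≤ WithZero.exp (-(n : ℤ))})
    (fun n => hb.mem_of_mem trivial) fun u hu => ?_
  obtain ⟨y, hy⟩ := h (fun n => (u n).ofVal) fun n => hu n n (n + 1) le_rfl n.le_succ
  refine ⟨WithVal.toVal w y, ((hasBasis_nhds_withVal hw _).tendsto_right_iff).mpr fun n _ => ?_⟩
  filter_upwards [eventually_ge_atTop n] with k hk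
  rw [Valuation.map_sub_swap]
  refine (hy k).trans ?_
  rw [WithZero.exp_le_exp]; omega

/-- By the ultrametric inequality the estimate on consecutive terms holds for all later terms, and
it survives in the limit. -/
theorem exists_limit_of_completeSpace (hw : Function.Surjective w) [CompleteSpace (WithVal w)]
    (x : ℕ → M) (hx : ∀ n, w (x (n + 1) - x n) ≤ WithZero.exp (-(n : ℤ))) :
    ∃ y, ∀ n, w (y - x n) ≤ WithZero.exp (-(n : ℤ)) := by
  have key : ∀ n k, w (x (n + k) - x n) ≤ WithZero.exp (-(n : ℤ)) := by
    intro n k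
    induction k with
    | zero => simp
    | succ k ih =>
      have : x (n + (k + 1)) - x n = (x (n + k + 1) - x (n + k)) + (x (n + k) - x n) := by
        rw [add_assoc]; ring
      rw [this]
      refine (w.map_add _ _).trans (max_le ((hx _).trans ?_) ih)
      rw [WithZero.exp_le_exp]; push_cast; omega
  have hc : CauchySeq fun n => WithVal.toVal w (x n) := by
    rw [(hasBasis_uniformity_withVal hw).cauchySeq_iff']
    intro n _
    refine ⟨n, fun m hm => ?_⟩
    obtain ⟨k, rfl⟩ := Nat.exists_eq_add_of_le hm
    change w (x n - x (n + k)) ≤ _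
    rw [Valuation.map_sub_swap]
    exact key n k
  obtain ⟨y, hy⟩ := cauchySeq_tendsto_of_complete hc
  refine ⟨y.ofVal, fun n => ?_⟩
  obtain ⟨m, hm, hm'⟩ := (((hasBasis_nhds_withVal hw y).tendsto_right_iff.mp hy n trivial).and
    (eventually_ge_atTop n)).exists
  obtain ⟨k, rfl⟩ := Nat.exists_eq_add_of_le hm'
  have : y.ofVal - x n = (y.ofVal - x (n + k)) + (x (n + k) - x n) := by ring
  rw [this]
  refine (w.map_add _ _).trans (max_le ?_ (key n k))
  rw [Valuation.map_sub_swap]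
  exact hm

theorem t0Space_withVal (hw : Function.Surjective w) (h0 : ∀ m, w m = 0 → m = 0) :
    T0Space (WithVal w) := by
  rw [t0Space_iff_uniformity]
  intro x y hxy
  have h := fun n => hxy _ ((hasBasis_uniformity_withVal hw).mem_of_mem (i := n) trivial)
  apply WithVal.ofVal_injective
  rw [eq_comm, ← sub_eq_zero]
  exact h0 _ (eq_zero_of_forall_le_exp_neg h)

/-- If `K → M` is an isometric embedding with dense image into a complete Hausdorff ring, then `M`
is the completion of `K`. -/
theorem exists_completion_ringEquiv {K : Type*} [CommRing K] {v : Valuation K ℤᵐ⁰}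
    (hv : Function.Surjective v) (h0 : ∀ m, w m = 0 → m = 0) [CompleteSpace (WithVal w)]
    (ι : K →+* M) (hι : ∀ x, w (ι x) = v x)
    (hd : ∀ (m : M) (n : ℕ), ∃ x, w (m - ι x) ≤ WithZero.exp (-(n : ℤ))) :
    ∃ e : v.Completion ≃+* M, (∀ x : K, e (x : v.Completion) = ι x) ∧
      ∀ y, y ∈ completedValuationRing v ↔ w (e y) ≤ 1 := by
  have hw : Function.Surjective w := fun c => by
    obtain ⟨x, hx⟩ := hv c
    exact ⟨ι x, by rw [hι, hx]⟩
  have := t0Space_withVal hw h0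
  let i : WithVal v → WithVal w := fun x => WithVal.toVal w (ι x.ofVal)
  have hi : IsUniformInducing i := by
    refine ((hasBasis_uniformity_withVal hv).isUniformInducing_iff
      (hasBasis_uniformity_withVal hw)).mpr ⟨fun n _ => ⟨n, trivial, fun x y h => ?_⟩,
      fun n _ => ⟨n, trivial, fun x y h => ?_⟩⟩
    · change w (ι y.ofVal - ι x.ofVal) ≤ _
      rw [← RingHom.map_sub, hι]; exact h
    · have h' : w (ι y.ofVal - ι x.ofVal) ≤ WithZero.exp (-(n : ℤ)) := h
      rw [← RingHom.map_sub, hι] at h'; exact h'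
  have hdense : DenseRange i := by
    intro m
    rw [mem_closure_iff_nhds_basis (hasBasis_nhds_withVal hw m)]
    intro n _
    obtain ⟨x, hx⟩ := hd m.ofVal n
    refine ⟨_, ⟨WithVal.toVal v x, rfl⟩, ?_⟩
    change w (ι x - m.ofVal) ≤ _
    rw [Valuation.map_sub_swap]; exact hx
  -- Uniqueness of completions gives the uniform isomorphism `E`; its additivity and
  -- multiplicativity are then checked on the dense image of `K`.
  let pkg : AbstractCompletion (WithVal v) :=
    { space := WithVal w
      coe := i
      uniformStruct := inferInstance
      complete := inferInstance
      separation := inferInstance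
      isUniformInducing := hi
      dense := hdense }
  let E : v.Completion ≃ᵤ WithVal w := UniformSpace.Completion.cPkg.compareEquiv pkg
  have hE : ∀ x : WithVal v, E (x : v.Completion) = i x := fun x =>
    UniformSpace.Completion.cPkg.compare_coe pkg x
  have hEc : Continuous E := E.continuous
  let e : v.Completion ≃+* M :=
    { toFun := fun y => (E y).ofVal
      invFun := fun m => E.symm (WithVal.toVal w m)
      left_inv := fun y => by simp
      right_inv := fun m => by simp
      map_add' := fun a b => by
        have key : E (a + b) = E a + E b :=
          UniformSpace.Completion.induction_on₂ a b
            (isClosed_eq (by fun_prop) (by fun_prop)) fun a b => by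
              rw [← UniformSpace.Completion.coe_add, hE, hE, hE]
              simp [i]
        rw [key, WithVal.ofVal_add]
      map_mul' := fun a b => by
        have key : E (a * b) = E a * E b :=
          UniformSpace.Completion.induction_on₂ a b
            (isClosed_eq (by fun_prop) (by fun_prop)) fun a b => by
              rw [← UniformSpace.Completion.coe_mul, hE, hE, hE]
              simp [i]
        rw [key, WithVal.ofVal_mul] }
  refine ⟨e, fun x => ?_, fun y => ?_⟩
  · change (E _).ofVal = _
    erw [hE]
    rfl
  · have h1 : y ∈ completedValuationRing v ↔
        E y ∈ closure (E '' ((fun x : K => (x : v.Completion)) '' {x | v x ≤ 1})) := by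
      have := E.toHomeomorph.image_closure ((fun x : K => (x : v.Completion)) '' {x | v x ≤ 1})
      change E '' _ = closure (E '' _) at this
      rw [← this, E.injective.mem_set_image]
      rfl
    have h2 : E '' ((fun x : K => (x : v.Completion)) '' {x | v x ≤ 1}) =
        (fun x : K => WithVal.toVal w (ι x)) '' {x | v x ≤ 1} := by
      rw [Set.image_image]
      refine Set.image_congr fun x _ => ?_
      exact hE (WithVal.toVal v x)
    rw [h1, h2, mem_closure_iff_nhds_basis (hasBasis_nhds_withVal hw _)]
    change _ ↔ w (E y).ofVal ≤ 1
    generalize E y = m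
    constructor
    · intro h
      -- An approximation to within `exp 0 = 1` is enough, since the unit ball is a subgroup.
      obtain ⟨_, ⟨x, hx, rfl⟩, hx'⟩ := h 0 trivial
      have hx2 : w (ι x - m.ofVal) ≤ 1 := by simpa using hx'
      have : m.ofVal = ι x - (ι x - m.ofVal) := by ring
      rw [this]
      exact (w.map_sub _ _).trans (max_le (by rw [hι]; exact hx) hx2)
    · intro h n _
      obtain ⟨x, hx⟩ := hd m.ofVal n
      refine ⟨_, ⟨x, ?_, rfl⟩, ?_⟩
      · change v x ≤ 1
        have : ι x = m.ofVal - (m.ofVal - ι x) := by ring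
        rw [← hι, this]
        refine (w.map_sub _ _).trans (max_le h (hx.trans ?_))
        rw [← WithZero.exp_zero, WithZero.exp_le_exp]; omega
      · change w (ι x - m.ofVal) ≤ _
        rw [Valuation.map_sub_swap]; exact hx

/-- A normalized discrete valuation of a field is determined by its valuation ring. -/
theorem eq_of_forall_le_one_iff {K : Type*} [CommRing K] (hK : IsField K) {v v' : Valuation K ℤᵐ⁰}
    (hv : Function.Surjective v) (hv' : Function.Surjective v')
    (h : ∀ x, v x ≤ 1 ↔ v' x ≤ 1) : v = v' := by
  have hinv : ∀ x : K, x ≠ 0 → ∃ y, x * y = 1 := fun x hx => hK.mul_inv_cancel hx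
  -- Dividing by `y` turns a comparison of values into membership in the valuation ring.
  have h1 : ∀ x y, y ≠ 0 → (v x ≤ v y ↔ v' x ≤ v' y) := by
    intro x y hy
    obtain ⟨z, hz⟩ := hinv y hy
    have e1 : v y * v z = 1 := by rw [← map_mul, hz, map_one]
    have e2 : v' y * v' z = 1 := by rw [← map_mul, hz, map_one]
    have p1 : 0 < v z := zero_lt_iff.mpr (right_ne_zero_of_mul_eq_one e1)
    have p2 : 0 < v' z := zero_lt_iff.mpr (right_ne_zero_of_mul_eq_one e2)
    rw [← mul_le_mul_iff_left₀ p1, e1, ← map_mul, h, ← mul_le_mul_iff_left₀ p2 (b := v' x), e2,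
      map_mul]
  have hne : ∀ (u : Valuation K ℤᵐ⁰) x, u x ≠ 0 → x ≠ 0 := fun u x hx h0 => hx (by rw [h0, map_zero])
  have hne' : ∀ (u : Valuation K ℤᵐ⁰) x, x ≠ 0 → u x ≠ 0 := fun u x hx h0 => by
    obtain ⟨z, hz⟩ := hinv x hx
    have := congrArg u hz
    rw [map_mul, h0, zero_mul, map_one] at this
    exact zero_ne_one this
  obtain ⟨p, hp⟩ := hv (WithZero.exp (-1))
  obtain ⟨q, hq⟩ := hv' (WithZero.exp (-1))
  have hp0 : p ≠ 0 := hne v p (by rw [hp]; exact WithZero.exp_ne_zero)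
  have hq0 : q ≠ 0 := hne v' q (by rw [hq]; exact WithZero.exp_ne_zero)
  have := hK.nontrivial
  have hlt : ∀ x, v x < 1 ↔ v' x < 1 := by
    intro x
    rcases eq_or_ne x 0 with rfl | hx
    · simp
    · have := h1 1 x hx
      rw [map_one, map_one] at this
      rw [← not_le, ← not_le, this]
  -- `exp (-1)` is the largest value below `1`, so the two valuations have the same uniformizers;
  -- they then agree on powers of `p`, whose values exhaust the value group.
  have hpq : v' p = WithZero.exp (-1) := by
    apply le_antisymm
    · rw [← lt_one_iff_le, ← hlt, lt_one_iff_le, hp]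
    · rw [← hq, ← h1 q p hp0, hp, ← lt_one_iff_le, hlt, lt_one_iff_le, hq]
  obtain ⟨r, hr⟩ := hinv p hp0
  have hy : ∀ n : ℤ, ∃ y, v y = WithZero.exp n ∧ v' y = WithZero.exp n := by
    have hr' : ∀ u : Valuation K ℤᵐ⁰, u p = WithZero.exp (-1) → u r = WithZero.exp 1 := by
      intro u hu
      have : u p * u r = 1 := by rw [← map_mul, hr, map_one]
      rw [eq_inv_of_mul_eq_one_right this, hu, ← WithZero.exp_neg, neg_neg]
    intro n
    obtain ⟨k, rfl | rfl⟩ := n.eq_nat_or_neg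
    · exact ⟨r ^ k, by simp [hr' v hp, ← WithZero.exp_nsmul], by simp [hr' v' hpq, ← WithZero.exp_nsmul]⟩
    · exact ⟨p ^ k, by simp [hp, ← WithZero.exp_nsmul], by simp [hpq, ← WithZero.exp_nsmul]⟩
  ext x
  rcases eq_or_ne x 0 with rfl | hx
  · simp
  obtain ⟨y, h2, h3⟩ := hy (WithZero.log (v x))
  rw [WithZero.exp_log (hne' v x hx)] at h2 h3
  have hy0 : y ≠ 0 := hne v y (by rw [h2]; exact hne' v x hx)
  rw [← h3]
  exact le_antisymm ((h1 y x hx).mp h2.le) ((h1 x y hy0).mp h2.ge)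

end Valuation

/-! ### Completion of a field of fractions at a principal prime -/

namespace Valuation

variable {R K M : Type*} [CommRing R] [CommRing K] [CommRing M]

theorem surjective_of_eq_exp_neg_one (hM : IsField M) {w : Valuation M ℤᵐ⁰} {p : M}
    (hp : w p = WithZero.exp (-1)) : Function.Surjective w := by
  have hp0 : p ≠ 0 := fun h => by
    rw [h, map_zero] at hp; exact WithZero.exp_ne_zero hp.symm
  obtain ⟨r, hr⟩ := hM.mul_inv_cancel hp0
  have hr' : w r = WithZero.exp 1 := by
    have : w p * w r = 1 := by rw [← map_mul, hr, map_one]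
    rw [eq_inv_of_mul_eq_one_right this, hp, ← WithZero.exp_neg, neg_neg]
  intro c
  rcases eq_or_ne c 0 with rfl | hc
  · exact ⟨0, map_zero w⟩
  rw [← WithZero.exp_log hc]
  obtain ⟨k, hk | hk⟩ := (WithZero.log c).eq_nat_or_neg
  · exact ⟨r ^ k, by simp [hr', hk, ← WithZero.exp_nsmul]⟩
  · exact ⟨p ^ k, by simp [hp, hk, ← WithZero.exp_nsmul]⟩

theorem eq_zero_of_map_eq_zero (hM : IsField M) {w : Valuation M ℤᵐ⁰} {m : M} (h : w m = 0) :
    m = 0 := by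
  by_contra hm
  obtain ⟨r, hr⟩ := hM.mul_inv_cancel hm
  have := congrArg w hr
  rw [map_mul, h, zero_mul, map_one] at this
  exact zero_ne_one this

/-- Let `j : R → M` embed a domain `R` with fraction field `K` into a field `M` that is complete
with respect to a discrete valuation `w`. If `w` is at most `1` on `R`, the elements of `R` with
`w < 1` are the multiples of the uniformizer `π`, and the residue field of `M` is generated by `R`
as a field, then `M` is the completion of `K` with respect to the `π`-adic valuation. -/
theorem exists_adicCompletion_ringEquiv [IsDomain R] [Algebra R K] [IsFractionRing R K]
    (hM : IsField M) (j : R →+* M) (hj : Function.Injective j) (π : R) (w : Valuation M ℤᵐ⁰)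
    [CompleteSpace (WithVal w)] (hle : ∀ r, w (j r) ≤ 1) (hdvd : ∀ r, w (j r) < 1 → π ∣ r)
    (hπ : w (j π) = WithZero.exp (-1))
    (happ : ∀ m, w m ≤ 1 → ∃ r s, w (j s) = 1 ∧ w (j s * m - j r) < 1) :
    (Ideal.span {π}).IsPrime ∧ (∃ v, IsAdicValuation (algebraMap R K) (Ideal.span {π}) v) ∧
      ∀ v, IsAdicValuation (algebraMap R K) (Ideal.span {π}) v → ∃ e : v.Completion ≃+* M,
        (∀ r : R, e (algebraMap R K r) = j r) ∧ ∀ y, y ∈ completedValuationRing v ↔ w (e y) ≤ 1 := by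
  have hwsurj := surjective_of_eq_exp_neg_one hM hπ
  have hπ1 : w (j π) < 1 := by rw [hπ, ← WithZero.exp_zero, WithZero.exp_lt_exp]; norm_num
  have hmem : ∀ r, r ∈ Ideal.span {π} ↔ w (j r) < 1 := by
    intro r
    rw [Ideal.mem_span_singleton]
    refine ⟨?_, hdvd r⟩
    rintro ⟨s, rfl⟩
    rw [map_mul, map_mul]
    exact mul_lt_one_of_lt_of_le hπ1 (hle s)
  have hnmem : ∀ r, r ∉ Ideal.span {π} ↔ w (j r) = 1 := by
    intro r
    rw [hmem, not_lt]
    exact ⟨fun h => le_antisymm (hle r) h, fun h => h.ge⟩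
  have hK : IsField K := by
    let _ := IsFractionRing.toField R (K := K)
    exact Field.toIsField K
  have hjunit : ∀ r, r ≠ 0 → IsUnit (j r) := fun r hr => by
    obtain ⟨z, hz⟩ := hM.mul_inv_cancel ((map_ne_zero_iff j hj).mpr hr)
    exact IsUnit.of_mul_eq_one z hz
  let ι : K →+* M := IsLocalization.lift (M := nonZeroDivisors R) (g := j)
    fun y => hjunit _ (nonZeroDivisors.ne_zero y.2)
  have hι : ∀ r, ι (algebraMap R K r) = j r := fun r => IsLocalization.lift_eq _ r
  -- The exponent is `k = -log w(j r)`: each division by `π` lowers it by one, and at `k = 0` the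
  -- value is `1`.
  have hmodel : ∀ r, r ≠ 0 → ∃ k s, r = π ^ k * s ∧ w (j s) = 1 := by
    have aux : ∀ k : ℕ, ∀ r, w (j r) = WithZero.exp (-(k : ℤ)) →
        ∃ s, r = π ^ k * s ∧ w (j s) = 1 := by
      intro k
      induction k with
      | zero => exact fun r hr => ⟨r, by simp, by simpa using hr⟩
      | succ k ih =>
        intro r hr
        obtain ⟨s, rfl⟩ := hdvd r (by
          rw [hr, ← WithZero.exp_zero, WithZero.exp_lt_exp]; push_cast; omega)
        obtain ⟨t, rfl, ht⟩ := ih s (by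
          rw [map_mul, map_mul, hπ] at hr
          apply mul_left_cancel₀ (WithZero.exp_ne_zero (a := (-1 : ℤ)))
          rw [hr, ← WithZero.exp_add]
          congr 1; push_cast; ring)
        exact ⟨t, by ring, ht⟩
    intro r hr
    have h0 : w (j r) ≠ 0 := fun h =>
      hr (hj (by rw [eq_zero_of_map_eq_zero hM h, map_zero]))
    obtain ⟨s, hs⟩ := aux (-WithZero.log (w (j r))).toNat r (by
      have h1 := hle r
      rw [← WithZero.exp_log h0, ← WithZero.exp_zero, WithZero.exp_le_exp] at h1
      rw [Int.toNat_of_nonneg (by omega), neg_neg, WithZero.exp_log h0])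
    exact ⟨_, s, hs⟩
  -- The `π`-adic valuation is the restriction of `w`; any other candidate has the same valuation
  -- ring and therefore coincides with it.
  let v₀ : Valuation K ℤᵐ⁰ := w.comap ι
  have hv₀surj : Function.Surjective v₀ := by
    refine surjective_of_eq_exp_neg_one hK (p := algebraMap R K π) ?_
    change w (ι _) = _
    rw [hι, hπ]
  have hv₀ : ∀ x : K, v₀ x ≤ 1 ↔
      ∃ r s : R, s ∉ Ideal.span {π} ∧ algebraMap R K s * x = algebraMap R K r := by
    intro x
    change w (ι x) ≤ 1 ↔ _
    constructor
    · intro hx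
      obtain ⟨⟨a, b⟩, hab⟩ := IsLocalization.surj (nonZeroDivisors R) x
      simp only at hab
      rcases eq_or_ne a 0 with rfl | ha
      · refine ⟨0, 1, by rw [hnmem, map_one, map_one], ?_⟩
        rw [map_zero] at hab ⊢
        rw [map_one, one_mul]
        exact (IsLocalization.map_units K b).mul_left_eq_zero.mp hab
      obtain ⟨k, s, hb, hs⟩ := hmodel b (nonZeroDivisors.ne_zero b.2)
      obtain ⟨m, r, rfl, hr⟩ := hmodel a ha
      -- Since `w x ≤ 1`, the power of `π` in the denominator is at most that in the numerator and
      -- cancels, leaving a denominator outside `(π)`.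
      have hkm : k ≤ m := by
        have h1 := congrArg (fun y => w (ι y)) hab
        simp only [map_mul, hι, hb, hs, hr, mul_one, map_pow, hπ, ← WithZero.exp_nsmul] at h1
        by_contra! hlt
        have h2 : w (ι x) * WithZero.exp (k • (-1 : ℤ)) ≤ WithZero.exp (k • (-1 : ℤ)) :=
          mul_le_of_le_one_left' hx
        rw [h1, WithZero.exp_le_exp] at h2
        simp at h2
        omega
      obtain ⟨d, rfl⟩ := Nat.exists_eq_add_of_le hkm
      refine ⟨π ^ d * r, s, (hnmem s).mpr hs, ?_⟩
      have hu : IsUnit (algebraMap R K (π ^ k)) :=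
        IsLocalization.map_units K (⟨π ^ k, mem_nonZeroDivisors_of_ne_zero fun h0 => by
          rw [h0, zero_mul] at hb
          exact nonZeroDivisors.ne_zero b.2 hb⟩ : nonZeroDivisors R)
      apply hu.mul_left_cancel
      rw [hb, map_mul] at hab
      rw [← map_mul, ← mul_assoc (π ^ k), ← pow_add, ← hab]
      ring
    · rintro ⟨r, s, hs, h⟩
      have := congrArg (fun y => w (ι y)) h
      simp only [map_mul, hι, (hnmem s).mp hs, one_mul] at this
      rw [this]
      exact hle r
  refine ⟨⟨?_, ?_⟩, ⟨v₀, hv₀surj, hv₀⟩, ?_⟩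
  · rw [Ne, Ideal.eq_top_iff_one, hnmem, map_one, map_one]
  · intro a b hab
    rw [hmem, map_mul, map_mul] at hab
    by_contra! h
    rw [hnmem, hnmem] at h
    rw [h.1, h.2, one_mul] at hab
    exact lt_irrefl _ hab
  · rintro v ⟨hv, hv'⟩
    obtain rfl : v = v₀ := eq_of_forall_le_one_iff hK hv hv₀surj fun x => (hv' x).trans (hv₀ x).symm
    have h1 : ∀ m, w m ≤ 1 → ∃ x, w (m - ι x) < 1 := by
      intro m hm
      obtain ⟨r, s, hs, h⟩ := happ m hm
      have hs0 : algebraMap R K s ≠ 0 := by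
        intro h0
        have := hι s
        rw [h0, map_zero] at this
        rw [← this, map_zero] at hs
        exact zero_ne_one hs
      obtain ⟨t, ht⟩ := hK.mul_inv_cancel hs0
      refine ⟨algebraMap R K r * t, ?_⟩
      have e1 : w (m - ι (algebraMap R K r * t)) = w (j s) * w (m - ι (algebraMap R K r * t)) := by
        rw [hs, one_mul]
      rw [e1, ← map_mul, mul_sub, ← hι s, ← map_mul ι, mul_left_comm, ht, mul_one, hι, hι]
      exact h
    obtain ⟨q, hq⟩ : ∃ q, algebraMap R K π * q = 1 := by
      refine hK.mul_inv_cancel fun h0 => ?_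
      have := hι π
      rw [h0, map_zero] at this
      rw [← this, map_zero] at hπ
      exact WithZero.exp_ne_zero hπ.symm
    have hιq : w (ι q) = WithZero.exp 1 := by
      have : w (j π) * w (ι q) = 1 := by rw [← map_mul, ← hι, ← map_mul, hq, map_one, map_one]
      rw [eq_inv_of_mul_eq_one_right this, hπ, ← WithZero.exp_neg, neg_neg]
    -- Successive approximation: `h1` approximates modulo the maximal ideal, and the error divided
    -- by `π` is integral again.
    have h2 : ∀ n : ℕ, ∀ m, w m ≤ 1 → ∃ x, w (m - ι x) ≤ WithZero.exp (-(n : ℤ)) := by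
      intro n
      induction n with
      | zero => exact fun m hm => ⟨0, by simpa using hm⟩
      | succ n ih =>
        intro m hm
        obtain ⟨x, hx⟩ := h1 m hm
        obtain ⟨y, hy⟩ := ih ((m - ι x) * ι q) (by
          rw [map_mul, hιq]
          calc _ ≤ WithZero.exp (-1) * WithZero.exp 1 := mul_le_mul_left (lt_one_iff_le.mp hx) _
            _ = 1 := by rw [← WithZero.exp_add]; rfl)
        refine ⟨x + algebraMap R K π * y, ?_⟩
        have : m - ι (x + algebraMap R K π * y) = j π * ((m - ι x) * ι q - ι y) := by
          have hq' : j π * ι q = 1 := by rw [← hι, ← map_mul, hq, map_one]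
          rw [map_add, map_mul, hι]
          linear_combination -(m - ι x) * hq'
        rw [this, map_mul, hπ]
        calc _ ≤ WithZero.exp (-1) * WithZero.exp (-(n : ℤ)) := mul_le_mul_right hy _
          _ = _ := by rw [← WithZero.exp_add]; congr 1; push_cast; ring
    refine (exists_completion_ringEquiv (w := w) hv (fun m => eq_zero_of_map_eq_zero hM) ι
      (fun x => rfl) ?_).imp fun e he => ⟨fun r => (he.1 _).trans (hι r), he.2⟩
    intro m n
    -- A general `m` is made integral by `π ^ k`; approximating to order `n + k` compensates for
    -- dividing by it afterwards.
    obtain ⟨k, hk⟩ : ∃ k : ℕ, w m ≤ WithZero.exp (k : ℤ) := by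
      rcases eq_or_ne (w m) 0 with h0 | h0
      · exact ⟨0, by simp [h0]⟩
      · refine ⟨(WithZero.log (w m)).toNat, ?_⟩
        rw [← WithZero.exp_log h0, WithZero.exp_le_exp, WithZero.log_exp]; omega
    have hπk : w (j π ^ k) = WithZero.exp (-(k : ℤ)) := by
      rw [map_pow, hπ, ← WithZero.exp_nsmul]; simp
    have hqk : w (ι q ^ k) = WithZero.exp (k : ℤ) := by
      rw [map_pow, hιq, ← WithZero.exp_nsmul]; simp
    obtain ⟨x, hx⟩ := h2 (n + k) (j π ^ k * m) (by
      rw [map_mul, hπk]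
      calc _ ≤ WithZero.exp (-(k : ℤ)) * WithZero.exp (k : ℤ) := mul_le_mul_right hk _
        _ = 1 := by rw [← WithZero.exp_add, neg_add_cancel, WithZero.exp_zero])
    refine ⟨q ^ k * x, ?_⟩
    have hq' : ι q ^ k * j π ^ k = 1 := by
      rw [← mul_pow, mul_comm, ← hι, ← map_mul, hq, map_one, one_pow]
    have : m - ι (q ^ k * x) = ι q ^ k * (j π ^ k * m - ι x) := by
      rw [map_mul, map_pow]
      linear_combination -m * hq'
    rw [this, map_mul, hqk]
    calc _ ≤ WithZero.exp (k : ℤ) * WithZero.exp (-((n + k : ℕ) : ℤ)) := mul_le_mul_right hx _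
      _ = _ := by rw [← WithZero.exp_add]; congr 1; push_cast; ring

end Valuation

/-! ### Higher local fields -/

namespace IsLocalFieldOfDim

theorem congr (n : ℕ) : ∀ {Q : Type*} {Q' : Type*} [CommRing Q] [CommRing Q'],
    Q ≃+* Q' → IsLocalFieldOfDim n Q → IsLocalFieldOfDim n Q' := by
  induction n with
  | zero =>
    intro Q Q' _ _ e h
    have := h.2
    exact ⟨e.symm.toMulEquiv.isField h.1, Finite.of_equiv Q e.toEquiv⟩
  | succ n ih =>
    rintro Q Q' _ _ e ⟨hQ, w, hw, hc, hres⟩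
    let w' : Valuation Q' ℤᵐ⁰ := w.comap (e.symm : Q' →+* Q)
    have hw' : Function.Surjective w' := fun c => by
      obtain ⟨x, hx⟩ := hw c
      exact ⟨e x, by change w (e.symm (e x)) = c; rw [e.symm_apply_apply, hx]⟩
    refine ⟨e.symm.toMulEquiv.isField hQ, w', hw', ?_, ?_⟩
    · refine Valuation.completeSpace_withVal hw' fun x hx => ?_
      obtain ⟨y, hy⟩ := Valuation.exists_limit_of_completeSpace hw (fun n => e.symm (x n))
        fun n => by rw [← map_sub]; exact hx n
      refine ⟨e y, fun n => ?_⟩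
      change w (e.symm (e y - x n)) ≤ _
      rw [map_sub, e.symm_apply_apply]
      exact hy n
    · let ρ : w.integer →+* w'.integer :=
        ((e : Q →+* Q').comp w.integer.subtype).codRestrict w'.integer fun x => by
          change w (e.symm (e x)) ≤ 1
          rw [e.symm_apply_apply]; exact x.2
      have hρ : Function.Surjective ρ := fun y => ⟨⟨e.symm y, y.2⟩, Subtype.ext (e.apply_symm_apply _)⟩
      let ρ' := (Ideal.Quotient.mk (w'.ltIdeal 1)).comp ρ
      have hker : RingHom.ker ρ' = w.ltIdeal 1 := by
        ext x
        rw [RingHom.mem_ker, RingHom.comp_apply, Ideal.Quotient.eq_zero_iff_mem,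
          Valuation.mem_ltIdeal_iff, Valuation.mem_ltIdeal_iff]
        change w (e.symm (e x)) < 1 ↔ _
        rw [e.symm_apply_apply]; rfl
      exact ih ((Ideal.quotEquivOfEq hker.symm).trans (RingHom.quotientKerEquivOfSurjective
        (Ideal.Quotient.mk_surjective.comp hρ))) hres

/-- Allows the residue field to be any surjective image of the valuation ring with the right kernel,
instead of the literal quotient in the definition. -/
theorem succ {n : ℕ} {Q k : Type*} [CommRing Q] [CommRing k] (hQ : IsField Q)
    {w : Valuation Q ℤᵐ⁰} (hw : Function.Surjective w) (hc : CompleteSpace (WithVal w))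
    (ρ : w.integer →+* k) (hρ : Function.Surjective ρ) (hker : ∀ x, ρ x = 0 ↔ w x < 1)
    (hk : IsLocalFieldOfDim n k) : IsLocalFieldOfDim (n + 1) Q := by
  refine ⟨hQ, w, hw, hc, congr n ?_ hk⟩
  have hker' : RingHom.ker ρ = w.ltIdeal 1 := by
    ext x
    rw [RingHom.mem_ker, hker, Valuation.mem_ltIdeal_iff]; rfl
  exact ((Ideal.quotEquivOfEq hker'.symm).trans (RingHom.quotientKerEquivOfSurjective hρ)).symm

end IsLocalFieldOfDim

/-! ### Laurent series -/

namespace LaurentSeries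

variable {k : Type*} [Field k]

theorem completeSpace_withVal : CompleteSpace (WithVal (Valued.v : Valuation k⸨X⸩ ℤᵐ⁰)) := by
  refine Valuation.completeSpace_withVal (valuation_surjective k) fun x hx => ?_
  simp only [valuation_le_iff_coeff_lt_eq_zero] at hx
  have hstep : ∀ (n m : ℕ) (i : ℤ), i < n → (x (n + m)).coeff i = (x n).coeff i := by
    intro n m i hi
    induction m with
    | zero => rfl
    | succ m ih =>
      have := hx (n + m) i (by push_cast; omega)
      rw [HahnSeries.coeff_sub, sub_eq_zero] at this
      rw [← add_assoc, this, ih]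
  -- The coefficient of index `i ≥ 0` is constant from `x (i + 1)` on, and those of negative index
  -- already from `x 0` on.
  refine ⟨x 0 + HahnSeries.ofPowerSeries ℤ k (PowerSeries.mk fun i => (x (i + 1) - x 0).coeff i),
    fun n => ?_⟩
  rw [valuation_le_iff_coeff_lt_eq_zero]
  intro i hi
  rw [HahnSeries.coeff_sub, HahnSeries.coeff_add, sub_eq_zero, PowerSeries.coeff_coe]
  split_ifs with h
  · rw [add_zero]
    simpa using (hstep 0 n i (by simpa using h)).symm
  · lift i to ℕ using (not_lt.mp h)
    rw [Int.natAbs_natCast, PowerSeries.coeff_mk, HahnSeries.coeff_sub, add_sub_cancel]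
    obtain ⟨d, rfl⟩ := Nat.exists_eq_add_of_le (show i + 1 ≤ n by exact_mod_cast hi)
    exact (hstep (i + 1) d i (by push_cast; omega)).symm

theorem mem_range_ofPowerSeries_iff (f : k⸨X⸩) :
    f ∈ (HahnSeries.ofPowerSeries ℤ k).range ↔ Valued.v f ≤ (1 : ℤᵐ⁰) := by
  rw [val_le_one_iff_eq_coe]; rfl

theorem valuation_ofPowerSeries_lt_one_iff (F : k⟦X⟧) :
    Valued.v (HahnSeries.ofPowerSeries ℤ k F) < (1 : ℤᵐ⁰) ↔ PowerSeries.constantCoeff F = 0 := by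
  rw [Valuation.lt_one_iff_le, valuation_le_iff_coeff_lt_eq_zero]
  constructor
  · intro h
    simpa [PowerSeries.coeff_coe] using h 0 zero_lt_one
  · intro h n hn
    rw [PowerSeries.coeff_coe]
    split_ifs with h0
    · rfl
    · obtain rfl : n = 0 := by omega
      simpa using h

/-- The constant coefficient, as a map from the valuation ring to the residue field. -/
def integerToResidue : (Valued.v : Valuation k⸨X⸩ ℤᵐ⁰).integer →+* k where
  toFun x := x.1.coeff 0
  map_one' := by simp
  map_zero' := rfl
  map_add' x y := by simp
  map_mul' x y := by
    obtain ⟨F, hF⟩ := (val_le_one_iff_eq_coe k x.1).mp x.2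
    obtain ⟨G, hG⟩ := (val_le_one_iff_eq_coe k y.1).mp y.2
    rw [Subring.coe_mul, ← hF, ← hG, ← map_mul, PowerSeries.coeff_coe, PowerSeries.coeff_coe,
      PowerSeries.coeff_coe]
    simp

theorem _root_.IsLocalFieldOfDim.laurentSeries {n : ℕ} (hk : IsLocalFieldOfDim n k) :
    IsLocalFieldOfDim (n + 1) k⸨X⸩ := by
  refine IsLocalFieldOfDim.succ (Field.toIsField _) (valuation_surjective k)
    completeSpace_withVal integerToResidue (fun a => ?_) (fun x => ?_) hk
  · refine ⟨⟨HahnSeries.ofPowerSeries ℤ k (PowerSeries.C a),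
      (val_le_one_iff_eq_coe k _).mpr ⟨_, rfl⟩⟩, ?_⟩
    change (HahnSeries.ofPowerSeries ℤ k (PowerSeries.C a)).coeff 0 = a
    simp
  · obtain ⟨F, hF⟩ := (val_le_one_iff_eq_coe k x.1).mp x.2
    change x.1.coeff 0 = 0 ↔ _
    rw [← hF, valuation_ofPowerSeries_lt_one_iff, PowerSeries.coeff_coe]
    simp

end LaurentSeries

/-! ### Finite extensions of `ℚ_l` -/

section AdicSequences

variable {R : Type*} [CommRing R] {p : R}

/-- A sequential form of precompleteness, parallel to the criterion for valuations, in which only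
consecutive terms are compared. -/
theorem IsPrecomplete.exists_limit (h : IsPrecomplete (Ideal.span {p}) R) (x : ℕ → R)
    (hx : ∀ n, p ^ n ∣ x (n + 1) - x n) : ∃ y, ∀ n, p ^ n ∣ y - x n := by
  have key : ∀ m k, p ^ m ∣ x (m + k) - x m := by
    intro m k
    induction k with
    | zero => simp
    | succ k ih =>
      have := ((pow_dvd_pow p (Nat.le_add_right m k)).trans (hx (m + k))).add ih
      simpa [← add_assoc] using this
  obtain ⟨y, hy⟩ := h.prec (f := x) fun {m n} hmn => by
    obtain ⟨k, rfl⟩ := Nat.exists_eq_add_of_le hmn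
    rw [SModEq.sub_mem, smul_eq_mul, Ideal.mul_top, Ideal.span_singleton_pow,
      Ideal.mem_span_singleton, ← neg_sub, dvd_neg]
    exact key m k
  refine ⟨y, fun n => ?_⟩
  have := hy n
  rwa [SModEq.sub_mem, smul_eq_mul, Ideal.mul_top, Ideal.span_singleton_pow,
      Ideal.mem_span_singleton, ← neg_sub, dvd_neg] at this

theorem IsPrecomplete.of_exists_limit (h : ∀ x : ℕ → R, (∀ n, p ^ n ∣ x (n + 1) - x n) →
    ∃ y, ∀ n, p ^ n ∣ y - x n) : IsPrecomplete (Ideal.span {p}) R := by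
  refine ⟨fun x hx => ?_⟩
  simp only [SModEq.sub_mem, smul_eq_mul, Ideal.mul_top, Ideal.span_singleton_pow,
      Ideal.mem_span_singleton] at hx ⊢
  obtain ⟨y, hy⟩ := h x fun n => by
    rw [← neg_sub, dvd_neg]; exact hx n.le_succ
  refine ⟨y, fun n => ?_⟩
  rw [← neg_sub, dvd_neg]; exact hy n

/-- A finite free algebra over a `p`-adically complete ring is `p`-adically complete. -/
theorem IsPrecomplete.exists_limit_of_free (h : IsPrecomplete (Ideal.span {p}) R) {A : Type*}
    [CommRing A] [Algebra R A] [Module.Finite R A] [Module.Free R A] (x : ℕ → A)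
    (hx : ∀ n, algebraMap R A p ^ n ∣ x (n + 1) - x n) :
    ∃ y, ∀ n, algebraMap R A p ^ n ∣ y - x n := by
  let b := Module.Free.chooseBasis R A
  have h1 : ∀ i n, p ^ n ∣ b.repr (x (n + 1)) i - b.repr (x n) i := by
    intro i n
    obtain ⟨z, hz⟩ := hx n
    rw [← map_pow, ← Algebra.smul_def] at hz
    refine ⟨b.repr z i, ?_⟩
    rw [← Finsupp.sub_apply, ← map_sub, hz, map_smul, Finsupp.smul_apply, smul_eq_mul]
  choose c hc using fun i => h.exists_limit (fun n => b.repr (x n) i) (h1 i)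
  choose d hd using hc
  refine ⟨∑ i, c i • b i, fun n => ⟨∑ i, d i n • b i, ?_⟩⟩
  rw [← map_pow, ← Algebra.smul_def, Finset.smul_sum]
  conv_lhs => rw [← b.sum_repr (x n)]
  rw [← Finset.sum_sub_distrib]
  refine Finset.sum_congr rfl fun i _ => ?_
  rw [← sub_smul, hd, mul_smul]

end AdicSequences

namespace PadicExtension

/-! ### The ring of integers is a discrete valuation ring -/

section Valuation

variable (l : ℕ) [Fact l.Prime] (F : Type*) [Field F] [Algebra ℚ_[l] F]
  [Algebra ℤ_[l] F] [IsScalarTower ℤ_[l] ℚ_[l] F]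

theorem algebraMap_injective : Function.Injective (algebraMap ℤ_[l] F) := by
  rw [IsScalarTower.algebraMap_eq ℤ_[l] ℚ_[l] F]
  exact (algebraMap ℚ_[l] F).injective.comp (IsFractionRing.injective ℤ_[l] ℚ_[l])

instance : Module.IsTorsionFree ℤ_[l] F :=
  Module.IsTorsionFree.trans_faithfulSMul ℤ_[l] ℚ_[l] F

variable {F} in
-- Otherwise `1 / l` would be integral over the integrally closed ring `ℤ_l`, hence in it, although
-- its norm `l` exceeds `1`.
theorem algebraMap_prime_not_isUnit : ¬ IsUnit ((l : integralClosure ℤ_[l] F)) := by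
  intro h
  obtain ⟨y, hy⟩ := h.exists_right_inv
  have : IsIntegral ℤ_[l] (algebraMap ℚ_[l] F (l : ℚ_[l])⁻¹) := by
    have : algebraMap ℚ_[l] F (l : ℚ_[l])⁻¹ = (y : F) := by
      have h2 := congrArg Subtype.val hy
      rw [map_inv₀, map_natCast]
      exact inv_eq_of_mul_eq_one_right (by simpa using h2)
    rw [this]; exact y.2
  rw [isIntegral_algebraMap_iff (algebraMap ℚ_[l] F).injective] at this
  obtain ⟨z, hz⟩ := IsIntegrallyClosed.isIntegral_iff.mp this
  have h3 := PadicInt.norm_le_one z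
  rw [← PadicInt.padic_norm_e_of_padicInt] at h3
  have h4 : (z : ℚ_[l]) = (l : ℚ_[l])⁻¹ := hz
  rw [h4, norm_inv, Padic.norm_p, inv_inv] at h3
  have := (Fact.out : l.Prime).one_lt
  have : (1 : ℝ) < l := by exact_mod_cast this
  linarith

variable [FiniteDimensional ℚ_[l] F]

instance : Module.Finite ℤ_[l] (integralClosure ℤ_[l] F) :=
  IsIntegralClosure.finite ℤ_[l] ℚ_[l] F _

instance : Module.Free ℤ_[l] (integralClosure ℤ_[l] F) :=
  IsIntegralClosure.module_free ℤ_[l] ℚ_[l] F _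

instance : IsFractionRing (integralClosure ℤ_[l] F) F :=
  IsIntegralClosure.isFractionRing_of_finite_extension ℤ_[l] ℚ_[l] F _

instance : IsDedekindDomain (integralClosure ℤ_[l] F) :=
  IsIntegralClosure.isDedekindDomain ℤ_[l] ℚ_[l] F _

variable {F}

/-- Both conditions say that the minimal polynomial over `ℚ_l` has coefficients in `ℤ_l`. -/
theorem mem_integralClosure_iff_spectralNorm_le_one (x : F) :
    x ∈ integralClosure ℤ_[l] F ↔ spectralNorm ℚ_[l] F x ≤ 1 := by
  have hx : IsIntegral ℚ_[l] x := Algebra.IsIntegral.isIntegral x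
  rw [spectralNorm, spectralValue_le_one_iff (minpoly.monic hx)]
  constructor
  · intro h n
    rw [minpoly.isIntegrallyClosed_eq_field_fractions' ℚ_[l] h, Polynomial.coeff_map]
    exact PadicInt.norm_le_one _
  · intro h
    have hl : minpoly ℚ_[l] x ∈ Polynomial.lifts (algebraMap ℤ_[l] ℚ_[l]) := by
      rw [Polynomial.lifts_iff_coeff_lifts]
      exact fun n => ⟨⟨_, h n⟩, rfl⟩
    obtain ⟨q, hq, -, hmonic⟩ :=
      Polynomial.lifts_and_degree_eq_and_monic hl (minpoly.monic hx)
    refine ⟨q, hmonic, ?_⟩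
    rw [← Polynomial.aeval_def, ← Polynomial.aeval_map_algebraMap ℚ_[l], hq, minpoly.aeval]

/-- The spectral norm is multiplicative and ultrametric. Hence units are the integral elements of
norm at least `1`, and a sum can be a unit only if a summand is. -/
instance : IsLocalRing (integralClosure ℤ_[l] F) := by
  have hm : ∀ x y : F, spectralNorm ℚ_[l] F (x * y) =
      spectralNorm ℚ_[l] F x * spectralNorm ℚ_[l] F y := fun x y =>
    map_mul (spectralMulAlgNorm ℚ_[l] F) x y
  have hu : ∀ x : integralClosure ℤ_[l] F, 1 ≤ spectralNorm ℚ_[l] F x → IsUnit x := by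
    intro x hx
    have hx0 : (x : F) ≠ 0 := fun h => by
      rw [h, spectralNorm_zero] at hx; exact absurd hx (by norm_num)
    have h1 : spectralNorm ℚ_[l] F (x : F) * spectralNorm ℚ_[l] F (x : F)⁻¹ = 1 := by
      rw [← hm, mul_inv_cancel₀ hx0]
      exact spectralNorm_one
    have h2 : (x : F)⁻¹ ∈ integralClosure ℤ_[l] F := by
      rw [mem_integralClosure_iff_spectralNorm_le_one]
      nlinarith [spectralNorm_nonneg (K := ℚ_[l]) (x : F)⁻¹]
    exact IsUnit.of_mul_eq_one ⟨_, h2⟩ (Subtype.ext (mul_inv_cancel₀ hx0))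
  have hlt : ∀ x : integralClosure ℤ_[l] F, IsUnit x → 1 ≤ spectralNorm ℚ_[l] F x := by
    intro x hx
    obtain ⟨y, hy⟩ := hx.exists_right_inv
    have h1 : spectralNorm ℚ_[l] F (x : F) * spectralNorm ℚ_[l] F (y : F) = 1 := by
      rw [← hm, show (x : F) * y = 1 from congrArg Subtype.val hy]
      exact spectralNorm_one
    have h2 := (mem_integralClosure_iff_spectralNorm_le_one l (y : F)).mp y.2
    nlinarith [spectralNorm_nonneg (K := ℚ_[l]) (x : F), spectralNorm_nonneg (K := ℚ_[l]) (y : F)]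
  refine IsLocalRing.of_isUnit_or_isUnit_of_isUnit_add fun a b hab => ?_
  have h1 : spectralNorm ℚ_[l] F ((a : F) + b) ≤ max _ _ :=
    isNonarchimedean_spectralNorm (a : F) (b : F)
  rcases le_max_iff.mp ((hlt _ hab).trans h1) with h | h
  · exact Or.inl (hu _ h)
  · exact Or.inr (hu _ h)

/-- A local Dedekind domain that is not a field, as `l` is a nonzero nonunit. -/
instance : IsDiscreteValuationRing (integralClosure ℤ_[l] F) := by
  have hf : ¬ IsField (integralClosure ℤ_[l] F) := fun h => by
    have h0 : (l : integralClosure ℤ_[l] F) ≠ 0 := by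
      intro h0
      have : algebraMap ℤ_[l] F l = algebraMap ℤ_[l] F 0 := by
        rw [map_natCast, map_zero]
        simpa using congrArg Subtype.val h0
      have := algebraMap_injective l F this
      exact (Fact.out : l.Prime).ne_zero (by exact_mod_cast this)
    obtain ⟨y, hy⟩ := h.mul_inv_cancel h0
    exact algebraMap_prime_not_isUnit l (IsUnit.of_mul_eq_one y hy)
  exact ((IsDiscreteValuationRing.TFAE (integralClosure ℤ_[l] F) hf).out 0 2).mpr
    (inferInstance : IsDedekindDomain (integralClosure ℤ_[l] F))

variable (F) in
-- Needed for the field generated by a zero of `f`, which, unlike `L`, comes without a chosen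
-- valuation.
theorem exists_valuation : ∃ v : Valuation F ℤᵐ⁰, Function.Surjective v ∧
    ∀ x, v x ≤ 1 ↔ x ∈ integralClosure ℤ_[l] F := by
  refine ⟨(IsDiscreteValuationRing.maximalIdeal (integralClosure ℤ_[l] F)).valuation F,
    IsDedekindDomain.HeightOneSpectrum.valuation_surjective F _, fun x => ⟨fun h => ?_, fun h => ?_⟩⟩
  · obtain ⟨a, rfl⟩ := IsDiscreteValuationRing.exists_lift_of_le_one h
    exact a.2
  · exact IsDedekindDomain.HeightOneSpectrum.valuation_le_one _ (⟨x, h⟩ : integralClosure ℤ_[l] F)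

end Valuation

/-! ### Completeness and finiteness of the residue field -/

section Complete

variable {l : ℕ} [Fact l.Prime] {F : Type*} [Field F] [Algebra ℤ_[l] F]
  {v : Valuation F ℤᵐ⁰} (hv : Function.Surjective v)
  (hint : ∀ x, v x ≤ 1 ↔ x ∈ integralClosure ℤ_[l] F)

include hint in
theorem isUnit_iff (x : integralClosure ℤ_[l] F) : IsUnit x ↔ v x = 1 := by
  constructor
  · intro h
    obtain ⟨y, hy⟩ := h.exists_right_inv
    have h1 : v x * v y = 1 := by
      rw [← map_mul, show (x : F) * y = 1 from congrArg Subtype.val hy, map_one]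
    refine le_antisymm ((hint _).mpr x.2) ?_
    rw [← h1]
    exact mul_le_of_le_one_right' ((hint _).mpr y.2)
  · intro h
    have hx0 : (x : F) ≠ 0 := fun h0 => by rw [h0, map_zero] at h; exact zero_ne_one h
    exact IsUnit.of_mul_eq_one ⟨(x : F)⁻¹, (hint _).mp (by rw [map_inv₀, h, inv_one])⟩
      (Subtype.ext (mul_inv_cancel₀ hx0))

include hint in
theorem dvd_iff (x y : integralClosure ℤ_[l] F) (hy : y ≠ 0) : y ∣ x ↔ v x ≤ v y := by
  have hy0 : (y : F) ≠ 0 := fun h => hy (Subtype.ext h)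
  constructor
  · rintro ⟨z, rfl⟩
    rw [Subalgebra.coe_mul, map_mul]
    exact mul_le_of_le_one_right' ((hint _).mpr z.2)
  · intro h
    refine ⟨⟨(x : F) / y, (hint _).mp ?_⟩, Subtype.ext ?_⟩
    · rw [map_div₀]
      exact div_le_one_of_le₀ h zero_le
    · change (x : F) = y * (x / y)
      rw [mul_div_cancel₀ _ hy0]

variable [Algebra ℚ_[l] F] [IsScalarTower ℤ_[l] ℚ_[l] F]

include hint in
-- `e` is the ramification index; it is positive because `l` is not a unit.
theorem exists_map_prime_eq : ∃ e : ℕ, 1 ≤ e ∧ v (l : F) = WithZero.exp (-(e : ℤ)) := by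
  have h0 : (l : F) ≠ 0 := by
    have := algebraMap_injective l F
    intro h
    have h1 : algebraMap ℤ_[l] F l = algebraMap ℤ_[l] F 0 := by rw [map_natCast, map_zero, h]
    exact (Fact.out : l.Prime).ne_zero (by exact_mod_cast this h1)
  have hne : v (l : F) ≠ 0 := (Valuation.ne_zero_iff v).mpr h0
  have h1 : v (l : F) < 1 := by
    refine lt_of_le_of_ne ((hint _).mpr (natCast_mem _ l)) fun h => ?_
    exact algebraMap_prime_not_isUnit (F := F) l ((isUnit_iff hint _).mpr (by simpa using h))
  rw [Valuation.lt_one_iff_le, ← WithZero.exp_log hne, WithZero.exp_le_exp] at h1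
  refine ⟨(-WithZero.log (v (l : F))).toNat, by omega, ?_⟩
  rw [Int.toNat_of_nonneg (by omega), neg_neg, WithZero.exp_log hne]

variable (l) in
theorem isPrecomplete_padicInt : IsPrecomplete (Ideal.span {(l : ℤ_[l])}) ℤ_[l] := by
  rw [← PadicInt.maximalIdeal_eq_span_p]
  infer_instance

variable [FiniteDimensional ℚ_[l] F]

include hv hint in
-- The ring of integers is finite free over `ℤ_l`, hence `l`-adically complete, and `v l = exp (-e)`
-- compares the `l`-adic filtration with that of `v`.
theorem completeSpace_withVal : CompleteSpace (WithVal v) := by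
  obtain ⟨e, he1, he⟩ := exists_map_prime_eq hint
  have hpow : ∀ k : ℕ, v ((l : F) ^ k) = WithZero.exp (-((e * k : ℕ) : ℤ)) := by
    intro k
    rw [map_pow, he, ← WithZero.exp_nsmul]
    congr 1
    simp; ring
  have hl0 : ∀ k : ℕ, (l : integralClosure ℤ_[l] F) ^ k ≠ 0 := fun k h => by
    have h2 := hpow k
    have h3 : (l : F) ^ k = 0 := by simpa using congrArg Subtype.val h
    rw [h3, map_zero] at h2
    exact WithZero.exp_ne_zero h2.symm
  refine Valuation.completeSpace_withVal hv fun x hx => ?_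
  have key : ∀ n k, v (x (n + k) - x n) ≤ WithZero.exp (-(n : ℤ)) := by
    intro n k
    induction k with
    | zero => simp
    | succ k ih =>
      have : x (n + (k + 1)) - x n = (x (n + k + 1) - x (n + k)) + (x (n + k) - x n) := by
        rw [add_assoc]; ring
      rw [this]
      refine (v.map_add _ _).trans (max_le ((hx _).trans ?_) ih)
      rw [WithZero.exp_le_exp]; push_cast; omega
  -- Subtracting `x 0` makes the terms integral, and passing to every `e`-th term makes consecutive
  -- differences divisible by `l ^ k`.
  let a : ℕ → integralClosure ℤ_[l] F := fun k => ⟨x (e * k) - x 0, (hint _).mp (by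
    simpa using key 0 (e * k))⟩
  obtain ⟨y, hy⟩ := (isPrecomplete_padicInt l).exists_limit_of_free a fun k => by
    rw [map_natCast, dvd_iff hint _ _ (hl0 k)]
    have : ((a (k + 1) - a k : integralClosure ℤ_[l] F) : F) = x (e * k + e) - x (e * k) := by
      simp only [a, Subalgebra.coe_sub, mul_add, mul_one]; ring
    rw [this]
    refine (key _ _).trans ?_
    rw [← hpow]; simp
  refine ⟨y + x 0, fun n => ?_⟩
  have h1 := hy n
  rw [map_natCast, dvd_iff hint _ _ (hl0 n)] at h1
  -- Since `e * n ≥ n`, the subsequence is at least as close to the limit as required at stage `n`.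
  have h2 : (y : F) + x 0 - x n =
      ((y - a n : integralClosure ℤ_[l] F) : F) + (x (e * n) - x n) := by
    simp only [a, Subalgebra.coe_sub]; ring
  rw [h2]
  refine (v.map_add _ _).trans (max_le (h1.trans ?_) ?_)
  · have := hpow n
    rw [Subalgebra.coe_pow, show ((l : integralClosure ℤ_[l] F) : F) = l from rfl, this, WithZero.exp_le_exp, neg_le_neg_iff]
    exact_mod_cast Nat.le_mul_of_pos_left n he1
  · obtain ⟨d, hd⟩ := Nat.exists_eq_add_of_le (Nat.le_mul_of_pos_left n he1)
    rw [hd]; exact key n d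

include hv hint in
-- The hypothesis under which Weierstrass division over the ring of integers is available.
-- Separatedness is Krull's intersection theorem.
theorem isAdicComplete {ϖ : integralClosure ℤ_[l] F} (hϖ : v (ϖ : F) = WithZero.exp (-1)) :
    IsAdicComplete (Ideal.span {ϖ}) (integralClosure ℤ_[l] F) := by
  have := completeSpace_withVal hv hint
  have hϖ0 : ∀ n : ℕ, ϖ ^ n ≠ 0 := fun n => pow_ne_zero n fun h => by
    rw [h, Subalgebra.coe_zero, map_zero] at hϖ
    exact WithZero.exp_ne_zero hϖ.symm
  have hpow : ∀ n : ℕ, v ((ϖ ^ n : integralClosure ℤ_[l] F) : F) = WithZero.exp (-(n : ℤ)) := by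
    intro n
    rw [Subalgebra.coe_pow, map_pow, hϖ, ← WithZero.exp_nsmul]; simp
  have hN : IsNoetherianRing (integralClosure ℤ_[l] F) := inferInstance
  have h1 : IsHausdorff (Ideal.span {ϖ}) (integralClosure ℤ_[l] F) := by
    refine IsHausdorff.of_isDomain _ fun h => ?_
    rw [Ideal.span_singleton_eq_top, isUnit_iff hint, hϖ, ← WithZero.exp_zero] at h
    simpa using WithZero.exp_injective h
  have h2 : IsPrecomplete (Ideal.span {ϖ}) (integralClosure ℤ_[l] F) := by
    refine IsPrecomplete.of_exists_limit fun x hx => ?_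
    obtain ⟨y, hy⟩ := Valuation.exists_limit_of_completeSpace hv (fun n => (x n : F)) fun n => by
      have := hx n
      rwa [dvd_iff hint _ _ (hϖ0 n), hpow] at this
    have hy1 : v y ≤ 1 := by
      have : y = (y - x 0) + x 0 := by ring
      rw [this]
      exact (v.map_add _ _).trans (max_le (by simpa using hy 0) ((hint _).mpr (x 0).2))
    refine ⟨⟨y, (hint _).mp hy1⟩, fun n => ?_⟩
    rw [dvd_iff hint _ _ (hϖ0 n), hpow]
    exact hy n
  exact { h1, h2 with }

include hint in
-- As `l` dies in the residue ring, each of the finitely many coordinates over `ℤ_l` matters only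
-- modulo `l`.
theorem finite_residue {k : Type*} [CommRing k] (ρ : integralClosure ℤ_[l] F →+* k)
    (hρ : Function.Surjective ρ) (hker : ∀ x, ρ x = 0 ↔ v x < 1) : Finite k := by
  let b := Module.Free.chooseBasis ℤ_[l] (integralClosure ℤ_[l] F)
  refine Finite.of_surjective (fun c : _ → Fin l => ρ (∑ i, (((c i : ℕ) : ℤ_[l]) • b i)))
    fun z => ?_
  obtain ⟨x, rfl⟩ := hρ z
  have hl : ρ (l : integralClosure ℤ_[l] F) = 0 := by
    obtain ⟨e, he1, he⟩ := exists_map_prime_eq hint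
    rw [hker, show ((l : integralClosure ℤ_[l] F) : F) = l from rfl, he, ← WithZero.exp_zero, WithZero.exp_lt_exp]
    omega
  refine ⟨fun i => ⟨PadicInt.zmodRepr (b.repr x i), PadicInt.zmodRepr_lt_p _⟩, ?_⟩
  conv_rhs => rw [← b.sum_repr x]
  simp only [map_sum]
  refine Finset.sum_congr rfl fun i _ => ?_
  have h1 := PadicInt.sub_zmodRepr_mem (b.repr x i)
  rw [PadicInt.maximalIdeal_eq_span_p, Ideal.mem_span_singleton] at h1
  obtain ⟨d, hd⟩ := h1
  have h2 : b.repr x i = (PadicInt.zmodRepr (b.repr x i) : ℤ_[l]) + l * d := by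
    rw [← hd]; ring
  conv_rhs => rw [h2]
  rw [add_smul, map_add, mul_smul, Nat.cast_smul_eq_nsmul ℤ_[l] l, nsmul_eq_mul, map_mul, hl,
    zero_mul, add_zero]

theorem exists_residueField.{t} {l : ℕ} [Fact l.Prime] {F : Type t} [Field F] [Algebra ℤ_[l] F]
    [Algebra ℚ_[l] F] [IsScalarTower ℤ_[l] ℚ_[l] F] [FiniteDimensional ℚ_[l] F]
    {v : Valuation F ℤᵐ⁰} (hint : ∀ x, v x ≤ 1 ↔ x ∈ integralClosure ℤ_[l] F) :
    ∃ (k : Type t) (_ : Field k) (ρ : v.integer →+* k),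
    Function.Surjective ρ ∧ (∀ x, ρ x = 0 ↔ v x < 1) ∧ IsLocalFieldOfDim 0 k := by
  have hmax : (v.ltIdeal 1).IsMaximal := by
    refine Ideal.isMaximal_iff.mpr ⟨fun h => ?_, fun J x hIJ hx hxJ => ?_⟩
    · rw [Valuation.mem_ltIdeal_iff] at h
      exact absurd h (by simp)
    · rw [Valuation.mem_ltIdeal_iff, Units.val_one, not_lt] at hx
      have hx1 : v (x : F) = 1 := le_antisymm x.2 hx
      have hx0 : (x : F) ≠ 0 := fun h => by rw [h, map_zero] at hx1; exact zero_ne_one hx1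
      have h1 : (⟨(x : F)⁻¹, by
          rw [Valuation.mem_integer_iff, map_inv₀, hx1, inv_one]⟩ : v.integer) * x = 1 :=
        Subtype.ext (inv_mul_cancel₀ hx0)
      rw [← h1]
      exact J.mul_mem_left _ hxJ
  let σ : integralClosure ℤ_[l] F →+* v.integer :=
    (integralClosure ℤ_[l] F).val.toRingHom.codRestrict v.integer fun x => (hint _).mpr x.2
  have hσ : Function.Surjective σ := fun x => ⟨⟨x, (hint _).mp x.2⟩, rfl⟩
  let _ := Ideal.Quotient.field (v.ltIdeal 1)
  have hker : ∀ x : v.integer, Ideal.Quotient.mk (v.ltIdeal 1) x = 0 ↔ v x < 1 := fun x => by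
    rw [Ideal.Quotient.eq_zero_iff_mem, Valuation.mem_ltIdeal_iff]; rfl
  exact ⟨v.integer ⧸ v.ltIdeal 1, inferInstance, Ideal.Quotient.mk (v.ltIdeal 1),
    Ideal.Quotient.mk_surjective, hker, Field.toIsField _,
    finite_residue hint ((Ideal.Quotient.mk (v.ltIdeal 1)).comp σ)
      (Ideal.Quotient.mk_surjective.comp hσ) fun x => hker (σ x)⟩

include hv hint in
theorem isLocalFieldOfDim_one : IsLocalFieldOfDim 1 F := by
  obtain ⟨k, _, ρ, hρ, hker, hk⟩ := exists_residueField hint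
  exact IsLocalFieldOfDim.succ (Field.toIsField F) hv (completeSpace_withVal hv hint) ρ hρ hker hk

end Complete

end PadicExtension

/-! ### Evaluation of power series by division by a distinguished polynomial -/

namespace Polynomial.IsDistinguishedAt

variable {A : Type*} [CommRing A] {I : Ideal A} [IsAdicComplete I A] {g : A[X]}
  (H : g.IsDistinguishedAt I)

include H in
-- Weierstrass division: `A[X]/(g)` maps onto `A⟦X⟧/(g)`, and Euclidean division by the monic `g`
-- lowers the degree.
theorem exists_degree_lt_dvd_sub [Nontrivial A] (f : A⟦X⟧) :
    ∃ r : A[X], r.degree < g.degree ∧ (g : A⟦X⟧) ∣ f - r := by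
  obtain ⟨q, hq⟩ := H.algEquivQuotient.surjective (Ideal.Quotient.mk _ f)
  obtain ⟨r, rfl⟩ := Ideal.Quotient.mk_surjective q
  refine ⟨r %ₘ g, Polynomial.degree_modByMonic_lt r H.monic, ?_⟩
  have h1 : (g : A⟦X⟧) ∣ f - r := by
    rw [← Ideal.mem_span_singleton, ← Ideal.Quotient.mk_eq_mk_iff_sub_mem, ← hq]
    rfl
  have h2 : f - (r %ₘ g : A[X]) = (f - r) + g * (r /ₘ g : A[X]) := by
    rw [Polynomial.modByMonic_eq_sub_mul_div]
    push_cast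
    ring
  rw [h2]
  exact h1.add (dvd_mul_right _ _)

include H in
-- The injectivity of `A[X]/(g) → A⟦X⟧/(g)`.
theorem coe_dvd_coe_iff (r : A[X]) : (g : A⟦X⟧) ∣ r ↔ g ∣ r := by
  refine ⟨fun h => ?_, fun ⟨q, hq⟩ => ⟨q, by rw [hq]; push_cast; rfl⟩⟩
  rw [← Ideal.mem_span_singleton, ← Ideal.Quotient.eq_zero_iff_mem]
  apply H.algEquivQuotient.injective
  rw [map_zero]
  rw [← Ideal.mem_span_singleton, ← Ideal.Quotient.eq_zero_iff_mem] at h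
  rw [← h]
  rfl

variable {B : Type*} [CommRing B] [Algebra A B]

/-- The evaluation of power series at a zero `b` of the distinguished polynomial `g`. -/
def evalPowerSeries (b : B) (hb : aeval b g = 0) : A⟦X⟧ →ₐ[A] B :=
  ((Ideal.Quotient.liftₐ (Ideal.span {g}) (aeval b) fun a ha => by
    obtain ⟨c, rfl⟩ := Ideal.mem_span_singleton.mp ha
    rw [map_mul, hb, zero_mul]).comp H.algEquivQuotient.symm.toAlgHom).comp
      (Ideal.Quotient.mkₐ A (Ideal.span {(g : A⟦X⟧)}))

theorem evalPowerSeries_coe (b : B) (hb : aeval b g = 0) (r : A[X]) :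
    H.evalPowerSeries b hb (r : A⟦X⟧) = aeval b r := by
  have : H.algEquivQuotient.symm (Ideal.Quotient.mk _ (r : A⟦X⟧)) = Ideal.Quotient.mk _ r := by
    rw [AlgEquiv.symm_apply_eq]
    rfl
  rw [evalPowerSeries, AlgHom.comp_apply, AlgHom.comp_apply]
  exact (congrArg _ this).trans (Ideal.Quotient.lift_mk _ _ _)

omit [IsAdicComplete I A] in
theorem _root_.AlgHom.map_polynomial_coe (Φ : A⟦X⟧ →ₐ[A] B) (r : A[X]) :
    Φ (r : A⟦X⟧) = aeval (Φ PowerSeries.X) r := by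
  have : (Φ.comp (Polynomial.coeToPowerSeries.algHom A)) = aeval (Φ PowerSeries.X) := by
    ext
    simp
  simpa using DFunLike.congr_fun this r

include H in
-- No continuity is needed: modulo `g` every power series is a polynomial, and both maps kill `g`.
theorem algHom_ext [Nontrivial A] {Φ Ψ : A⟦X⟧ →ₐ[A] B} (h : Φ PowerSeries.X = Ψ PowerSeries.X)
    (hg : aeval (Φ PowerSeries.X) g = 0) : Φ = Ψ := by
  ext f
  obtain ⟨r, -, q, hq⟩ := H.exists_degree_lt_dvd_sub f
  rw [sub_eq_iff_eq_add.mp hq, map_add, map_add, map_mul, map_mul, Φ.map_polynomial_coe,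
    Ψ.map_polynomial_coe, Φ.map_polynomial_coe, Ψ.map_polynomial_coe, ← h, hg, zero_mul, zero_mul]

end Polynomial.IsDistinguishedAt

/-! ### The completed group ring of a procyclic group -/

namespace completedGroupRing

open Polynomial

variable (l : ℕ) [Fact l.Prime]

/-- The polynomial `(1 + X) ^ (l ^ n) - 1`. -/
def cycloPoly (n : ℕ) : ℤ_[l][X] := (X + 1) ^ (l ^ n) - 1

theorem natDegree_X_add_one_pow (m : ℕ) : ((X + 1 : ℤ_[l][X]) ^ m).natDegree = m := by
  have : (X + 1 : ℤ_[l][X]) = X + C 1 := by simp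
  rw [this, natDegree_pow, natDegree_X_add_C, mul_one]

theorem natDegree_cycloPoly (n : ℕ) : (cycloPoly l n).natDegree = l ^ n := by
  have h : 0 < l ^ n := pow_pos (Fact.out : l.Prime).pos n
  rw [cycloPoly, natDegree_sub_eq_left_of_natDegree_lt, natDegree_X_add_one_pow]
  rw [natDegree_X_add_one_pow, natDegree_one]
  exact h

theorem monic_cycloPoly (n : ℕ) : (cycloPoly l n).Monic := by
  have h : 0 < l ^ n := pow_pos (Fact.out : l.Prime).pos n
  rw [Monic, leadingCoeff, natDegree_cycloPoly, cycloPoly, coeff_sub, coeff_X_add_one_pow,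
    Nat.choose_self, coeff_one, if_neg h.ne', Nat.cast_one, sub_zero]

theorem dvd_coeff_cycloPoly {n i : ℕ} (h : i < l ^ n) : (l : ℤ_[l]) ∣ (cycloPoly l n).coeff i := by
  rw [cycloPoly, coeff_sub, coeff_X_add_one_pow, coeff_one]
  split_ifs with h0
  · simp [h0]
  · rw [sub_zero]
    exact_mod_cast Nat.cast_dvd_cast (Nat.Prime.dvd_choose_pow Fact.out h0 h.ne)

theorem isDistinguishedAt_cycloPoly (n : ℕ) :
    (cycloPoly l n).IsDistinguishedAt (IsLocalRing.maximalIdeal ℤ_[l]) where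
  mem {i} hi := by
    rw [natDegree_cycloPoly] at hi
    rw [PadicInt.maximalIdeal_eq_span_p, Ideal.mem_span_singleton]
    exact dvd_coeff_cycloPoly l hi
  monic := monic_cycloPoly l n

variable {G : Type*} [CommGroup G] [TopologicalSpace G] {l}

theorem aeval_cycloPoly {H : Type*} [CommGroup H] (h : H) (n : ℕ) :
    aeval (MonoidAlgebra.single h 1 - 1 : MonoidAlgebra ℤ_[l] H) (cycloPoly l n) =
      MonoidAlgebra.single (h ^ l ^ n) 1 - 1 := by
  simp [cycloPoly, MonoidAlgebra.single_pow]

/-- The elements `1, h, …, h ^ (m - 1)` are distinct, hence linearly independent in the group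
algebra. -/
theorem eq_zero_of_aeval_eq_zero {H : Type*} [CommGroup H] {h : H} {m : ℕ}
    (hm : ∀ i j, i < m → j < m → h ^ i = h ^ j → i = j) {r : ℤ_[l][X]} (hr : r.degree < m)
    (h0 : aeval (MonoidAlgebra.single h 1 - 1 : MonoidAlgebra ℤ_[l] H) r = 0) : r = 0 := by
  -- In terms of `X + 1` the evaluation point `h - 1` becomes `h`.
  obtain ⟨s, rfl⟩ : ∃ s : ℤ_[l][X], r = s.comp (X + 1) := ⟨r.comp (X - 1), by simp [comp_assoc]⟩
  have hs : s.degree < m := by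
    rcases eq_or_ne s 0 with rfl | hs0
    · simp
    have : (X + 1 : ℤ_[l][X]) = X + C 1 := by simp
    have h1 : (s.comp (X + 1)).natDegree = s.natDegree := by
      rw [this, natDegree_comp, natDegree_X_add_C, mul_one]
    have h2 : s.comp (X + 1) ≠ 0 := by
      intro h
      apply hs0
      have := congrArg (fun t => t.comp (X - 1)) h
      simpa [comp_assoc] using this
    rw [degree_eq_natDegree h2, h1] at hr
    rw [degree_eq_natDegree hs0]
    exact hr
  suffices s = 0 by rw [this, zero_comp]
  ext i
  rcases lt_or_ge i m with hi | hi
  · rw [aeval_comp] at h0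
    simp only [map_add, aeval_X, map_one, sub_add_cancel] at h0
    rw [aeval_eq_sum_range' (n := m) (by
      rcases eq_or_ne s 0 with rfl | hs0
      · simpa using (Nat.zero_le i).trans_lt hi
      · rwa [degree_eq_natDegree hs0, Nat.cast_lt] at hs)] at h0
    have h3 := congrArg (fun z : MonoidAlgebra ℤ_[l] H => z.coeff (h ^ i)) h0
    simp only [MonoidAlgebra.coeff_sum, Finsupp.finsetSum_apply, MonoidAlgebra.single_pow, one_pow,
      MonoidAlgebra.coeff_smul_apply, MonoidAlgebra.coeff_single, smul_eq_mul] at h3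
    rw [Finset.sum_eq_single i] at h3
    · simpa using h3
    · intro j hj hji
      rw [Finsupp.single_eq_of_ne, mul_zero]
      intro hij
      exact hji (hm _ _ (Finset.mem_range.mp hj) hi hij.symm)
    · intro h; exact absurd (Finset.mem_range.mpr hi) h
  · rw [coeff_zero]
    exact coeff_eq_zero_of_degree_lt (hs.trans_le (by exact_mod_cast hi))

/-- A subgroup system describing a topological generator `g` of a group isomorphic to `ℤ_l`. -/
structure IsProcyclicSystem (l : ℕ) (g : G) (U : ℕ → OpenSubgroup G) : Prop where
  antitone : ∀ n, (U (n + 1)).toSubgroup ≤ (U n).toSubgroup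
  cofinal : ∀ V : OpenSubgroup G, ∃ n, (U n).toSubgroup ≤ V.toSubgroup
  pow_mem_iff : ∀ n i, g ^ i ∈ U n ↔ l ^ n ∣ i
  exists_pow : ∀ n x, ∃ i : ℕ, x⁻¹ * g ^ i ∈ U n

namespace IsProcyclicSystem

variable {g : G} {U : ℕ → OpenSubgroup G} (S : IsProcyclicSystem l g U)

include S in
theorem aeval_eq_zero {V : OpenSubgroup G} {n : ℕ} (h : (U n).toSubgroup ≤ V.toSubgroup) :
    aeval (MonoidAlgebra.single (g : G ⧸ V.toSubgroup) 1 - 1 :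
      MonoidAlgebra ℤ_[l] (G ⧸ V.toSubgroup)) (cycloPoly l n) = 0 := by
  rw [aeval_cycloPoly, sub_eq_zero, MonoidAlgebra.one_def]
  congr 1
  rw [← QuotientGroup.mk_pow, QuotientGroup.eq_one_iff]
  exact h ((S.pow_mem_iff n _).mpr dvd_rfl)

/-- The evaluation `X ↦ g - 1` with values in `ℤ_l[G/V]`. -/
def evalAt (V : OpenSubgroup G) : ℤ_[l]⟦X⟧ →ₐ[ℤ_[l]] MonoidAlgebra ℤ_[l] (G ⧸ V.toSubgroup) :=
  (isDistinguishedAt_cycloPoly l (S.cofinal V).choose).evalPowerSeries _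
    (S.aeval_eq_zero (S.cofinal V).choose_spec)

theorem evalAt_X (V : OpenSubgroup G) :
    S.evalAt V PowerSeries.X = MonoidAlgebra.single (g : G ⧸ V.toSubgroup) 1 - 1 := by
  rw [← Polynomial.coe_X, evalAt, IsDistinguishedAt.evalPowerSeries_coe, aeval_X]

theorem evalAt_coe (V : OpenSubgroup G) (r : ℤ_[l][X]) : S.evalAt V (r : ℤ_[l]⟦X⟧) =
    aeval (MonoidAlgebra.single (g : G ⧸ V.toSubgroup) 1 - 1 :
      MonoidAlgebra ℤ_[l] (G ⧸ V.toSubgroup)) r := by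
  rw [AlgHom.map_polynomial_coe, evalAt_X]

/-- Both sides send `X` to the class of `g - 1`, where some `cycloPoly` vanishes; so the arbitrary
level chosen in `evalAt` plays no role. -/
theorem evalAt_compatible (V W : OpenSubgroup G) (h : V.toSubgroup ≤ W.toSubgroup) :
    (MonoidAlgebra.mapDomainAlgHom ℤ_[l] ℤ_[l]
      (QuotientGroup.map V.toSubgroup W.toSubgroup (MonoidHom.id G) h)).comp (S.evalAt V) =
      S.evalAt W := by
  obtain ⟨n, hn⟩ := S.cofinal W
  have hX : ((MonoidAlgebra.mapDomainAlgHom ℤ_[l] ℤ_[l]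
      (QuotientGroup.map V.toSubgroup W.toSubgroup (MonoidHom.id G) h)).comp (S.evalAt V))
        PowerSeries.X = S.evalAt W PowerSeries.X := by
    rw [AlgHom.comp_apply, evalAt_X, evalAt_X, map_sub, map_one]
    simp
    rfl
  refine (isDistinguishedAt_cycloPoly l n).algHom_ext hX ?_
  rw [hX, evalAt_X]
  exact S.aeval_eq_zero hn

/-- The Weierstrass remainder has degree below `l ^ n`, and the powers of `g` below this exponent
are distinct modulo `U n`, so a vanishing value forces a zero remainder. -/
theorem evalAt_eq_zero_iff (n : ℕ) (f : ℤ_[l]⟦X⟧) :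
    S.evalAt (U n) f = 0 ↔ (cycloPoly l n : ℤ_[l]⟦X⟧) ∣ f := by
  have h0 : S.evalAt (U n) (cycloPoly l n : ℤ_[l]⟦X⟧) = 0 := by
    rw [evalAt_coe]; exact S.aeval_eq_zero le_rfl
  constructor
  · intro h
    obtain ⟨r, hr, q, hq⟩ := (isDistinguishedAt_cycloPoly l n).exists_degree_lt_dvd_sub f
    rw [degree_eq_natDegree (monic_cycloPoly l n).ne_zero, natDegree_cycloPoly] at hr
    have h1 := congrArg (S.evalAt (U n)) hq
    rw [map_sub, map_mul, h0, h, zero_mul, zero_sub, neg_eq_zero, evalAt_coe] at h1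
    have : r = 0 := by
      refine eq_zero_of_aeval_eq_zero (m := l ^ n) ?_ hr h1
      have aux : ∀ i j, i ≤ j → i < l ^ n → j < l ^ n → (g : G ⧸ (U n).toSubgroup) ^ i = g ^ j →
          i = j := by
        intro i j hij hi hj h
        obtain ⟨d, rfl⟩ := Nat.exists_eq_add_of_le hij
        rw [pow_add, left_eq_mul, ← QuotientGroup.mk_pow, QuotientGroup.eq_one_iff] at h
        have := Nat.eq_zero_of_dvd_of_lt ((S.pow_mem_iff n d).mp h) (by omega)
        omega
      intro i j hi hj h
      rcases le_total i j with hij | hij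
      · exact aux i j hij hi hj h
      · exact (aux j i hij hj hi h.symm).symm
    rw [this, Polynomial.coe_zero, sub_zero] at hq
    exact ⟨q, hq⟩
  · rintro ⟨q, rfl⟩
    rw [map_mul, h0, zero_mul]

theorem evalAt_surjective (n : ℕ) : Function.Surjective (S.evalAt (U n)) := by
  rw [← AlgHom.range_eq_top, eq_top_iff]
  rintro x -
  induction x using MonoidAlgebra.induction_on with
  | of x =>
    obtain ⟨x, rfl⟩ := QuotientGroup.mk_surjective x
    obtain ⟨i, hi⟩ := S.exists_pow n x
    have : (x : G ⧸ (U n).toSubgroup) = g ^ i := by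
      rw [← QuotientGroup.mk_pow]; exact (QuotientGroup.eq).mpr hi
    rw [this, map_pow]
    refine Subalgebra.pow_mem (S.evalAt (U n)).range ⟨PowerSeries.X + 1, ?_⟩ i
    change S.evalAt (U n) _ = _
    rw [map_add, map_one, evalAt_X, sub_add_cancel]
    rfl
  | add x y hx hy => exact add_mem hx hy
  | smul r x hx => exact Subalgebra.smul_mem _ hx r

/-- The map `X ↦ g - 1` from power series to the completed group ring. -/
def evalHom : ℤ_[l]⟦X⟧ →ₐ[ℤ_[l]] completedGroupRing ℤ_[l] G :=
  (AlgHom.pi S.evalAt).codRestrict _ fun f V W h =>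
    DFunLike.congr_fun (S.evalAt_compatible V W h) f

theorem evalHom_apply (f : ℤ_[l]⟦X⟧) (V : OpenSubgroup G) : (S.evalHom f).1 V = S.evalAt V f := rfl

theorem evalHom_X : S.evalHom PowerSeries.X = of ℤ_[l] g - 1 :=
  Subtype.ext (funext fun V => S.evalAt_X V)

/-- The coefficients of `cycloPoly l n` below `l ^ n` are divisible by `l`; for the coefficient of
index `i` the level `n = i + 1` works because `i < l ^ (i + 1)`. -/
theorem dvd_of_forall_cycloPoly_dvd (f : ℤ_[l]⟦X⟧)
    (h : ∀ n, (cycloPoly l n : ℤ_[l]⟦X⟧) ∣ f) : PowerSeries.C (l : ℤ_[l]) ∣ f := by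
  have : ∀ i, (l : ℤ_[l]) ∣ PowerSeries.coeff i f := by
    intro i
    obtain ⟨q, rfl⟩ := h (i + 1)
    rw [PowerSeries.coeff_mul]
    refine Finset.dvd_sum fun p hp => Dvd.dvd.mul_right ?_ _
    rw [Polynomial.coeff_coe]
    refine dvd_coeff_cycloPoly l ?_
    have h1 := Finset.HasAntidiagonal.mem_antidiagonal.mp hp
    have h2 : i + 1 < l ^ (i + 1) := Nat.lt_pow_self (Fact.out : l.Prime).one_lt
    omega
  choose c hc using this
  refine ⟨PowerSeries.mk c, ?_⟩
  ext i
  rw [PowerSeries.coeff_C_mul, PowerSeries.coeff_mk, hc]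

/-- Elements of the kernel are divisible by `l`, and the quotient again lies in the kernel because
the target has no `l`-torsion. So the kernel equals `l` times itself, and Nakayama's lemma applies
in the noetherian local ring `ℤ_l⟦X⟧`. -/
theorem evalHom_injective : Function.Injective S.evalHom := by
  rw [injective_iff_map_eq_zero]
  suffices hk : RingHom.ker S.evalHom = ⊥ by
    intro f hf
    have : f ∈ RingHom.ker S.evalHom := hf
    rwa [hk] at this
  refine Submodule.eq_bot_of_le_smul_of_le_jacobson_bot (Ideal.span {PowerSeries.C (l : ℤ_[l])}) _
    (IsNoetherian.noetherian _) ?_ ?_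
  · intro f hf
    have hf0 : S.evalHom f = 0 := hf
    obtain ⟨f', rfl⟩ := dvd_of_forall_cycloPoly_dvd f fun n => by
      rw [← S.evalAt_eq_zero_iff, ← evalHom_apply, hf0]; rfl
    refine Ideal.mul_mem_mul (Ideal.mem_span_singleton_self _) ?_
    rw [RingHom.mem_ker]
    have h1 : (l : ℤ_[l]) • S.evalHom f' = 0 := by
      rw [← map_smul, PowerSeries.smul_eq_C_mul]; exact hf0
    apply Subtype.ext
    funext V
    ext x
    have h2 := congrArg (fun z : completedGroupRing ℤ_[l] G => (z.1 V).coeff x) h1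
    have h3 : (l : ℤ_[l]) * ((S.evalHom f').1 V).coeff x = 0 := h2
    exact (mul_eq_zero.mp h3).resolve_left (by exact_mod_cast (Fact.out : l.Prime).ne_zero)
  · rw [IsLocalRing.jacobson_eq_maximalIdeal _ bot_ne_top, Ideal.span_singleton_le_iff_mem,
      IsLocalRing.mem_maximalIdeal, mem_nonunits_iff, PowerSeries.isUnit_iff_constantCoeff,
      PowerSeries.constantCoeff_C]
    exact PadicInt.prime_p.not_isUnit

open scoped PowerSeries.WithPiTopology in
-- Compactness: the solution sets at the levels `U n` are nonempty, closed and decreasing in the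
-- compact space `ℤ_l⟦X⟧`, so they have a common point.
theorem evalHom_surjective : Function.Surjective S.evalHom := by
  intro y
  have : CompactSpace ℤ_[l]⟦X⟧ := inferInstanceAs (CompactSpace ((Unit →₀ ℕ) → ℤ_[l]))
  let K : ℕ → Set ℤ_[l]⟦X⟧ := fun n => {f | S.evalAt (U n) f = y.1 (U n)}
  have hcl : ∀ n, IsClosed (K n) := by
    intro n
    obtain ⟨f₀, hf₀⟩ := S.evalAt_surjective n (y.1 (U n))
    -- A solution set is a coset of the ideal generated by `cycloPoly l n`, hence a continuous image
    -- of a compact space.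
    have : K n = Set.range fun q : ℤ_[l]⟦X⟧ => f₀ + (cycloPoly l n : ℤ_[l]⟦X⟧) * q := by
      ext f
      change S.evalAt (U n) f = _ ↔ _
      rw [← hf₀, ← sub_eq_zero, ← map_sub, evalAt_eq_zero_iff]
      constructor
      · rintro ⟨q, hq⟩; exact ⟨q, by simp only [← hq]; ring⟩
      · rintro ⟨q, rfl⟩; exact ⟨q, by ring⟩
    rw [this]
    exact (isCompact_range (by fun_prop)).isClosed
  obtain ⟨f, hf⟩ := IsCompact.nonempty_iInter_of_sequence_nonempty_isCompact_isClosed K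
    (fun n f hf => by
      change S.evalAt (U (n + 1)) f = _ at hf
      change S.evalAt (U n) f = _
      rw [← S.evalAt_compatible _ _ (S.antitone n), AlgHom.comp_apply, hf]
      exact y.2 _ _ _)
    (fun n => S.evalAt_surjective n _) (hcl 0).isCompact hcl
  rw [Set.mem_iInter] at hf
  refine ⟨f, Subtype.ext (funext fun V => ?_)⟩
  obtain ⟨n, hn⟩ := S.cofinal V
  have h1 : S.evalAt (U n) f = y.1 (U n) := hf n
  rw [evalHom_apply, ← S.evalAt_compatible _ _ hn, AlgHom.comp_apply, h1]
  exact y.2 _ _ _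

include S in
theorem exists_algEquiv : ∃ e : ℤ_[l]⟦X⟧ ≃ₐ[ℤ_[l]] completedGroupRing ℤ_[l] G,
    e PowerSeries.X = of ℤ_[l] g - 1 :=
  ⟨AlgEquiv.ofBijective S.evalHom ⟨S.evalHom_injective, S.evalHom_surjective⟩, S.evalHom_X⟩

end IsProcyclicSystem

end completedGroupRing

/-! ### The subgroups `Γ ^ w` of a group isomorphic to `ℤ_l` -/

namespace completedGroupRing

variable {l : ℕ} [Fact l.Prime]

theorem _root_.PadicInt.dvd_iff_norm_le {a z : ℤ_[l]} : a ∣ z ↔ ‖z‖ ≤ ‖a‖ := by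
  rcases eq_or_ne a 0 with rfl | ha
  · simp
  have ha' : ‖a‖ = (l : ℝ) ^ (-(a.valuation : ℤ)) := PadicInt.norm_eq_zpow_neg_valuation ha
  rw [ha', PadicInt.norm_le_pow_iff_mem_span_pow, Ideal.mem_span_singleton]
  conv_lhs => rw [PadicInt.unitCoeff_spec ha]
  simp

theorem _root_.PadicInt.natCast_pow_dvd_natCast_iff {n i : ℕ} :
    (l : ℤ_[l]) ^ n ∣ (i : ℤ_[l]) ↔ l ^ n ∣ i := by
  rw [← Ideal.mem_span_singleton, ← PadicInt.norm_le_pow_iff_mem_span_pow]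
  have := PadicInt.norm_int_le_pow_iff_dvd (p := l) (k := i) (n := n)
  rw [Int.cast_natCast] at this
  rw [this]
  exact_mod_cast Iff.rfl

theorem _root_.PadicInt.isOpen_setOf_dvd {a : ℤ_[l]} (ha : a ≠ 0) : IsOpen {z : ℤ_[l] | a ∣ z} := by
  have : {z : ℤ_[l] | a ∣ z} = Metric.closedBall 0 ‖a‖ := by
    ext z
    rw [mem_closedBall_zero_iff]
    exact PadicInt.dvd_iff_norm_le
  rw [this]
  exact IsUltrametricDist.isOpen_closedBall 0 (norm_ne_zero_iff.mpr ha)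

variable {Γ : Type*} [CommGroup Γ] [TopologicalSpace Γ]

/-- Otherwise `γ` would lie in the preimage of `l ℤ_l`, a proper closed subgroup. -/
theorem isUnit_of_topologicalClosure_zpowers_eq_top [IsTopologicalGroup Γ]
    (e : Γ ≃ₜ* Multiplicative ℤ_[l]) {γ : Γ}
    (hγ : (Subgroup.zpowers γ).topologicalClosure = ⊤) : IsUnit (e γ).toAdd := by
  by_contra hu
  have hl : (l : ℤ_[l]) ∣ (e γ).toAdd := by
    rwa [← Ideal.mem_span_singleton, ← PadicInt.maximalIdeal_eq_span_p,
      IsLocalRing.mem_maximalIdeal]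
  let D : AddSubgroup ℤ_[l] := (Ideal.span {(l : ℤ_[l])}).toAddSubgroup
  have hDo : IsOpen (D : Set ℤ_[l]) := by
    have := PadicInt.isOpen_setOf_dvd (l := l) (a := l) (by
      exact_mod_cast (Fact.out : l.Prime).ne_zero)
    convert this using 1
    ext z
    exact Ideal.mem_span_singleton
  let H : Subgroup Γ := (AddSubgroup.toSubgroup D).comap (e : Γ →* Multiplicative ℤ_[l])
  have hHc : IsClosed (H : Set Γ) :=
    (D.isClosed_of_isOpen hDo).preimage (continuous_toAdd.comp e.continuous)
  have hle : (Subgroup.zpowers γ).topologicalClosure ≤ H := by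
    refine Subgroup.topologicalClosure_minimal _ ?_ hHc
    rw [Subgroup.zpowers_le]
    exact Ideal.mem_span_singleton.mpr hl
  rw [hγ, top_le_iff] at hle
  have h1 : e.symm (Multiplicative.ofAdd 1) ∈ H := hle ▸ Subgroup.mem_top _
  have h2 : (e (e.symm (Multiplicative.ofAdd 1))).toAdd ∈ Ideal.span {(l : ℤ_[l])} := h1
  rw [e.apply_symm_apply, toAdd_ofAdd, Ideal.mem_span_singleton] at h2
  exact PadicInt.prime_p.not_isUnit (isUnit_of_dvd_one h2)

/-- Under `Γ ≅ ℤ_l` the group `Γ^w` becomes `w ℤ_l`, with `γ^w` corresponding to `w` times a unit;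
`U n` is the preimage of `l ^ n w ℤ_l`. -/
theorem exists_isProcyclicSystem [IsTopologicalGroup Γ]
    (e : Γ ≃ₜ* Multiplicative ℤ_[l]) {γ : Γ}
    (hγ : (Subgroup.zpowers γ).topologicalClosure = ⊤) {w : ℕ} (hw : w ≠ 0) {Γw : Subgroup Γ}
    (hΓw : Γw = (powMonoidHom w : Γ →* Γ).range) {γw : Γw} (hγw : (γw : Γ) = γ ^ w) :
    ∃ U, IsProcyclicSystem l γw U := by
  have hu := isUnit_of_topologicalClosure_zpowers_eq_top e hγ
  have hw0 : (w : ℤ_[l]) ≠ 0 := by exact_mod_cast hw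
  have hl0 : ∀ n : ℕ, (l : ℤ_[l]) ^ n * w ≠ 0 := fun n =>
    mul_ne_zero (pow_ne_zero n (by exact_mod_cast (Fact.out : l.Prime).ne_zero)) hw0
  let E : Γw → ℤ_[l] := fun x => (e (x : Γ)).toAdd
  have hEc : Continuous E := continuous_toAdd.comp (e.continuous.comp continuous_subtype_val)
  have hE1 : E 1 = 0 := by simp [E]
  have hEmul : ∀ x y, E (x * y) = E x + E y := fun x y => by simp [E]
  have hEinv : ∀ x, E x⁻¹ = -E x := fun x => by simp [E]
  have hEpow : ∀ x (i : ℕ), E (x ^ i) = i * E x := fun x i => by simp [E]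
  have hEγ : E γw = w * (e γ).toAdd := by
    change (e (γw : Γ)).toAdd = _
    rw [hγw, map_pow, toAdd_pow, nsmul_eq_mul]
  have hEdvd : ∀ x, (w : ℤ_[l]) ∣ E x := by
    rintro ⟨x, hx⟩
    rw [hΓw] at hx
    obtain ⟨y, rfl⟩ := hx
    change (w : ℤ_[l]) ∣ (e (y ^ w)).toAdd
    rw [map_pow, toAdd_pow, nsmul_eq_mul]
    exact dvd_mul_right _ _
  let U : ℕ → OpenSubgroup Γw := fun n =>
    { carrier := {x | (l : ℤ_[l]) ^ n * w ∣ E x}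
      one_mem' := by change _ ∣ E 1; rw [hE1]; exact dvd_zero _
      mul_mem' := fun {x y} hx hy => by change _ ∣ E (x * y); rw [hEmul]; exact dvd_add hx hy
      inv_mem' := fun {x} hx => by change _ ∣ E x⁻¹; rw [hEinv]; exact (dvd_neg).mpr hx
      isOpen' := (PadicInt.isOpen_setOf_dvd (hl0 n)).preimage hEc }
  have hU : ∀ n x, x ∈ U n ↔ (l : ℤ_[l]) ^ n * w ∣ E x := fun n x => Iff.rfl
  refine ⟨U, ⟨fun n x hx => ?_, fun V => ?_, fun n i => ?_, fun n x => ?_⟩⟩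
  · exact (mul_dvd_mul_right (pow_dvd_pow _ n.le_succ) _).trans hx
  · have hV : (V : Set Γw) ∈ nhds (1 : Γw) := V.mem_nhds_one
    obtain ⟨O, hO, hOV⟩ := (mem_nhds_induced _ _ _).mp hV
    have h1 : (fun z => e.symm (Multiplicative.ofAdd z)) ⁻¹' O ∈ nhds (0 : ℤ_[l]) := by
      refine (e.symm.continuous.comp continuous_ofAdd).continuousAt.preimage_mem_nhds ?_
      simpa using hO
    obtain ⟨ε, hε, hball⟩ := Metric.mem_nhds_iff.mp h1
    obtain ⟨n, hn⟩ := PadicInt.exists_pow_neg_lt l hε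
    refine ⟨n, fun x hx => ?_⟩
    refine hOV (show (x : Γ) ∈ O from ?_)
    have hx' : (l : ℤ_[l]) ^ n ∣ E x := (dvd_mul_right _ _).trans hx
    have h2 : E x ∈ Metric.ball (0 : ℤ_[l]) ε := by
      rw [mem_ball_zero_iff]
      refine lt_of_le_of_lt ?_ hn
      rw [PadicInt.norm_le_pow_iff_mem_span_pow, Ideal.mem_span_singleton]
      exact hx'
    have h3 := hball h2
    simpa [E] using h3
  · rw [hU, hEpow, hEγ, ← PadicInt.natCast_pow_dvd_natCast_iff, mul_left_comm,
      mul_comm ((l : ℤ_[l]) ^ n), mul_dvd_mul_iff_left hw0, hu.dvd_mul_right]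
  · obtain ⟨c, hc⟩ := hEdvd x
    obtain ⟨u, hu'⟩ := hu
    obtain ⟨u', huu⟩ : ∃ u' : ℤ_[l], u' * u = 1 := ⟨_, u.inv_mul⟩
    -- With `E x = w c` and `E γw = w u`, the exponent must approximate `c / u` modulo `l ^ n`.
    refine ⟨PadicInt.appr (c * u') n, ?_⟩
    have h1 := Ideal.mem_span_singleton.mp (PadicInt.appr_spec n (c * u'))
    rw [hU, hEmul, hEinv, hEpow, hEγ, hc, ← hu']
    have h2 : -((w : ℤ_[l]) * c) + (PadicInt.appr (c * u') n : ℤ_[l]) * (w * u) =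
        (c * u' - (PadicInt.appr (c * u') n : ℤ_[l])) * w * (-(u : ℤ_[l])) := by
      linear_combination ((w : ℤ_[l]) * c) * huu
    rw [h2]
    exact (mul_dvd_mul_right h1 _).mul_right _

end completedGroupRing

/-! ### Power series with coefficients in a finite free algebra -/

namespace PowerSeries

variable {R A : Type*} [CommRing R] [CommRing A] [Algebra R A]

/-- The canonical map `A ⊗ R⟦X⟧ → A⟦X⟧`. -/
def tensorToPowerSeries : A ⊗[R] R⟦X⟧ →ₐ[A] A⟦X⟧ :=
  Algebra.TensorProduct.lift (Algebra.ofId A A⟦X⟧) (PowerSeries.mapAlgHom (Algebra.ofId R A))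
    fun _ _ => Commute.all _ _

theorem tensorToPowerSeries_tmul (a : A) (f : R⟦X⟧) :
    (tensorToPowerSeries : A ⊗[R] R⟦X⟧ →ₐ[A] A⟦X⟧) (a ⊗ₜ[R] f) = C a * f.map (algebraMap R A) := by
  rw [tensorToPowerSeries, Algebra.TensorProduct.lift_tmul]
  rfl

/-- In a finite basis of `A` over `R`, both sides are families of power series over `R` indexed by
the basis. -/
theorem tensorToPowerSeries_bijective [Module.Finite R A] [Module.Free R A] :
    Function.Bijective (tensorToPowerSeries : A ⊗[R] R⟦X⟧ →ₐ[A] A⟦X⟧) := by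
  let b := Module.Free.chooseBasis R A
  let E := TensorProduct.equivFinsuppOfBasisLeft (N := R⟦X⟧) b
  have key : ∀ f n, coeff n ((tensorToPowerSeries : A ⊗[R] R⟦X⟧ →ₐ[A] A⟦X⟧) (E.symm f)) =
      ∑ i, coeff n (f i) • b i := by
    intro f n
    rw [TensorProduct.equivFinsuppOfBasisLeft_symm_apply, Finsupp.sum_fintype _ _ (by simp)]
    simp only [map_sum, tensorToPowerSeries_tmul, coeff_C_mul, coeff_map]
    exact Finset.sum_congr rfl fun i _ => by rw [Algebra.smul_def, mul_comm]
  constructor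
  · rw [injective_iff_map_eq_zero]
    intro x hx
    obtain ⟨f, rfl⟩ := E.symm.surjective x
    have : f = 0 := by
      ext i n
      have h1 := key f n
      rw [hx, map_zero] at h1
      have h2 := Fintype.linearIndependent_iff.mp b.linearIndependent (fun i => coeff n (f i)) h1.symm i
      simpa using h2
    rw [this, map_zero]
  · intro g
    refine ⟨E.symm (Finsupp.equivFunOnFinite.symm fun i => mk fun n => b.repr (coeff n g) i), ?_⟩
    ext n
    rw [key]
    simp only [Finsupp.equivFunOnFinite_symm_apply_apply, coeff_mk]
    exact b.sum_repr _

theorem isIntegral_of_finite [Module.Finite R A] [Module.Free R A] (g : A⟦X⟧) :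
    IsIntegral R⟦X⟧ g := by
  obtain ⟨x, rfl⟩ := (tensorToPowerSeries_bijective (R := R) (A := A)).2 g
  induction x using TensorProduct.induction_on with
  | zero => rw [map_zero]; exact isIntegral_zero
  | add x y hx hy => rw [map_add]; exact hx.add hy
  | tmul a f =>
    rw [tensorToPowerSeries_tmul]
    refine IsIntegral.mul ?_ (isIntegral_algebraMap (x := f))
    have h1 : IsIntegral R (C a : A⟦X⟧) :=
      (Algebra.IsIntegral.isIntegral (R := R) a).map (IsScalarTower.toAlgHom R A A⟦X⟧)
    have : IsScalarTower R R⟦X⟧ A⟦X⟧ := IsScalarTower.of_algebraMap_eq fun x => by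
      rw [algebraMap_apply'', algebraMap_apply, algebraMap_apply, map_C]
      rfl
    exact h1.tower_top

/-- `A⟦X⟧` is integral over `R⟦X⟧`, so every denominator can be enlarged to one with coefficients in
`R`. -/
theorem exists_ne_zero_dvd_map [IsDomain R] [IsDomain A] [Module.Finite R A] [Module.Free R A]
    {g : A⟦X⟧} (hg : g ≠ 0) : ∃ f : R⟦X⟧, f ≠ 0 ∧ g ∣ f.map (algebraMap R A) :=
  (isIntegral_of_finite g).isAlgebraic.exists_nonzero_dvd (mem_nonZeroDivisors_of_ne_zero hg)

end PowerSeries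

/-! ### `𝒬^L G` as a field of fractions -/

section

open PadicExtension

variable (l : ℕ) [Fact l.Prime]
variable (L : Type*) [Field L] [Algebra ℚ_[l] L] [FiniteDimensional ℚ_[l] L]
  [Algebra ℤ_[l] L] [IsScalarTower ℤ_[l] ℚ_[l] L]

/-- A common basis makes `tensorIwasawaToQuot` the coordinatewise inclusion of `ΛG` into `𝒬G`. -/
theorem PadicExtension.exists_basis : ∃ (n : ℕ)
    (b : Module.Basis (Fin n) ℤ_[l] (integralClosure ℤ_[l] L)) (B : Module.Basis (Fin n) ℚ_[l] L),
    ∀ i, B i = b i := by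
  have := IsIntegralClosure.isLocalization ℤ_[l] ℚ_[l] L (integralClosure ℤ_[l] L)
  let b := Module.finBasis ℤ_[l] (integralClosure ℤ_[l] L)
  exact ⟨_, b, b.localizationLocalization ℚ_[l] (nonZeroDivisors ℤ_[l]) L,
    fun i => b.localizationLocalization_apply _ _ _ _⟩

variable (G : Type*) [CommGroup G] [TopologicalSpace G]

omit [FiniteDimensional ℚ_[l] L] in
theorem tensorIwasawaToQuot_tmul (a : integralClosure ℤ_[l] L) (x : Iwasawa l G) :
    tensorIwasawaToQuot l G L (a ⊗ₜ[ℤ_[l]] x) =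
      (a : L) ⊗ₜ[ℚ_[l]] algebraMap (Iwasawa l G) (QuotIwasawa l G) x := by
  rw [tensorIwasawaToQuot, Algebra.TensorProduct.lift_tmul]
  change ((a : L) ⊗ₜ[ℚ_[l]] (1 : QuotIwasawa l G)) * ((1 : L) ⊗ₜ[ℚ_[l]] _) = _
  rw [Algebra.TensorProduct.tmul_mul_tmul, mul_one, one_mul]
  rfl

theorem tensorIwasawaToQuot_injective : Function.Injective (tensorIwasawaToQuot l G L) := by
  obtain ⟨n, b, B, hB⟩ := PadicExtension.exists_basis l L
  let E := TensorProduct.equivFinsuppOfBasisLeft (N := Iwasawa l G) b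
  let E' := TensorProduct.equivFinsuppOfBasisLeft (N := QuotIwasawa l G) B
  rw [injective_iff_map_eq_zero]
  intro x hx
  obtain ⟨f, rfl⟩ := E.symm.surjective x
  have h1 : tensorIwasawaToQuot l G L (E.symm f) =
      E'.symm (Finsupp.equivFunOnFinite.symm fun i => algebraMap _ (QuotIwasawa l G) (f i)) := by
    rw [TensorProduct.equivFinsuppOfBasisLeft_symm_apply, Finsupp.sum_fintype _ _ (by simp),
      TensorProduct.equivFinsuppOfBasisLeft_symm_apply, Finsupp.sum_fintype _ _ (by simp), map_sum]
    simp [tensorIwasawaToQuot_tmul, hB]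
  rw [h1, LinearEquiv.map_eq_zero_iff] at hx
  have : f = 0 := by
    ext1 i
    have h2 := DFunLike.congr_fun hx i
    exact (map_eq_zero_iff _ (IsFractionRing.injective (Iwasawa l G) (QuotIwasawa l G))).mp h2
  rw [this, map_zero]

theorem exists_mul_eq_tensorIwasawaToQuot (y : L ⊗[ℚ_[l]] QuotIwasawa l G) :
    ∃ (d : Iwasawa l G) (x : integralClosure ℤ_[l] L ⊗[ℤ_[l]] Iwasawa l G), d ≠ 0 ∧
      y * tensorIwasawaToQuot l G L (1 ⊗ₜ d) = tensorIwasawaToQuot l G L x := by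
  obtain ⟨n, b, B, hB⟩ := PadicExtension.exists_basis l L
  let E' := TensorProduct.equivFinsuppOfBasisLeft (N := QuotIwasawa l G) B
  obtain ⟨f, rfl⟩ := E'.symm.surjective y
  obtain ⟨d, hd⟩ := IsLocalization.exist_integer_multiples_of_finite
    (nonZeroDivisors (Iwasawa l G)) f
  choose s hs using hd
  refine ⟨d, ∑ i, b i ⊗ₜ s i, nonZeroDivisors.ne_zero d.2, ?_⟩
  rw [TensorProduct.equivFinsuppOfBasisLeft_symm_apply, Finsupp.sum_fintype _ _ (by simp), map_sum,
    Finset.sum_mul]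
  refine Finset.sum_congr rfl fun i _ => ?_
  rw [tensorIwasawaToQuot_tmul, tensorIwasawaToQuot_tmul, hs, Algebra.TensorProduct.tmul_mul_tmul,
    hB, Algebra.smul_def, mul_comm (f i)]
  simp

omit [FiniteDimensional ℚ_[l] L] in
theorem isUnit_tensorIwasawaToQuot [IsDomain (Iwasawa l G)]
    {x : integralClosure ℤ_[l] L ⊗[ℤ_[l]] Iwasawa l G}
    {d : Iwasawa l G} (hd : d ≠ 0) (hx : x ∣ 1 ⊗ₜ d) : IsUnit (tensorIwasawaToQuot l G L x) := by
  refine isUnit_of_dvd_unit (map_dvd (tensorIwasawaToQuot l G L) hx) ?_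
  rw [tensorIwasawaToQuot_tmul]
  have h1 : IsUnit (algebraMap (Iwasawa l G) (QuotIwasawa l G) d) :=
    IsLocalization.map_units (M := nonZeroDivisors _) _ ⟨d, mem_nonZeroDivisors_of_ne_zero hd⟩
  exact h1.map (Algebra.TensorProduct.includeRight :
    QuotIwasawa l G →ₐ[ℚ_[l]] L ⊗[ℚ_[l]] QuotIwasawa l G)

omit [FiniteDimensional ℚ_[l] L] in
theorem iwasawaOverToQuot_algebraMap (a : integralClosure ℤ_[l] L) :
    iwasawaOverToQuot l G L (algebraMap _ _ a) = algebraMap L (QuotIwasawaOver l G L) a := by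
  refine (tensorIwasawaToQuot_tmul l L G a 1).trans ?_
  rw [map_one]
  rfl

end

namespace completedGroupRing

open PadicExtension

variable {l : ℕ} [Fact l.Prime]
  (L : Type*) [Field L] [Algebra ℚ_[l] L] [FiniteDimensional ℚ_[l] L]
  [Algebra ℤ_[l] L] [IsScalarTower ℤ_[l] ℚ_[l] L]
  {G : Type*} [CommGroup G] [TopologicalSpace G] {g : G} {U : ℕ → OpenSubgroup G}

/-- If `G` is procyclic, then `Λ^{𝔬_L} G` is a power series ring, with total ring of fractions
`𝒬^L G`. -/
theorem IsProcyclicSystem.exists_powerSeries_algEquiv (hU : IsProcyclicSystem l g U) :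
    ∃ Θ : (integralClosure ℤ_[l] L)⟦X⟧ ≃ₐ[integralClosure ℤ_[l] L] IwasawaOver l G L,
      Θ PowerSeries.X = iwasawaVar l L g ∧
      @IsFractionRing (integralClosure ℤ_[l] L)⟦X⟧ _ (QuotIwasawaOver l G L) _
        ((iwasawaOverToQuot l G L).comp (Θ : _ →+* IwasawaOver l G L)).toAlgebra := by
  obtain ⟨e, he⟩ := hU.exists_algEquiv
  have : IsDomain (Iwasawa l G) := e.symm.toMulEquiv.isDomain
  let A := integralClosure ℤ_[l] L
  let Φ : A ⊗[ℤ_[l]] ℤ_[l]⟦X⟧ ≃ₐ[A] A⟦X⟧ :=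
    AlgEquiv.ofBijective _ PowerSeries.tensorToPowerSeries_bijective
  let Θ : A⟦X⟧ ≃ₐ[A] IwasawaOver l G L :=
    Φ.symm.trans (Algebra.TensorProduct.congr AlgEquiv.refl e)
  have hΦ : ∀ f : ℤ_[l]⟦X⟧, Θ (f.map (algebraMap ℤ_[l] A)) = (1 : A) ⊗ₜ[ℤ_[l]] e f := by
    intro f
    have h1 : f.map (algebraMap ℤ_[l] A) = Φ (1 ⊗ₜ f) := by
      refine Eq.symm ((PowerSeries.tensorToPowerSeries_tmul 1 f).trans ?_)
      rw [map_one, one_mul]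
    rw [h1]
    change Algebra.TensorProduct.congr AlgEquiv.refl e (Φ.symm (Φ _)) = _
    rw [Φ.symm_apply_apply]
    rfl
  refine ⟨Θ, ?_, ?_⟩
  · rw [← PowerSeries.map_X (algebraMap ℤ_[l] A), hΦ, he]
    rfl
  · let _ := ((iwasawaOverToQuot l G L).comp (Θ : A⟦X⟧ →+* IwasawaOver l G L)).toAlgebra
    have hinj : Function.Injective (algebraMap A⟦X⟧ (QuotIwasawaOver l G L)) :=
      (tensorIwasawaToQuot_injective l L G).comp Θ.injective
    refine (isLocalization_iff _ _).mpr ⟨?_, ?_, ?_⟩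
    · intro y
      -- The image of `y` divides that of a nonzero series over `ℤ_l`, which is already invertible
      -- in `𝒬G`.
      obtain ⟨f, hf0, hf⟩ := PowerSeries.exists_ne_zero_dvd_map (R := ℤ_[l])
        (nonZeroDivisors.ne_zero y.2)
      have h2 : Θ y ∣ (1 : A) ⊗ₜ[ℤ_[l]] e f := hΦ f ▸ map_dvd Θ hf
      exact isUnit_tensorIwasawaToQuot l L G ((map_ne_zero_iff e e.injective).mpr hf0) h2
    · intro z
      obtain ⟨d, x, hd, hx⟩ := exists_mul_eq_tensorIwasawaToQuot l L G z
      obtain ⟨f, rfl⟩ := e.surjective d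
      obtain ⟨x, rfl⟩ := Θ.surjective x
      have hf : f ≠ 0 := fun h => hd (by rw [h, map_zero])
      have hf' : f.map (algebraMap ℤ_[l] A) ≠ 0 := by
        rwa [Ne, map_eq_zero_iff _ (PowerSeries.map_injective _
          (FaithfulSMul.algebraMap_injective ℤ_[l] A))]
      refine ⟨(x, ⟨_, mem_nonZeroDivisors_of_ne_zero hf'⟩), ?_⟩
      rw [← hΦ] at hx
      exact hx
    · intro x y hxy
      exact ⟨1, by rw [hinj hxy]⟩

end completedGroupRing

/-! ### Transfer of the completion criterion to `𝒬^L G` -/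

section

variable {l : ℕ} [Fact l.Prime]
  {L : Type*} [Field L] [Algebra ℚ_[l] L] [FiniteDimensional ℚ_[l] L]
  [Algebra ℤ_[l] L] [IsScalarTower ℤ_[l] ℚ_[l] L]
  {G : Type*} [CommGroup G] [TopologicalSpace G]

theorem IsAdicValuation.comp_ringEquiv_iff {R S K : Type*} [CommRing R] [CommRing S] [CommRing K]
    (Θ : R ≃+* S) (φ : S →+* K) (π : R) (v : Valuation K ℤᵐ⁰) :
    IsAdicValuation (φ.comp (Θ : R →+* S)) (Ideal.span {π}) v ↔
      IsAdicValuation φ (Ideal.span {Θ π}) v := by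
  refine and_congr_right fun _ => forall_congr' fun x => iff_congr Iff.rfl ?_
  constructor
  · rintro ⟨r, s, hs, h⟩
    refine ⟨Θ r, Θ s, fun h1 => hs ?_, h⟩
    rw [Ideal.mem_span_singleton] at h1 ⊢
    exact (map_dvd_iff Θ).mp h1
  · rintro ⟨r, s, hs, h⟩
    refine ⟨Θ.symm r, Θ.symm s, fun h1 => hs ?_, by simpa using h⟩
    rw [Ideal.mem_span_singleton] at h1 ⊢
    rwa [← map_dvd_iff Θ.symm, Θ.symm_apply_apply]

theorem exists_completion_quotIwasawaOver_ringEquiv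
    (Θ : (integralClosure ℤ_[l] L)⟦X⟧ ≃ₐ[integralClosure ℤ_[l] L] IwasawaOver l G L)
    (hΘ : @IsFractionRing (integralClosure ℤ_[l] L)⟦X⟧ _ (QuotIwasawaOver l G L) _
        ((iwasawaOverToQuot l G L).comp (Θ : _ →+* IwasawaOver l G L)).toAlgebra)
    {M : Type*} [CommRing M] (hM : IsField M) (j : (integralClosure ℤ_[l] L)⟦X⟧ →+* M)
    (hj : Function.Injective j) (jL : L →+* M)
    (hjL : ∀ a : integralClosure ℤ_[l] L, jL a = j (PowerSeries.C a))
    (π : (integralClosure ℤ_[l] L)⟦X⟧) (w : Valuation M ℤᵐ⁰) [CompleteSpace (WithVal w)]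
    (hle : ∀ r, w (j r) ≤ 1) (hdvd : ∀ r, w (j r) < 1 → π ∣ r) (hπ : w (j π) = WithZero.exp (-1))
    (happ : ∀ m, w m ≤ 1 → ∃ r s, w (j s) = 1 ∧ w (j s * m - j r) < 1) :
    (Ideal.span {Θ π}).IsPrime ∧
      (∃ v, IsAdicValuation (iwasawaOverToQuot l G L) (Ideal.span {Θ π}) v) ∧
      ∀ v, IsAdicValuation (iwasawaOverToQuot l G L) (Ideal.span {Θ π}) v →
        ∃ e : v.Completion ≃+* M,
          (∀ a : L, e (algebraMap L (QuotIwasawaOver l G L) a) = jL a) ∧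
          (∀ r, e (iwasawaOverToQuot l G L (Θ r)) = j r) ∧
          ∀ y, y ∈ completedValuationRing v ↔ w (e y) ≤ 1 := by
  let A := integralClosure ℤ_[l] L
  let _ := ((iwasawaOverToQuot l G L).comp (Θ : A⟦X⟧ →+* IwasawaOver l G L)).toAlgebra
  have hK := hΘ
  have hiff := IsAdicValuation.comp_ringEquiv_iff (Θ : A⟦X⟧ ≃+* IwasawaOver l G L)
    (iwasawaOverToQuot l G L) π
  obtain ⟨h1, ⟨v, hv⟩, h3⟩ := Valuation.exists_adicCompletion_ringEquiv
    (K := QuotIwasawaOver l G L) hM j hj π w hle hdvd hπ happ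
  refine ⟨?_, ⟨v, (hiff v).mp hv⟩, fun v hv => ?_⟩
  · have h4 := Ideal.map_isPrime_of_equiv (I := Ideal.span {π}) (Θ : A⟦X⟧ ≃+* IwasawaOver l G L)
    rwa [Ideal.map_span, Set.image_singleton] at h4
  · obtain ⟨e, he, hy⟩ := h3 v ((hiff v).mpr hv)
    refine ⟨e, fun a => ?_, he, hy⟩
    let ι : L →+* M := ((e : v.Completion →+* M).comp UniformSpace.Completion.coeRingHom).comp
      ((WithVal.equiv v).symm.toRingHom.comp (algebraMap L (QuotIwasawaOver l G L)))
    have hA : IsFractionRing A L := inferInstance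
    -- Compatibility with `L` only has to be checked on its ring of integers, whose field of
    -- fractions is `L`.
    have h5 : ι = jL := by
      refine IsLocalization.ringHom_ext (nonZeroDivisors A) (RingHom.ext fun a => ?_)
      have h6 : ι (algebraMap A L a) = j (PowerSeries.C a) := by
        rw [← he]
        change e ↑(algebraMap L (QuotIwasawaOver l G L) a) = e _
        rw [← iwasawaOverToQuot_algebraMap, ← Θ.commutes]
        rfl
      exact h6.trans (hjL a).symm
    exact DFunLike.congr_fun h5 a

end

/-! ### Expansion of power series around a zero of a distinguished polynomial -/

namespace Polynomial.IsDistinguishedAt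

variable {A : Type*} [CommRing A] {I : Ideal A} {f : A[X]}

theorem pow (H : f.IsDistinguishedAt I) (n : ℕ) : (f ^ n).IsDistinguishedAt I := by
  induction n with
  | zero => exact ⟨⟨fun {n} h => by simp at h⟩, by rw [pow_zero]; exact monic_one⟩
  | succ n ih => rw [pow_succ]; exact ih.mul H

/-- Modulo `J ^ n` the element `s` is a zero of the distinguished polynomial `f ^ n`, so power
series can be evaluated there; completeness of `S` glues these evaluations. -/
theorem exists_algHom_of_aeval_mem [Nontrivial A] [IsAdicComplete I A] (H : f.IsDistinguishedAt I)
    {S : Type*} [CommRing S] [Algebra A S] (J : Ideal S) [IsAdicComplete J S] {s : S}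
    (hs : aeval s f ∈ J) : ∃ j : A⟦X⟧ →ₐ[A] S, j PowerSeries.X = s := by
  have h0 : ∀ n, aeval (Ideal.Quotient.mk (J ^ n) s) (f ^ n) = 0 := fun n => by
    have : aeval (Ideal.Quotient.mk (J ^ n) s) (f ^ n) =
        Ideal.Quotient.mkₐ A (J ^ n) (aeval s (f ^ n)) := by
      rw [← aeval_algHom_apply]; rfl
    rw [this, map_pow]
    exact Ideal.Quotient.eq_zero_iff_mem.mpr (Ideal.pow_mem_pow hs n)
  let F : ∀ n, A⟦X⟧ →ₐ[A] S ⧸ J ^ n := fun n => (H.pow n).evalPowerSeries _ (h0 n)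
  have hF : ∀ n (r : A[X]), F n (r : A⟦X⟧) = aeval (Ideal.Quotient.mk (J ^ n) s) r := fun n r =>
    (H.pow n).evalPowerSeries_coe _ (h0 n) r
  have hX : ∀ n, F n PowerSeries.X = Ideal.Quotient.mk (J ^ n) s := fun n => by
    rw [← coe_X, hF, aeval_X]
  have hcompat : ∀ {m n : ℕ} (hle : m ≤ n),
      (Ideal.Quotient.factorPow J hle).comp (F n : A⟦X⟧ →+* S ⧸ J ^ n) = F m := by
    intro m n hle
    have h1 : (Ideal.Quotient.factorₐ A (Ideal.pow_le_pow_right hle)).comp (F n) = F m := by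
      have h2 : (Ideal.Quotient.factorₐ A (Ideal.pow_le_pow_right hle)).comp (F n) PowerSeries.X =
          F m PowerSeries.X := by
        rw [AlgHom.comp_apply, hX, hX]; rfl
      refine (H.pow m).algHom_ext h2 ?_
      rw [h2, hX, h0]
    ext x
    exact DFunLike.congr_fun h1 x
  let j := IsAdicComplete.liftRingHom J (fun n => (F n : A⟦X⟧ →+* S ⧸ J ^ n)) hcompat
  have hj : ∀ n x, Ideal.Quotient.mk (J ^ n) (j x) = F n x := fun n x =>
    IsAdicComplete.mk_liftRingHom J _ hcompat n x
  have hext : ∀ x y : S, (∀ n, Ideal.Quotient.mk (J ^ n) x = Ideal.Quotient.mk (J ^ n) y) → x = y := by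
    intro x y h
    refine (IsHausdorff.eq_iff_smodEq (I := J)).mpr fun n => ?_
    rw [SModEq.sub_mem, smul_eq_mul, Ideal.mul_top]
    exact Ideal.Quotient.eq.mp (h n)
  refine ⟨{ j with commutes' := fun a => hext _ _ fun n => ?_ }, hext _ _ fun n => ?_⟩
  · exact (hj n _).trans ((F n).commutes a)
  · exact (hj n _).trans (hX n)

section Field

variable {E : Type*} [Field E] [Algebra A E] (θ : E)

theorem _root_.PowerSeries.aeval_C_add_X (r : A[X]) :
    aeval (PowerSeries.C θ + PowerSeries.X : E⟦X⟧) r =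
      (taylor θ (r.map (algebraMap A E)) : E⟦X⟧) := by
  rw [taylor_apply, comp, ← coeToPowerSeries.ringHom_apply, hom_eval₂, eval₂_map, aeval_def]
  congr 1
  · ext1 a
    simp [PowerSeries.algebraMap_apply]
  · simp [add_comm]

theorem _root_.PowerSeries.constantCoeff_aeval_C_add_X (r : A[X]) :
    PowerSeries.constantCoeff (aeval (PowerSeries.C θ + PowerSeries.X : E⟦X⟧) r) = aeval θ r := by
  rw [PowerSeries.aeval_C_add_X, Polynomial.constantCoeff_coe, taylor_coeff_zero, aeval_def,
    eval_map]

variable {θ} [IsDomain A] [IsAdicComplete I A]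

/-- Expansion around `θ`: `f(θ + X)` has constant term `f(θ) = 0`, so it lies in the ideal `(X)`,
for which `E⟦X⟧` is complete. -/
theorem exists_algHom_powerSeries (H : f.IsDistinguishedAt I) (hθ : aeval θ f = 0) :
    ∃ j : A⟦X⟧ →ₐ[A] E⟦X⟧, j PowerSeries.X = PowerSeries.C θ + PowerSeries.X := by
  refine H.exists_algHom_of_aeval_mem (Ideal.span {(PowerSeries.X : E⟦X⟧)}) ?_
  rw [Ideal.mem_span_singleton, PowerSeries.X_dvd_iff, PowerSeries.constantCoeff_aeval_C_add_X, hθ]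

/-- The data needed to identify the completion of the field of fractions of `A⟦X⟧` at `(f)` with
`E⸨X⸩`, where `E` is generated over `A` by a zero of `f`. -/
theorem exists_algHom_laurentSeries [IsNoetherianRing A] [CharZero E] (H : f.IsDistinguishedAt I)
    (hθ : aeval θ f = 0) (hmin : ∀ p : A[X], aeval θ p = 0 → f ∣ p)
    (hinj : Function.Injective (algebraMap A E))
    (hgen : ∀ x : E, ∃ s : A, s ≠ 0 ∧ ∃ r : A[X], algebraMap A E s * x = aeval θ r) :
    ∃ j : A⟦X⟧ →+* E⸨X⸩, (∀ a, j (PowerSeries.C a) = HahnSeries.C (algebraMap A E a)) ∧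
      Function.Injective j ∧ (∀ r, Valued.v (j r) ≤ (1 : ℤᵐ⁰)) ∧
      (∀ r, Valued.v (j r) < (1 : ℤᵐ⁰) → (f : A⟦X⟧) ∣ r) ∧
      Valued.v (j f) = WithZero.exp (-1) ∧
      (∀ m : E⸨X⸩, Valued.v m ≤ (1 : ℤᵐ⁰) →
        ∃ r s, Valued.v (j s) = (1 : ℤᵐ⁰) ∧ Valued.v (j s * m - j r) < (1 : ℤᵐ⁰)) := by
  obtain ⟨j, hj⟩ := H.exists_algHom_powerSeries hθ
  let ι : E⟦X⟧ →+* E⸨X⸩ := HahnSeries.ofPowerSeries ℤ E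
  have hιinj : Function.Injective ι := HahnSeries.ofPowerSeries_injective
  have hle : ∀ F : E⟦X⟧, Valued.v (ι F) ≤ (1 : ℤᵐ⁰) := fun F =>
    (LaurentSeries.val_le_one_iff_eq_coe E _).mpr ⟨F, rfl⟩
  have hlt : ∀ F : E⟦X⟧, Valued.v (ι F) < (1 : ℤᵐ⁰) ↔ PowerSeries.constantCoeff F = 0 :=
    LaurentSeries.valuation_ofPowerSeries_lt_one_iff
  have hjcoe : ∀ r : A[X], j (r : A⟦X⟧) = aeval (PowerSeries.C θ + PowerSeries.X : E⟦X⟧) r :=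
    fun r => by rw [AlgHom.map_polynomial_coe, hj]
  have hjf : PowerSeries.constantCoeff (j f) = 0 := by
    rw [hjcoe, PowerSeries.constantCoeff_aeval_C_add_X, hθ]
  -- The constant term is the value at `θ`. The Weierstrass remainder is a polynomial vanishing at
  -- `θ`, hence a multiple of `f`.
  have hdvd : ∀ g, PowerSeries.constantCoeff (j g) = 0 → (f : A⟦X⟧) ∣ g := by
    intro g hg
    obtain ⟨r, -, hr⟩ := H.exists_degree_lt_dvd_sub g
    have h1 : PowerSeries.constantCoeff (j (g - r)) = 0 := by
      obtain ⟨q, hq⟩ := hr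
      rw [hq, map_mul, map_mul, hjf, zero_mul]
    rw [map_sub, map_sub, hg, zero_sub, neg_eq_zero, hjcoe,
      PowerSeries.constantCoeff_aeval_C_add_X] at h1
    exact (dvd_iff_dvd_of_dvd_sub hr).mpr ((H.coe_dvd_coe_iff r).mpr (hmin r h1))
  -- The linear coefficient is `f'(θ)`. Were it zero, `f` would divide `f'`, of smaller degree, so
  -- `f' = 0`; in characteristic zero the monic `f` would then be `1`.
  have hf1 : PowerSeries.coeff 1 (j f) ≠ 0 := by
    rw [hjcoe, PowerSeries.aeval_C_add_X, coeff_coe, taylor_coeff_one, derivative_map, eval_map,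
      ← aeval_def]
    intro h
    have h1 := hmin _ h
    have h2 : f.derivative = 0 := eq_zero_of_dvd_of_degree_lt h1 (degree_derivative_lt H.monic.ne_zero)
    have : CharZero A :=
      ⟨fun m n h => Nat.cast_injective (R := E) (by simpa using congrArg (algebraMap A E) h)⟩
    have h3 : f.natDegree = 0 := derivative_eq_zero.mp h2
    rw [H.monic.natDegree_eq_zero.mp h3, map_one] at hθ
    exact one_ne_zero hθ
  have hjf0 : j f ≠ 0 := fun h => hf1 (by rw [h, map_zero])
  -- Remove the largest power of `f` from `g`; the cofactor would still be in the kernel, hence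
  -- divisible by `f` once more.
  have hjinj : ∀ g, j g = 0 → g = 0 := by
    intro g hg
    by_contra hg0
    have hfu : ¬ IsUnit (f : A⟦X⟧) := by
      intro h
      have := (h.map j).map (PowerSeries.constantCoeff (R := E))
      rw [hjf] at this
      exact not_isUnit_zero this
    obtain ⟨c, hc, hc'⟩ := (FiniteMultiplicity.of_not_isUnit hfu hg0).exists_eq_pow_mul_and_not_dvd
    rw [hc, map_mul, map_pow] at hg
    have := (mul_eq_zero.mp hg).resolve_left (pow_ne_zero _ hjf0)
    exact hc' (hdvd c (by rw [this, map_zero]))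
  refine ⟨ι.comp (j : A⟦X⟧ →+* E⟦X⟧), fun a => ?_, ?_, fun r => hle _, fun r hr => ?_, ?_, ?_⟩
  · have h1 : j (PowerSeries.C a) = PowerSeries.C (algebraMap A E a) := by
      have := j.commutes a
      rwa [PowerSeries.algebraMap_apply, PowerSeries.algebraMap_apply, Algebra.algebraMap_self_apply]
        at this
    change ι (j (PowerSeries.C a)) = _
    rw [h1]
    exact HahnSeries.ofPowerSeries_C _
  · exact hιinj.comp ((injective_iff_map_eq_zero j).mpr hjinj)
  · exact hdvd r ((hlt _).mp hr)
  -- The constant term vanishes and the linear one does not, so the order is exactly one.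
  · apply le_antisymm
    · rw [← Valuation.lt_one_iff_le]
      exact (hlt _).mpr hjf
    · by_contra h
      have h1 : Valued.v (ι (j f)) ≤ WithZero.exp (-(2 : ℤ)) := by
        rw [not_le] at h
        exact Valuation.lt_exp_iff_le.mp h
      have h2 := (LaurentSeries.valuation_le_iff_coeff_lt_eq_zero E).mp h1 1 (by norm_num)
      rw [PowerSeries.coeff_coe] at h2
      exact hf1 (by simpa using h2)
  · intro m hm
    obtain ⟨F, rfl⟩ := (LaurentSeries.val_le_one_iff_eq_coe E m).mp hm
    obtain ⟨s, hs, r, hr⟩ := hgen (PowerSeries.constantCoeff F)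
    have hjs : j (PowerSeries.C s) = PowerSeries.C (algebraMap A E s) := by
      have := j.commutes s
      rwa [PowerSeries.algebraMap_apply, PowerSeries.algebraMap_apply, Algebra.algebraMap_self_apply]
        at this
    refine ⟨r, PowerSeries.C s, ?_, ?_⟩
    · refine le_antisymm (hle _) (not_lt.mp fun h => hs (hinj ?_))
      have := (hlt _).mp h
      rwa [RingHom.coe_coe, hjs, PowerSeries.constantCoeff_C, ← (algebraMap A E).map_zero] at this
    · change Valued.v (ι (j _) * ι F - ι (j _)) < 1
      rw [← map_mul, ← map_sub, hlt, map_sub, map_mul, hjs, hjcoe,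
        PowerSeries.constantCoeff_aeval_C_add_X, ← hr, PowerSeries.constantCoeff_C, sub_self]

end Field

end Polynomial.IsDistinguishedAt

/-! ### The residue algebra of a distinguished polynomial -/

section

variable {l : ℕ} [Fact l.Prime]
  {L : Type*} [Field L] [Algebra ℚ_[l] L] [FiniteDimensional ℚ_[l] L]
  [Algebra ℤ_[l] L] [IsScalarTower ℤ_[l] ℚ_[l] L]

open Polynomial PadicExtension

namespace ResidueAlgebra

variable {I : Ideal (integralClosure ℤ_[l] L)} [IsAdicComplete I (integralClosure ℤ_[l] L)]
  {f : (integralClosure ℤ_[l] L)[X]}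

/-- The residue class of `T`. -/
def root (f : (integralClosure ℤ_[l] L)[X]) : ResidueAlgebra f :=
  Ideal.Quotient.mk _ ((1 : L) ⊗ₜ[ℤ_[l]] (PowerSeries.X : ℤ_[l]⟦X⟧))

/-- The quotient map `L ⊗ ℤ_l⟦X⟧ → (L ⊗ ℤ_l⟦X⟧) / (f)`. -/
def mk (f : (integralClosure ℤ_[l] L)[X]) : L ⊗[ℤ_[l]] ℤ_[l]⟦X⟧ →ₐ[L] ResidueAlgebra f :=
  Ideal.Quotient.mkₐ L _

omit [Algebra ℚ_[l] L] [FiniteDimensional ℚ_[l] L] [IsScalarTower ℤ_[l] ℚ_[l] L] in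
theorem aeval_root (f : (integralClosure ℤ_[l] L)[X]) :
    aeval (root f) (f.map (algebraMap _ L)) = 0 := by
  have h1 : mk f (aeval ((1 : L) ⊗ₜ[ℤ_[l]] (PowerSeries.X : ℤ_[l]⟦X⟧)) f) = 0 :=
    Ideal.Quotient.eq_zero_iff_mem.mpr (Ideal.mem_span_singleton_self _)
  rw [← h1, ← aeval_map_algebraMap L _ f, ← aeval_algHom_apply]
  rfl

/-- The element `1 ⊗ h` comes from `A⟦X⟧`, where Weierstrass division replaces `h` by a polynomial
modulo `f`. -/
theorem exists_aeval_root_eq (H : f.IsDistinguishedAt I) (x : ResidueAlgebra f) :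
    ∃ q : L[X], aeval (root f) q = x := by
  let A := integralClosure ℤ_[l] L
  obtain ⟨x, rfl⟩ : ∃ y, mk f y = x := Ideal.Quotient.mk_surjective x
  induction x using TensorProduct.induction_on with
  | zero => exact ⟨0, by simp⟩
  | add x y hx hy =>
    obtain ⟨p, hp⟩ := hx
    obtain ⟨q, hq⟩ := hy
    exact ⟨p + q, by rw [map_add, map_add, hp, hq]⟩
  | tmul a h =>
    let Φ : A ⊗[ℤ_[l]] ℤ_[l]⟦X⟧ ≃ₐ[A] A⟦X⟧ :=
      AlgEquiv.ofBijective _ PowerSeries.tensorToPowerSeries_bijective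
    have hΦ : ∀ h : ℤ_[l]⟦X⟧, Φ.symm (h.map (algebraMap ℤ_[l] A)) = (1 : A) ⊗ₜ[ℤ_[l]] h := by
      intro h
      rw [AlgEquiv.symm_apply_eq]
      refine Eq.symm ((PowerSeries.tensorToPowerSeries_tmul 1 h).trans ?_)
      rw [map_one, one_mul]
    let μ : A⟦X⟧ →ₐ[A] L ⊗[ℤ_[l]] ℤ_[l]⟦X⟧ :=
      (Algebra.TensorProduct.map (Algebra.ofId A L) (AlgHom.id ℤ_[l] ℤ_[l]⟦X⟧)).comp
        (Φ.symm : A⟦X⟧ →ₐ[A] A ⊗[ℤ_[l]] ℤ_[l]⟦X⟧)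
    have hμ : ∀ h : ℤ_[l]⟦X⟧, μ (h.map (algebraMap ℤ_[l] A)) = (1 : L) ⊗ₜ[ℤ_[l]] h := by
      intro h
      change Algebra.TensorProduct.map _ _ (Φ.symm _) = _
      rw [hΦ, Algebra.TensorProduct.map_tmul, map_one]
      rfl
    have hμX : μ PowerSeries.X = (1 : L) ⊗ₜ[ℤ_[l]] PowerSeries.X := by
      rw [← PowerSeries.map_X (algebraMap ℤ_[l] A), hμ]
    have hμc : ∀ r : A[X], mk f (μ r) = aeval (root f) (r.map (algebraMap A L)) := by
      intro r
      rw [AlgHom.map_polynomial_coe, hμX, ← aeval_map_algebraMap L, ← aeval_algHom_apply]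
      rfl
    obtain ⟨r, -, q, hq⟩ := H.exists_degree_lt_dvd_sub (h.map (algebraMap ℤ_[l] A))
    refine ⟨C a * r.map (algebraMap A L), ?_⟩
    have h1 : (a ⊗ₜ[ℤ_[l]] h : L ⊗[ℤ_[l]] ℤ_[l]⟦X⟧) = a • (1 ⊗ₜ[ℤ_[l]] h) := by
      rw [TensorProduct.smul_tmul', smul_eq_mul, mul_one]
    have h2 : mk f (μ (h.map (algebraMap ℤ_[l] A))) = mk f (μ r) := by
      rw [eq_add_of_sub_eq hq, map_add, map_mul, map_add, map_mul, hμc f, aeval_root, zero_mul,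
        zero_add]
    rw [h1, map_smul, ← hμ, h2, hμc, map_mul, aeval_C, Algebra.smul_def]

omit [Algebra ℚ_[l] L] [FiniteDimensional ℚ_[l] L] [IsScalarTower ℤ_[l] ℚ_[l] L] in
-- Evaluation at the root is well defined on power series because `f` is distinguished. It provides
-- a left inverse of `L[X]/(f) → ResidueAlgebra f`.
theorem exists_algHom_adjoinRoot (H : f.IsDistinguishedAt I) :
    ∃ ψ : ResidueAlgebra f →ₐ[L] AdjoinRoot (f.map (algebraMap _ L)),
      ψ (root f) = AdjoinRoot.root _ := by
  let A := integralClosure ℤ_[l] L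
  let p := f.map (algebraMap A L)
  have hr : aeval (AdjoinRoot.root p) f = 0 := by
    rw [← aeval_map_algebraMap L, AdjoinRoot.aeval_eq, AdjoinRoot.mk_self]
  let ε : A⟦X⟧ →ₐ[A] AdjoinRoot p := H.evalPowerSeries _ hr
  let m : ℤ_[l]⟦X⟧ →ₐ[ℤ_[l]] A⟦X⟧ := PowerSeries.mapAlgHom (Algebra.ofId ℤ_[l] A)
  have hm : m PowerSeries.X = PowerSeries.X := PowerSeries.map_X _
  have hε : ε PowerSeries.X = AdjoinRoot.root p := by
    rw [← coe_X, H.evalPowerSeries_coe, aeval_X]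
  let κ : L ⊗[ℤ_[l]] ℤ_[l]⟦X⟧ →ₐ[L] AdjoinRoot p :=
    Algebra.TensorProduct.lift (Algebra.ofId L _) ((ε.restrictScalars ℤ_[l]).comp m)
      fun _ _ => Commute.all _ _
  have hκ : κ ((1 : L) ⊗ₜ[ℤ_[l]] (PowerSeries.X : ℤ_[l]⟦X⟧)) = AdjoinRoot.root p := by
    rw [Algebra.TensorProduct.lift_tmul, map_one, one_mul, AlgHom.comp_apply, hm,
      AlgHom.restrictScalars_apply, hε]
  let t : L ⊗[ℤ_[l]] ℤ_[l]⟦X⟧ := (1 : L) ⊗ₜ[ℤ_[l]] PowerSeries.X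
  have hκt : κ (aeval t f) = 0 := by
    rw [← aeval_map_algebraMap L t f, ← aeval_algHom_apply, hκ, aeval_map_algebraMap, hr]
  have hker : ∀ a ∈ Ideal.span {aeval t f}, κ a = 0 := fun a ha => by
    obtain ⟨c, rfl⟩ := Ideal.mem_span_singleton.mp ha
    rw [map_mul, hκt, zero_mul]
  let ψ : (L ⊗[ℤ_[l]] ℤ_[l]⟦X⟧) ⧸ Ideal.span {aeval t f} →ₐ[L] AdjoinRoot p :=
    Ideal.Quotient.liftₐ _ κ hker
  exact ⟨ψ, hκ⟩

/-- The algebra is `L[X]/(f)`, and the monic `f` stays irreducible over `L` by Gauss's lemma. -/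
theorem isField (H : f.IsDistinguishedAt I) (hf : Irreducible f) : IsField (ResidueAlgebra f) := by
  let A := integralClosure ℤ_[l] L
  let p := f.map (algebraMap A L)
  have : Fact (Irreducible p) :=
    ⟨(H.monic.irreducible_iff_irreducible_map_fraction_map (K := L)).mp hf⟩
  obtain ⟨ψ, hψ⟩ := exists_algHom_adjoinRoot H
  let φ : AdjoinRoot p →ₐ[L] ResidueAlgebra f :=
    AdjoinRoot.liftAlgHom p (Algebra.ofId L _) (root f) (aeval_root f)
  have hφ : φ (AdjoinRoot.root p) = root f := AdjoinRoot.liftAlgHom_root _ _ _ _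
  have hψφ : ψ.comp φ = AlgHom.id L _ := AdjoinRoot.algHom_ext (by
    rw [AlgHom.comp_apply, hφ, hψ]; rfl)
  have hsurj : Function.Surjective φ := fun x => by
    obtain ⟨q, hq⟩ := exists_aeval_root_eq H x
    exact ⟨aeval (AdjoinRoot.root p) q, by rw [← aeval_algHom_apply, hφ, hq]⟩
  have hinj : Function.Injective φ :=
    Function.LeftInverse.injective (g := ψ) fun x => DFunLike.congr_fun hψφ x
  exact (AlgEquiv.ofBijective φ ⟨hinj, hsurj⟩).toMulEquiv.symm.isField (Field.toIsField _)

end ResidueAlgebra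

end

/-! ### Completion at `(T)` and at `(f)` -/

section

open Polynomial PadicExtension

/-- A field generated over a finite extension of `ℚ_l` by an algebraic element is a
one-dimensional local field. -/
theorem IsLocalFieldOfDim.one_of_aeval_surjective (l : ℕ) [Fact l.Prime]
    {L : Type*} [Field L] [Algebra ℚ_[l] L] [FiniteDimensional ℚ_[l] L] {E : Type*} [Field E] [Algebra L E] {θ : E}
    {p : L[X]} (hp : p.Monic) (hθ : aeval θ p = 0) (hgen : ∀ x, ∃ q : L[X], aeval θ q = x) :
    IsLocalFieldOfDim 1 E := by
  have := hp.finite_adjoinRoot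
  have : FiniteDimensional L E := by
    refine Module.Finite.of_surjective
      (AdjoinRoot.liftAlgHom p (Algebra.ofId L E) θ hθ).toLinearMap fun x => ?_
    obtain ⟨q, rfl⟩ := hgen x
    exact ⟨AdjoinRoot.mk p q, AdjoinRoot.liftAlgHom_mk p _ _ hθ q⟩
  let _ : Algebra ℚ_[l] E := ((algebraMap L E).comp (algebraMap ℚ_[l] L)).toAlgebra
  let _ : Algebra ℤ_[l] E := ((algebraMap ℚ_[l] E).comp (algebraMap ℤ_[l] ℚ_[l])).toAlgebra
  have : IsScalarTower ℚ_[l] L E := IsScalarTower.of_algebraMap_eq fun _ => rfl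
  have : IsScalarTower ℤ_[l] ℚ_[l] E := IsScalarTower.of_algebraMap_eq fun _ => rfl
  have : FiniteDimensional ℚ_[l] E := FiniteDimensional.trans ℚ_[l] L E
  obtain ⟨v, hv, hint⟩ := exists_valuation l E
  exact isLocalFieldOfDim_one hv hint

variable {l : ℕ} [Fact l.Prime]
  {L : Type*} [Field L] [Algebra ℚ_[l] L] [FiniteDimensional ℚ_[l] L]
  [Algebra ℤ_[l] L] [IsScalarTower ℤ_[l] ℚ_[l] L]

variable {I : Ideal (integralClosure ℤ_[l] L)} [IsAdicComplete I (integralClosure ℤ_[l] L)]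
  {f : (integralClosure ℤ_[l] L)[X]}
  {G : Type*} [CommGroup G] [TopologicalSpace G]

/-- The pair `(E, θ)` is left abstract in order to cover both `(T)`, with `E = L` and `θ = 0`, and
`(f)`, with the residue algebra. -/
theorem exists_completion_ringEquiv_laurentSeries
    {Θ : (integralClosure ℤ_[l] L)⟦X⟧ ≃ₐ[integralClosure ℤ_[l] L] IwasawaOver l G L}
    (hΘ : @IsFractionRing (integralClosure ℤ_[l] L)⟦X⟧ _ (QuotIwasawaOver l G L) _
        ((iwasawaOverToQuot l G L).comp (Θ : _ →+* IwasawaOver l G L)).toAlgebra)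
    (H : f.IsDistinguishedAt I) (hf : Irreducible f) {E : Type*} [Field E] [Algebra L E] {θ : E}
    (hθ : aeval θ (f.map (algebraMap _ L)) = 0) (hgen : ∀ x, ∃ q : L[X], aeval θ q = x) :
    (Ideal.span {Θ f}).IsPrime ∧
      (∃ v, IsAdicValuation (iwasawaOverToQuot l G L) (Ideal.span {Θ f}) v) ∧
      ∀ v, IsAdicValuation (iwasawaOverToQuot l G L) (Ideal.span {Θ f}) v →
        IsLocalFieldOfDim 2 v.Completion ∧ ∃ e : v.Completion ≃+* E⸨X⸩,
          (∀ a : L, e (algebraMap L (QuotIwasawaOver l G L) a) = HahnSeries.C (algebraMap L E a)) ∧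
          ∀ y, y ∈ completedValuationRing v ↔ e y ∈ (HahnSeries.ofPowerSeries ℤ E).range := by
  let A := integralClosure ℤ_[l] L
  have hp : (f.map (algebraMap A L)).Monic := H.monic.map _
  have hirr : Irreducible (f.map (algebraMap A L)) :=
    (H.monic.irreducible_iff_irreducible_map_fraction_map (K := L)).mp hf
  have hAL : Function.Injective (algebraMap A L) := Subtype.val_injective
  have hLE : Function.Injective (algebraMap L E) := (algebraMap L E).injective
  have hAE : Function.Injective (algebraMap A E) := by
    rw [IsScalarTower.algebraMap_eq A L E]
    exact hLE.comp hAL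
  have : CharZero L := charZero_of_injective_algebraMap (algebraMap ℚ_[l] L).injective
  have : CharZero E := charZero_of_injective_algebraMap hLE
  -- Over `L` the polynomial `f` is the minimal polynomial of `θ`; divisibility by a monic
  -- polynomial descends from `L` to `A`.
  have hmin : ∀ q : A[X], aeval θ q = 0 → f ∣ q := by
    intro q hq
    rw [← map_dvd_map (algebraMap A L) hAL H.monic,
      minpoly.eq_of_irreducible_of_monic hirr hθ hp]
    exact minpoly.dvd _ _ (by rwa [aeval_map_algebraMap])
  have hgenA : ∀ x : E, ∃ s : A, s ≠ 0 ∧ ∃ r : A[X], algebraMap A E s * x = aeval θ r := by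
    intro x
    obtain ⟨q, rfl⟩ := hgen x
    obtain ⟨s, hs, h⟩ := IsLocalization.integerNormalization_spec (nonZeroDivisors A) q
    refine ⟨s, nonZeroDivisors.ne_zero hs,
      IsLocalization.integerNormalization (nonZeroDivisors A) q, ?_⟩
    rw [← aeval_map_algebraMap L _ (IsLocalization.integerNormalization _ q), h, ← Algebra.smul_def, algebra_compatible_smul L s (aeval θ q),
      ← map_smul, ← algebra_compatible_smul]
  obtain ⟨j, hjC, hj, hle, hdvd, hπ, happ⟩ := H.exists_algHom_laurentSeries
    (by rwa [aeval_map_algebraMap] at hθ) hmin hAE hgenA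
  have := LaurentSeries.completeSpace_withVal (k := E)
  obtain ⟨h1, h2, h3⟩ := exists_completion_quotIwasawaOver_ringEquiv Θ hΘ (Field.toIsField _) j hj
    (HahnSeries.C.comp (algebraMap L E)) (fun a => (hjC a).symm) f Valued.v hle hdvd hπ happ
  refine ⟨h1, h2, fun v hv => ?_⟩
  obtain ⟨e, he, -, hy⟩ := h3 v hv
  refine ⟨IsLocalFieldOfDim.congr _ e.symm
    (IsLocalFieldOfDim.one_of_aeval_surjective l hp hθ hgen).laurentSeries, e, he, fun y => ?_⟩
  rw [hy, LaurentSeries.mem_range_ofPowerSeries_iff]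

end

/-! ### The ring `F{{T}}` -/

/-- `F` is complete with respect to the normalized discrete valuation `v`. -/
class Valuation.IsCompleteDiscrete {F : Type*} [Field F] (v : Valuation F ℤᵐ⁰) : Prop where
  surjective : Function.Surjective v
  completeSpace : CompleteSpace (WithVal v)

namespace TwoSidedSeries

open Valuation Topology

variable {F : Type*} [Field F] {v : Valuation F ℤᵐ⁰}

section Sums

theorem mul_exp_one_ne_zero {c : ℤᵐ⁰} (hc : c ≠ 0) : c * WithZero.exp 1 ≠ 0 :=
  mul_ne_zero hc WithZero.exp_ne_zero

theorem lt_mul_exp_one_iff {a c : ℤᵐ⁰} (hc : c ≠ 0) : a < c * WithZero.exp 1 ↔ a ≤ c := by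
  rw [← WithZero.exp_log hc, ← WithZero.exp_add, lt_exp_iff_le, add_sub_cancel_right]

/-- Values are discrete, so `≤ c` is the strict bound `< c * exp 1`. -/
theorem vsum_le {t : ℤ → F} {c : ℤᵐ⁰} (h : ∀ i, v (t i) ≤ c) : v (vsum v t) ≤ c := by
  rcases eq_or_ne c 0 with rfl | hc
  · have : t = 0 := by
      funext i
      simpa using h i
    subst this
    simp [vsum]
  · rw [← lt_mul_exp_one_iff hc]
    exact vsum_lt (mul_exp_one_ne_zero hc) fun i => (lt_mul_exp_one_iff hc).mpr (h i)

theorem vsum_zero : vsum v 0 = 0 := by simp [vsum]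

theorem vsum_eq_sum {t : ℤ → F} {S : Finset ℤ} (h : ∀ i ∉ S, t i = 0) :
    vsum v t = ∑ i ∈ S, t i := by
  rw [vsum, tsum_eq_sum (s := S) fun i hi => by rw [h i hi, WithVal.toVal_zero]]
  exact map_sum (WithVal.equiv v) _ _

variable (v) in
theorem nonarchimedeanAddGroup (hv : Function.Surjective v) :
    NonarchimedeanAddGroup (WithVal v) where
  is_nonarchimedean U hU := by
    obtain ⟨n, -, hn⟩ := ((hasBasis_nhds_withVal hv (0 : WithVal v)).mem_iff).mp hU
    let D : AddSubgroup (WithVal v) :=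
      { carrier := {y | v y.ofVal ≤ WithZero.exp (-(n : ℤ))}
        zero_mem' := by simp
        add_mem' := fun {a b} ha hb => by
          have := (v.map_add a.ofVal b.ofVal).trans (max_le ha hb)
          simpa using this
        neg_mem' := fun {a} ha => by simpa using ha }
    refine ⟨⟨D, D.isOpen_of_mem_nhds (g := 0) ?_⟩, fun y hy => hn ?_⟩
    · refine ((hasBasis_nhds_withVal hv (0 : WithVal v)).mem_iff).mpr ⟨n, trivial, fun y hy => ?_⟩
      simpa [D] using hy
    · have : v y.ofVal ≤ WithZero.exp (-(n : ℤ)) := hy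
      simpa using this

variable [v.IsCompleteDiscrete]

/-- In a complete nonarchimedean group it suffices that the terms tend to zero along cofinite sets.
-/
theorem summable_toVal {κ : Type*} {t : κ → F} (ht : ∀ c ≠ 0, {i | c ≤ v (t i)}.Finite) :
    Summable fun i => WithVal.toVal v (t i) := by
  have hv := IsCompleteDiscrete.surjective (v := v)
  have := IsCompleteDiscrete.completeSpace (v := v)
  have := nonarchimedeanAddGroup v hv
  refine NonarchimedeanAddGroup.summable_of_tendsto_cofinite_zero ?_
  refine (hasBasis_nhds_withVal hv (0 : WithVal v)).tendsto_right_iff.mpr fun n _ => ?_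
  rw [Filter.eventually_cofinite]
  refine (ht _ (WithZero.exp_ne_zero (a := -(n : ℤ)))).subset fun i hi => ?_
  have hi' : ¬ v ((WithVal.toVal v (t i)).ofVal - (0 : WithVal v).ofVal) ≤ _ := hi
  simp only [WithVal.ofVal_zero, sub_zero, not_le] at hi'
  exact hi'.le

theorem vsum_add {s t : ℤ → F} (hs : ∀ c ≠ 0, {i | c ≤ v (s i)}.Finite)
    (ht : ∀ c ≠ 0, {i | c ≤ v (t i)}.Finite) :
    vsum v (fun i => s i + t i) = vsum v s + vsum v t := by
  have := (summable_toVal hs).tsum_add (summable_toVal ht)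
  simp only [vsum, WithVal.toVal_add]
  rw [this, WithVal.ofVal_add]

/-- Splits off the finite part on `S`, so that a coefficient of a product can be computed modulo
small terms. -/
theorem vsum_sub_sum_lt {t : ℤ → F} (ht : ∀ c ≠ 0, {i | c ≤ v (t i)}.Finite) (S : Finset ℤ)
    {c : ℤᵐ⁰} (hc : c ≠ 0) (h : ∀ i ∉ S, v (t i) < c) : v (vsum v t - ∑ i ∈ S, t i) < c := by
  classical
  let s : ℤ → F := fun i => if i ∈ S then t i else 0
  let u : ℤ → F := fun i => if i ∈ S then 0 else t i
  have hs : ∀ c ≠ 0, {i | c ≤ v (s i)}.Finite := fun c hc => by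
    refine S.finite_toSet.subset fun i hi => ?_
    by_contra hiS
    have : c ≤ v (s i) := hi
    rw [show s i = 0 from if_neg hiS, map_zero, le_zero_iff] at this
    exact hc this
  have hu : ∀ c ≠ 0, {i | c ≤ v (u i)}.Finite := fun c hc => by
    refine (ht c hc).subset fun i hi => ?_
    have h1 : c ≤ v (u i) := hi
    change c ≤ v (t i)
    by_cases hiS : i ∈ S
    · rw [show u i = 0 from if_pos hiS, map_zero, le_zero_iff] at h1
      exact absurd h1 hc
    · rwa [show u i = t i from if_neg hiS] at h1
  have hsum : t = fun i => s i + u i := by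
    funext i
    by_cases hiS : i ∈ S <;> simp [s, u, hiS]
  have h1 : vsum v s = ∑ i ∈ S, t i := by
    rw [vsum_eq_sum (S := S) fun i hi => if_neg hi]
    exact Finset.sum_congr rfl fun i hi => if_pos hi
  have h2 : vsum v t = vsum v s + vsum v u := by
    rw [← vsum_add hs hu, ← hsum]
  rw [h2, h1, add_sub_cancel_left]
  refine vsum_lt hc fun i => ?_
  by_cases hiS : i ∈ S
  · rw [show u i = 0 from if_pos hiS, map_zero]
    exact zero_lt_iff.mpr hc
  · rw [show u i = t i from if_neg hiS]
    exact h i hiS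

end Sums

theorem exists_forall_mul_lt (a : TwoSidedSeries v) (C : ℤᵐ⁰) {c : ℤᵐ⁰} (hc : c ≠ 0) :
    ∃ N : ℤ, ∀ i ≤ N, v (a.coeff i) * C < c := by
  rcases eq_or_ne C 0 with rfl | hC
  · exact ⟨0, fun i _ => by rw [mul_zero]; exact zero_lt_iff.mpr hc⟩
  · obtain ⟨N, hN⟩ := a.tendsto (c / C) (div_ne_zero hc hC)
    refine ⟨N, fun i hi => ?_⟩
    calc _ < c / C * C := mul_lt_mul_of_pos_right (hN i hi) (zero_lt_iff.mpr hC)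
      _ = c := div_mul_cancel₀ c hC

/-- For `i` far to the left the first factor is small, for `i` far to the right the second;
boundedness controls the other factor. -/
theorem finite_mul (a b : TwoSidedSeries v) (n : ℤ) {c : ℤᵐ⁰} (hc : c ≠ 0) :
    {i | c ≤ v (a.coeff i * b.coeff (n - i))}.Finite := by
  obtain ⟨A, hA⟩ := a.bounded
  obtain ⟨B, hB⟩ := b.bounded
  obtain ⟨M, hM⟩ := a.exists_forall_mul_lt B hc
  obtain ⟨N, hN⟩ := b.exists_forall_mul_lt A hc
  refine (Set.finite_Icc M (n - N)).subset fun i hi => ?_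
  have hi' : c ≤ v (a.coeff i) * v (b.coeff (n - i)) := by rw [← map_mul]; exact hi
  constructor
  · by_contra h
    exact absurd (hi'.trans (mul_le_mul' le_rfl (hB _))) (not_le.mpr (hM i (by lia)))
  · by_contra h
    rw [mul_comm] at hi'
    exact absurd (hi'.trans (mul_le_mul' le_rfl (hA _))) (not_le.mpr (hN (n - i) (by lia)))

theorem finite_mul_mul (a b d : TwoSidedSeries v) (n : ℤ) {c : ℤᵐ⁰} (hc : c ≠ 0) :
    {p : ℤ × ℤ | c ≤ v (a.coeff p.1 * (b.coeff (p.2 - p.1) * d.coeff (n - p.2)))}.Finite := by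
  obtain ⟨A, hA⟩ := a.bounded
  obtain ⟨B, hB⟩ := b.bounded
  obtain ⟨D, hD⟩ := d.bounded
  obtain ⟨M, hM⟩ := a.exists_forall_mul_lt (B * D) hc
  obtain ⟨N, hN⟩ := b.exists_forall_mul_lt (A * D) hc
  obtain ⟨K, hK⟩ := d.exists_forall_mul_lt (A * B) hc
  refine ((Set.finite_Icc M (n - K - N)).prod (Set.finite_Icc (M + N) (n - K))).subset ?_
  rintro ⟨i, j⟩ hij
  have h : c ≤ v (a.coeff i) * (v (b.coeff (j - i)) * v (d.coeff (n - j))) := by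
    rw [← map_mul, ← map_mul]; exact hij
  have h1 : M ≤ i := by
    by_contra h0
    exact absurd (h.trans (mul_le_mul' le_rfl (mul_le_mul' (hB _) (hD _))))
      (not_le.mpr (hM i (by lia)))
  have h2 : N ≤ j - i := by
    by_contra h0
    rw [mul_left_comm] at h
    exact absurd (h.trans (mul_le_mul' le_rfl (mul_le_mul' (hA _) (hD _))))
      (not_le.mpr (hN (j - i) (by lia)))
  have h3 : K ≤ n - j := by
    by_contra h0
    rw [← mul_assoc, mul_comm] at h
    exact absurd (h.trans (mul_le_mul' le_rfl (mul_le_mul' (hA _) (hB _))))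
      (not_le.mpr (hK (n - j) (by lia)))
  simp only [Set.mem_prod, Set.mem_Icc]
  lia

instance : Zero (TwoSidedSeries v) := ⟨⟨0, ⟨0, fun i => by simp⟩, fun c hc => ⟨0, fun i _ => by
  simpa using zero_lt_iff.mpr hc⟩⟩⟩

instance : Neg (TwoSidedSeries v) where
  neg a :=
    { coeff := -a.coeff
      bounded := by simpa using a.bounded
      tendsto := by simpa using a.tendsto }

instance : One (TwoSidedSeries v) := ⟨monomial v 0 1⟩

@[simp] theorem coeff_zero (n : ℤ) : (0 : TwoSidedSeries v).coeff n = 0 := rfl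
@[simp] theorem coeff_add (a b : TwoSidedSeries v) (n : ℤ) :
    (a + b).coeff n = a.coeff n + b.coeff n := rfl
@[simp] theorem coeff_neg (a : TwoSidedSeries v) (n : ℤ) : (-a).coeff n = -a.coeff n := rfl
theorem coeff_mul (a b : TwoSidedSeries v) (n : ℤ) :
    (a * b).coeff n = vsum v fun i => a.coeff i * b.coeff (n - i) := rfl
theorem coeff_monomial (m : ℤ) (x : F) (n : ℤ) :
    (monomial v m x).coeff n = if n = m then x else 0 := by
  change Pi.single (M := fun _ => F) m x n = _
  rw [Pi.single_apply]

theorem coeff_monomial_mul (m : ℤ) (x : F) (a : TwoSidedSeries v) (n : ℤ) :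
    (monomial v m x * a).coeff n = x * a.coeff (n - m) := by
  rw [coeff_mul, vsum_eq_sum (S := {m}), Finset.sum_singleton, coeff_monomial, if_pos rfl]
  intro i hi
  rw [coeff_monomial, if_neg (by simpa using hi), zero_mul]

instance : AddCommGroup (TwoSidedSeries v) where
  add_assoc a b c := by ext; simp [add_assoc]
  zero_add a := by ext; simp
  add_zero a := by ext; simp
  add_comm a b := by ext; simp [add_comm]
  neg_add_cancel a := by ext; simp
  nsmul := nsmulRec
  zsmul := zsmulRec

variable [v.IsCompleteDiscrete]

omit [v.IsCompleteDiscrete] in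
protected theorem mul_comm (a b : TwoSidedSeries v) : a * b = b * a := by
  ext n
  rw [coeff_mul, coeff_mul, vsum, vsum, ← (Equiv.subLeft n).tsum_eq]
  congr 2
  funext i
  rw [Equiv.subLeft_apply, sub_sub_cancel, mul_comm]

protected theorem left_distrib (a b c : TwoSidedSeries v) : a * (b + c) = a * b + a * c := by
  ext n
  simp only [coeff_mul, coeff_add, mul_add]
  exact vsum_add (fun _ => finite_mul a b n) (fun _ => finite_mul a c n)

omit [v.IsCompleteDiscrete] in
protected theorem one_mul (a : TwoSidedSeries v) : 1 * a = a := by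
  ext n
  change (monomial v 0 1 * a).coeff n = _
  rw [coeff_monomial_mul, one_mul, sub_zero]

omit [v.IsCompleteDiscrete] in
protected theorem zero_mul (a : TwoSidedSeries v) : 0 * a = 0 := by
  ext n
  rw [coeff_mul]
  simp only [coeff_zero, zero_mul]
  exact vsum_zero

/-- The double family is summable over `ℤ × ℤ` by `finite_mul_mul`, which justifies exchanging the
sums; the shift `j = i + k` then matches the indices. -/
protected theorem mul_assoc (a b c : TwoSidedSeries v) : a * b * c = a * (b * c) := by
  have := IsCompleteDiscrete.completeSpace (v := v)
  ext n
  let A : ℤ → WithVal v := fun i => WithVal.toVal v (a.coeff i)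
  let B : ℤ → WithVal v := fun i => WithVal.toVal v (b.coeff i)
  let C : ℤ → WithVal v := fun i => WithVal.toVal v (c.coeff i)
  have hAB : ∀ m, WithVal.toVal v ((a * b).coeff m) = ∑' i, A i * B (m - i) := fun m => by
    rw [coeff_mul, vsum, WithVal.toVal_ofVal]; simp only [WithVal.toVal_mul, A, B]
  have hBC : ∀ m, WithVal.toVal v ((b * c).coeff m) = ∑' i, B i * C (m - i) := fun m => by
    rw [coeff_mul, vsum, WithVal.toVal_ofVal]; simp only [WithVal.toVal_mul, B, C]
  have h1 : ∀ (x y : TwoSidedSeries v) m,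
      Summable fun i => WithVal.toVal v (x.coeff i) * WithVal.toVal v (y.coeff (m - i)) :=
    fun x y m => by
      simpa only [WithVal.toVal_mul] using summable_toVal (v := v) fun _ => finite_mul x y m
  have h2 : Summable (Function.uncurry fun i j => A i * (B (j - i) * C (n - j))) := by
    have := summable_toVal (v := v) fun _ => finite_mul_mul a b c n
    simp only [WithVal.toVal_mul] at this
    exact this
  apply (WithVal.equiv v).symm.injective
  change WithVal.toVal v _ = WithVal.toVal v _
  rw [coeff_mul, coeff_mul, vsum, vsum, WithVal.toVal_ofVal, WithVal.toVal_ofVal]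
  simp only [WithVal.toVal_mul, hAB, hBC]
  calc ∑' j, (∑' i, A i * B (j - i)) * C (n - j)
      = ∑' j, ∑' i, A i * (B (j - i) * C (n - j)) := by
        refine tsum_congr fun j => ?_
        rw [← (h1 a b j).tsum_mul_right]
        exact tsum_congr fun i => mul_assoc _ _ _
    _ = ∑' i, ∑' j, A i * (B (j - i) * C (n - j)) := h2.tsum_comm
    _ = ∑' i, A i * ∑' k, B k * C (n - i - k) := by
        refine tsum_congr fun i => ?_
        rw [← (h1 b c (n - i)).tsum_mul_left, ← (Equiv.addRight i).tsum_eq]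
        refine tsum_congr fun j => ?_
        rw [Equiv.coe_addRight, add_sub_cancel_right, sub_sub, add_comm i j]

instance : CommRing (TwoSidedSeries v) where
  __ := (inferInstance : AddCommGroup (TwoSidedSeries v))
  mul_assoc := TwoSidedSeries.mul_assoc
  mul_comm := TwoSidedSeries.mul_comm
  left_distrib := TwoSidedSeries.left_distrib
  right_distrib a b c := by
    rw [TwoSidedSeries.mul_comm, TwoSidedSeries.left_distrib, TwoSidedSeries.mul_comm c,
      TwoSidedSeries.mul_comm c]
  one_mul := TwoSidedSeries.one_mul
  mul_one a := by rw [TwoSidedSeries.mul_comm, TwoSidedSeries.one_mul]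
  zero_mul := TwoSidedSeries.zero_mul
  mul_zero a := by rw [TwoSidedSeries.mul_comm, TwoSidedSeries.zero_mul]

end TwoSidedSeries

/-! ### The Gauss valuation of `F{{T}}` -/

namespace TwoSidedSeries

open Valuation Topology

variable {F : Type*} [Field F] {v : Valuation F ℤᵐ⁰}

/-- The values are bounded and discrete, so their supremum is attained. -/
theorem exists_forall_coeff_le (a : TwoSidedSeries v) :
    ∃ i, ∀ j, v (a.coeff j) ≤ v (a.coeff i) := by
  by_cases h0 : ∀ j, a.coeff j = 0
  · exact ⟨0, fun j => by simp [h0]⟩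
  push Not at h0
  obtain ⟨i₁, hi₁⟩ := h0
  obtain ⟨c, hc⟩ := a.bounded
  have hv : ∀ {i}, a.coeff i ≠ 0 → v (a.coeff i) ≠ 0 := fun h => (v.ne_zero_iff).mpr h
  have hc0 : c ≠ 0 := fun h => hv hi₁ (le_zero_iff.mp (h ▸ hc i₁))
  obtain ⟨z, ⟨i, hi, hz⟩, hmax⟩ := Int.exists_greatest_of_bdd
    (P := fun z => ∃ i, a.coeff i ≠ 0 ∧ WithZero.log (v (a.coeff i)) = z)
    ⟨WithZero.log c, by
      rintro z ⟨i, hi, rfl⟩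
      exact (WithZero.log_le_log (hv hi) hc0).mpr (hc i)⟩ ⟨_, i₁, hi₁, rfl⟩
  refine ⟨i, fun j => ?_⟩
  by_cases hj : a.coeff j = 0
  · simp [hj]
  · rw [← WithZero.log_le_log (hv hj) (hv hi), hz]
    exact hmax _ ⟨j, hj, rfl⟩

/-- The maximum of the valuations of the coefficients. -/
def gaussNorm (a : TwoSidedSeries v) : ℤᵐ⁰ := v (a.coeff a.exists_forall_coeff_le.choose)

theorem le_gaussNorm (a : TwoSidedSeries v) (i : ℤ) : v (a.coeff i) ≤ a.gaussNorm :=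
  a.exists_forall_coeff_le.choose_spec i

theorem gaussNorm_le_iff {a : TwoSidedSeries v} {c : ℤᵐ⁰} :
    a.gaussNorm ≤ c ↔ ∀ i, v (a.coeff i) ≤ c :=
  ⟨fun h i => (a.le_gaussNorm i).trans h, fun h => h _⟩

theorem gaussNorm_lt_iff {a : TwoSidedSeries v} {c : ℤᵐ⁰} :
    a.gaussNorm < c ↔ ∀ i, v (a.coeff i) < c :=
  ⟨fun h i => (a.le_gaussNorm i).trans_lt h, fun h => h _⟩

theorem gaussNorm_eq_zero_iff {a : TwoSidedSeries v} : a.gaussNorm = 0 ↔ a = 0 := by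
  rw [← le_zero_iff, gaussNorm_le_iff]
  simp only [le_zero_iff, map_eq_zero]
  exact ⟨fun h => by ext i; exact h i, fun h i => by rw [h, coeff_zero]⟩

/-- Coefficients tend to zero on the left, so there is a leftmost one of maximal value; it serves as
leading term in Gauss's lemma and in inversion. -/
theorem exists_least_coeff {a : TwoSidedSeries v} (ha : a ≠ 0) :
    ∃ i, v (a.coeff i) = a.gaussNorm ∧ ∀ j < i, v (a.coeff j) < a.gaussNorm := by
  obtain ⟨N, hN⟩ := a.tendsto a.gaussNorm (fun h => ha (gaussNorm_eq_zero_iff.mp h))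
  obtain ⟨i, hi, hmin⟩ := Int.exists_least_of_bdd (P := fun i => v (a.coeff i) = a.gaussNorm)
    ⟨N, fun z hz => by
      by_contra h
      exact absurd hz (hN z (by lia)).ne⟩ ⟨_, rfl⟩
  refine ⟨i, hi, fun j hj => (a.le_gaussNorm j).lt_of_ne fun h => ?_⟩
  exact absurd (hmin j h) (by lia)

theorem gaussNorm_monomial (m : ℤ) (x : F) : (monomial v m x).gaussNorm = v x := by
  refine le_antisymm (gaussNorm_le_iff.mpr fun i => ?_) ?_
  · rw [coeff_monomial]
    split_ifs <;> simp
  · have := le_gaussNorm (monomial v m x) m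
    rwa [coeff_monomial, if_pos rfl] at this

variable [v.IsCompleteDiscrete]

/-- Gauss's lemma: if `i` and `j` are the leftmost maximal indices, the term `aᵢ bⱼ` strictly
dominates the coefficient of index `i + j`. -/
theorem gaussNorm_mul (a b : TwoSidedSeries v) :
    (a * b).gaussNorm = a.gaussNorm * b.gaussNorm := by
  rcases eq_or_ne a 0 with rfl | ha
  · rw [zero_mul, gaussNorm_eq_zero_iff.mpr rfl, zero_mul]
  rcases eq_or_ne b 0 with rfl | hb
  · rw [mul_zero, gaussNorm_eq_zero_iff.mpr rfl, mul_zero]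
  have ha0 : a.gaussNorm ≠ 0 := fun h => ha (gaussNorm_eq_zero_iff.mp h)
  have hb0 : b.gaussNorm ≠ 0 := fun h => hb (gaussNorm_eq_zero_iff.mp h)
  refine le_antisymm (gaussNorm_le_iff.mpr fun n => vsum_le fun i => ?_) ?_
  · rw [map_mul]
    exact mul_le_mul' (a.le_gaussNorm _) (b.le_gaussNorm _)
  obtain ⟨i, hi, hi'⟩ := exists_least_coeff ha
  obtain ⟨j, hj, hj'⟩ := exists_least_coeff hb
  -- For `k < i` the first factor is not maximal; for `k > i` the index `i + j - k` is below `j` and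
  -- the second is not.
  have h1 := vsum_sub_sum_lt (v := v) (fun _ => finite_mul a b (i + j)) {i}
    (c := a.gaussNorm * b.gaussNorm) (mul_ne_zero ha0 hb0) (fun k hk => by
      rw [map_mul]
      rcases lt_or_gt_of_ne (show k ≠ i by simpa using hk) with h | h
      · exact (mul_le_mul' le_rfl (b.le_gaussNorm _)).trans_lt
          (mul_lt_mul_of_pos_right (hi' k h) (zero_lt_iff.mpr hb0))
      · exact (mul_le_mul' (a.le_gaussNorm _) le_rfl).trans_lt
          (mul_lt_mul_of_pos_left (hj' (i + j - k) (by lia)) (zero_lt_iff.mpr ha0)))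
  rw [Finset.sum_singleton, ← coeff_mul, add_sub_cancel_left] at h1
  have h2 : v (a.coeff i * b.coeff j) = a.gaussNorm * b.gaussNorm := by rw [map_mul, hi, hj]
  rw [← h2] at h1 ⊢
  rw [← map_eq_of_sub_lt v h1]
  exact le_gaussNorm _ _

variable (v) in
/-- The Gauss valuation of `F{{T}}`. -/
def gaussValuation : Valuation (TwoSidedSeries v) ℤᵐ⁰ where
  toFun := gaussNorm
  map_zero' := gaussNorm_eq_zero_iff.mpr rfl
  map_one' := (gaussNorm_monomial 0 1).trans (map_one v)
  map_mul' := gaussNorm_mul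
  map_add_le_max' a b := gaussNorm_le_iff.mpr fun i =>
    (v.map_add _ _).trans (max_le_max (a.le_gaussNorm i) (b.le_gaussNorm i))

theorem gaussValuation_le_iff {a : TwoSidedSeries v} {c : ℤᵐ⁰} :
    gaussValuation v a ≤ c ↔ ∀ i, v (a.coeff i) ≤ c := gaussNorm_le_iff

theorem gaussValuation_lt_iff {a : TwoSidedSeries v} {c : ℤᵐ⁰} :
    gaussValuation v a < c ↔ ∀ i, v (a.coeff i) < c := gaussNorm_lt_iff

theorem gaussValuation_monomial (m : ℤ) (x : F) : gaussValuation v (monomial v m x) = v x :=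
  gaussNorm_monomial m x

theorem gaussValuation_surjective : Function.Surjective (gaussValuation v) := fun c => by
  obtain ⟨x, rfl⟩ := IsCompleteDiscrete.surjective (v := v) c
  exact ⟨_, gaussValuation_monomial 0 x⟩

@[simp] theorem coeff_sub (a b : TwoSidedSeries v) (n : ℤ) :
    (a - b).coeff n = a.coeff n - b.coeff n := by
  rw [sub_eq_add_neg, coeff_add, coeff_neg, sub_eq_add_neg]

/-- Limits are taken coefficientwise; the estimates are uniform in the index, so boundedness and
decay on the left pass to the limit. -/
instance completeSpace_gaussValuation : CompleteSpace (WithVal (gaussValuation v)) := by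
  have hv := IsCompleteDiscrete.surjective (v := v)
  have := IsCompleteDiscrete.completeSpace (v := v)
  refine Valuation.completeSpace_withVal gaussValuation_surjective fun x hx => ?_
  simp only [gaussValuation_le_iff, coeff_sub] at hx
  choose y hy using fun i => exists_limit_of_completeSpace hv (fun n => (x n).coeff i) (hx · i)
  have hyx : ∀ n i, v (y i) ≤ max (v ((x n).coeff i)) (WithZero.exp (-(n : ℤ))) := fun n i => by
    calc v (y i) = v ((x n).coeff i + (y i - (x n).coeff i)) := by rw [add_sub_cancel]
      _ ≤ _ := (v.map_add _ _).trans (max_le_max le_rfl (hy i n))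
  let z : TwoSidedSeries v :=
    { coeff := y
      bounded := by
        obtain ⟨c, hc⟩ := (x 0).bounded
        exact ⟨_, fun i => (hyx 0 i).trans (max_le_max (hc i) le_rfl)⟩
      tendsto := fun c hc => by
        obtain ⟨n, hn⟩ := exists_exp_neg_le hc
        obtain ⟨N, hN⟩ := (x (n + 1)).tendsto c hc
        refine ⟨N, fun i hi => (hyx (n + 1) i).trans_lt (max_lt (hN i hi) (lt_of_lt_of_le ?_ hn))⟩
        rw [WithZero.exp_lt_exp]
        lia }
  refine ⟨z, fun n => gaussValuation_le_iff.mpr fun i => ?_⟩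
  rw [coeff_sub]
  exact hy i n

end TwoSidedSeries

/-- The inverse is the geometric series in `1 - x`. -/
theorem Valuation.exists_mul_eq_one_of_lt_one {M : Type*} [CommRing M] {w : Valuation M ℤᵐ⁰}
    (hw : Function.Surjective w) [CompleteSpace (WithVal w)] (hw0 : ∀ m, w m = 0 → m = 0) {x : M}
    (hx : w (1 - x) < 1) : ∃ y, x * y = 1 := by
  have hpow : ∀ n : ℕ, w ((1 - x) ^ n) ≤ WithZero.exp (-(n : ℤ)) := by
    intro n
    rw [map_pow]
    refine (pow_le_pow_left₀ zero_le (lt_one_iff_le.mp hx) n).trans_eq ?_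
    rw [← WithZero.exp_nsmul]
    simp
  obtain ⟨y, hy⟩ := exists_limit_of_completeSpace hw
    (fun n => ∑ i ∈ Finset.range n, (1 - x) ^ i) fun n => by
      rw [Finset.sum_range_succ, add_sub_cancel_left]
      exact hpow n
  refine ⟨y, sub_eq_zero.mp (hw0 _ (eq_zero_of_forall_le_exp_neg fun n => ?_))⟩
  have h1 : x * y - 1 = x * (y - ∑ i ∈ Finset.range n, (1 - x) ^ i) - (1 - x) ^ n := by
    have := mul_neg_geom_sum (1 - x) n
    rw [sub_sub_cancel] at this
    linear_combination this
  have hx1 : w x ≤ 1 := by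
    rw [← sub_sub_cancel 1 x]
    exact (w.map_sub _ _).trans (max_le (map_one w).le hx.le)
  rw [h1]
  refine (w.map_sub _ _).trans (max_le ?_ (hpow n))
  rw [map_mul]
  exact (mul_le_mul' hx1 (hy n)).trans_eq (one_mul _)

/-! ### `F{{T}}` as a higher local field -/

/-- Rewrites the product of Hahn series as a finite sum over the first index, the shape of the
Cauchy product of `TwoSidedSeries`. -/
theorem HahnSeries.exists_coeff_mul_eq_sum {R : Type*} [Semiring R] (f g : HahnSeries ℤ R) (n : ℤ) :
    ∃ S : Finset ℤ, (∀ i ∉ S, f.coeff i = 0 ∨ g.coeff (n - i) = 0) ∧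
      (f * g).coeff n = ∑ i ∈ S, f.coeff i * g.coeff (n - i) := by
  classical
  let P := Finset.antidiagonal f.isPWO_support g.isPWO_support n
  have hP : ∀ p, p ∈ P ↔ f.coeff p.1 ≠ 0 ∧ g.coeff p.2 ≠ 0 ∧ p.1 + p.2 = n := fun p =>
    Finset.mem_antidiagonal
  refine ⟨P.image Prod.fst, fun i hi => ?_, ?_⟩
  · by_contra! h
    exact hi (Finset.mem_image.mpr ⟨(i, n - i), (hP _).mpr ⟨h.1, h.2, by ring⟩, rfl⟩)
  · rw [HahnSeries.coeff_mul, Finset.sum_image]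
    · refine Finset.sum_congr rfl fun p hp => ?_
      rw [← ((hP p).mp hp).2.2, add_sub_cancel_left]
    · intro p hp q hq h
      have h1 := ((hP p).mp hp).2.2
      have h2 := ((hP q).mp hq).2.2
      refine Prod.ext h ?_
      have h' : p.1 = q.1 := h
      lia

namespace TwoSidedSeries

open Valuation Topology

variable {F : Type*} [Field F] {v : Valuation F ℤᵐ⁰} [v.IsCompleteDiscrete]

section OfPowerSeries

variable {A : Type*} [CommRing A] (φ : A →+* F) (hφ : ∀ a, v (φ a) ≤ 1)

/-- A power series with integral coefficients, as an element of `F{{T}}`. -/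
def ofPowerSeries : A⟦X⟧ →+* TwoSidedSeries v where
  toFun f :=
    { coeff := (HahnSeries.ofPowerSeries ℤ F (f.map φ)).coeff
      bounded := ⟨1, fun i => by
        rw [PowerSeries.coeff_coe]
        split_ifs
        · simp
        · rw [PowerSeries.coeff_map]
          exact hφ _⟩
      tendsto := fun c hc => ⟨-1, fun i hi => by
        rw [PowerSeries.coeff_coe, if_pos (by lia), map_zero]
        exact zero_lt_iff.mpr hc⟩ }
  map_one' := by
    ext n
    change (HahnSeries.ofPowerSeries ℤ F _).coeff n = (monomial v 0 1).coeff n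
    rw [map_one, map_one, HahnSeries.coeff_one, coeff_monomial]
    split_ifs <;> rfl
  map_zero' := by
    ext n
    change (HahnSeries.ofPowerSeries ℤ F _).coeff n = 0
    rw [map_zero, map_zero, HahnSeries.coeff_zero]
  map_add' f g := by
    ext n
    change (HahnSeries.ofPowerSeries ℤ F _).coeff n = _
    rw [map_add, map_add, HahnSeries.coeff_add]
    rfl
  map_mul' f g := by
    ext n
    change (HahnSeries.ofPowerSeries ℤ F _).coeff n = vsum v _
    rw [map_mul, map_mul]
    obtain ⟨S, hS, h⟩ := HahnSeries.exists_coeff_mul_eq_sum (HahnSeries.ofPowerSeries ℤ F (f.map φ))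
      (HahnSeries.ofPowerSeries ℤ F (g.map φ)) n
    rw [h, vsum_eq_sum (S := S)]
    intro i hi
    rcases hS i hi with h | h <;> simp [h]

theorem coeff_ofPowerSeries (f : A⟦X⟧) (n : ℤ) : (ofPowerSeries φ hφ f).coeff n =
    if n < 0 then 0 else φ (PowerSeries.coeff n.natAbs f) := by
  refine (PowerSeries.coeff_coe _ _).trans ?_
  rw [PowerSeries.coeff_map]

theorem coeff_ofPowerSeries_natCast (f : A⟦X⟧) (n : ℕ) :
    (ofPowerSeries φ hφ f).coeff n = φ (PowerSeries.coeff n f) := by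
  rw [coeff_ofPowerSeries, if_neg (by lia), Int.natAbs_natCast]

theorem gaussValuation_ofPowerSeries_le_one (f : A⟦X⟧) :
    gaussValuation v (ofPowerSeries φ hφ f) ≤ 1 := by
  refine gaussValuation_le_iff.mpr fun i => ?_
  rw [coeff_ofPowerSeries]
  split_ifs
  · simp
  · exact hφ _

theorem ofPowerSeries_C (a : A) : ofPowerSeries φ hφ (PowerSeries.C a) = monomial v 0 (φ a) := by
  ext n
  rw [coeff_ofPowerSeries, coeff_monomial]
  split_ifs with h1 h2 h2
  · lia
  · rfl
  · simp [h2]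
  · rw [PowerSeries.coeff_C, if_neg (by lia), map_zero]

theorem ofPowerSeries_X_pow (m : ℕ) :
    ofPowerSeries φ hφ (PowerSeries.X ^ m) = monomial v m 1 := by
  ext n
  rw [coeff_ofPowerSeries, coeff_monomial, PowerSeries.coeff_X_pow]
  split_ifs with h1 h2 h3 h4 <;> first | lia | simp

end OfPowerSeries

variable (v) in
-- Normalise so that the leftmost maximal coefficient is `1`, in degree `0`. Up to terms of value
-- below `1` the series is then an invertible integral power series, and the geometric series does
-- the rest.
theorem isField : IsField (TwoSidedSeries v) := by
  refine ⟨⟨0, 1, fun h => ?_⟩, mul_comm, fun {a} ha => ?_⟩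
  · have := congrArg (fun a => a.coeff 0) h
    change 0 = (monomial v 0 1).coeff 0 at this
    rw [coeff_monomial, if_pos rfl] at this
    exact zero_ne_one this
  obtain ⟨i, hi, hi'⟩ := exists_least_coeff ha
  have hN : a.gaussNorm ≠ 0 := fun h => ha (gaussNorm_eq_zero_iff.mp h)
  have hα : a.coeff i ≠ 0 := fun h => hN (by rw [← hi, h, map_zero])
  let b := monomial v (-i) (a.coeff i)⁻¹ * a
  have hb : ∀ n, b.coeff n = (a.coeff i)⁻¹ * a.coeff (n + i) := fun n => by
    rw [coeff_monomial_mul, sub_neg_eq_add]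
  have hb1 : gaussValuation v b = 1 := by
    rw [map_mul, gaussValuation_monomial, map_inv₀, hi]
    exact inv_mul_cancel₀ hN
  have hbn : ∀ n < 0, v (b.coeff n) < 1 := fun n hn => by
    rw [hb, map_mul, map_inv₀, hi, ← inv_mul_cancel₀ hN]
    exact mul_lt_mul_of_pos_left (hi' _ (by lia)) (zero_lt_iff.mpr (inv_ne_zero hN))
  -- `U` is the part of `b` in nonnegative degrees, with constant term `1`; the discarded part has
  -- value below `1`.
  let U : v.integer⟦X⟧ := PowerSeries.mk fun n => ⟨b.coeff n, gaussValuation_le_iff.mp hb1.le n⟩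
  have hU : IsUnit U := by
    rw [PowerSeries.isUnit_iff_constantCoeff]
    convert isUnit_one
    rw [← PowerSeries.coeff_zero_eq_constantCoeff_apply, PowerSeries.coeff_mk]
    refine Subtype.ext ?_
    change b.coeff ((0 : ℕ) : ℤ) = 1
    rw [hb, Nat.cast_zero, zero_add, inv_mul_cancel₀ hα]
  obtain ⟨V, hV⟩ := hU.exists_right_inv
  let j : v.integer⟦X⟧ →+* TwoSidedSeries v := ofPowerSeries v.integer.subtype fun a => a.2
  have hjU : gaussValuation v (j U - b) < 1 := by
    refine gaussValuation_lt_iff.mpr fun n => ?_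
    rw [coeff_sub]
    rcases lt_or_ge n 0 with hn | hn
    · rw [show (j U).coeff n = _ from coeff_ofPowerSeries _ _ U n, if_pos hn, zero_sub, Valuation.map_neg]
      exact hbn n hn
    · lift n to ℕ using hn
      rw [show (j U).coeff n = _ from coeff_ofPowerSeries_natCast _ _ U n, PowerSeries.coeff_mk]
      simp
  have hjV : j U * j V = 1 := by rw [← map_mul, hV, map_one]
  obtain ⟨y, hy⟩ := exists_mul_eq_one_of_lt_one gaussValuation_surjective
    (fun m hm => gaussNorm_eq_zero_iff.mp hm) (x := b * j V) (by
      rw [← hjV, ← sub_mul, map_mul]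
      exact mul_lt_one_of_lt_of_le hjU (gaussValuation_ofPowerSeries_le_one _ _ _))
  exact ⟨monomial v (-i) (a.coeff i)⁻¹ * j V * y, by rw [← hy]; ring⟩

section Residue

variable {k : Type*} [CommRing k] (ρ : v.integer →+* k) (hker : ∀ x, ρ x = 0 ↔ v x < 1)

theorem coeff_mem_integer (x : (gaussValuation v).integer) (i : ℤ) : x.1.coeff i ∈ v.integer :=
  gaussValuation_le_iff.mp x.2 i

omit [v.IsCompleteDiscrete] in
include hker in
theorem eq_of_sub_lt_one {x y : v.integer} (h : v ((x : F) - y) < 1) : ρ x = ρ y := by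
  rw [← sub_eq_zero, ← RingHom.map_sub, hker]
  exact h

/-- Coefficientwise reduction. -/
def integerToResidue : (gaussValuation v).integer →+* k⸨X⸩ where
  toFun x := HahnSeries.ofSuppBddBelow (fun i => ρ ⟨_, coeff_mem_integer x i⟩) (by
    obtain ⟨N, hN⟩ := x.1.tendsto 1 one_ne_zero
    refine ⟨N, fun i hi => ?_⟩
    by_contra h
    exact hi ((hker _).mpr (hN i (by lia))))
  map_one' := by
    ext n
    rw [HahnSeries.coeff_one]
    change ρ ⟨(monomial v 0 1).coeff n, _⟩ = _
    simp only [coeff_monomial]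
    split_ifs
    · exact map_one ρ
    · exact map_zero ρ
  map_zero' := by
    ext n
    exact map_zero ρ
  map_add' x y := by
    ext n
    rw [HahnSeries.coeff_add]
    exact map_add ρ ⟨_, coeff_mem_integer x n⟩ ⟨_, coeff_mem_integer y n⟩
  map_mul' x y := by
    ext n
    obtain ⟨S, hS, h⟩ := HahnSeries.exists_coeff_mul_eq_sum
      (HahnSeries.ofSuppBddBelow (fun i => ρ ⟨_, coeff_mem_integer x i⟩) _)
      (HahnSeries.ofSuppBddBelow (fun i => ρ ⟨_, coeff_mem_integer y i⟩) _) n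
    rw [h]
    change ρ _ = ∑ i ∈ S, ρ _ * ρ _
    simp only [← map_mul, ← map_sum]
    refine eq_of_sub_lt_one ρ hker ?_
    -- Outside `S` one factor reduces to zero, so the corresponding terms have value below `1` and
    -- do not affect the residue.
    have h1 := vsum_sub_sum_lt (v := v) (fun _ => finite_mul x.1 y.1 n) S (c := 1) one_ne_zero
      fun i hi => by
        rw [map_mul]
        rcases hS i hi with h | h
        · exact mul_lt_one_of_lt_of_le ((hker _).mp h) (coeff_mem_integer y _)
        · rw [mul_comm]
          exact mul_lt_one_of_lt_of_le ((hker _).mp h) (coeff_mem_integer x _)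
    simpa [coeff_mul] using h1

end Residue

theorem isLocalFieldOfDim {k : Type*} [Field k] (ρ : v.integer →+* k)
    (hρ : Function.Surjective ρ) (hker : ∀ x, ρ x = 0 ↔ v x < 1) {n : ℕ}
    (hk : IsLocalFieldOfDim n k) : IsLocalFieldOfDim (n + 2) (TwoSidedSeries v) := by
  refine IsLocalFieldOfDim.succ (isField v) gaussValuation_surjective inferInstance
    (integerToResidue ρ hker) (fun h => ?_) (fun x => ?_) hk.laurentSeries
  · obtain ⟨σ, hσ⟩ : ∃ σ : k → v.integer, ∀ c, ρ (σ c) = c ∧ (c = 0 → σ c = 0) := by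
      choose τ hτ using hρ
      classical
      refine ⟨fun c => if c = 0 then 0 else τ c, fun c => ?_⟩
      by_cases hc : c = 0 <;> simp [hc, hτ]
    let z : TwoSidedSeries v :=
      { coeff := fun i => σ (h.coeff i)
        bounded := ⟨1, fun i => (σ _).2⟩
        tendsto := fun c hc => ⟨h.order - 1, fun i hi => by
          rw [(hσ _).2 (HahnSeries.coeff_eq_zero_of_lt_order (by lia))]
          simpa using zero_lt_iff.mpr hc⟩ }
    refine ⟨⟨z, gaussValuation_le_iff.mpr fun i => (σ _).2⟩, ?_⟩
    ext i
    exact (hσ _).1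
  · rw [gaussValuation_lt_iff]
    refine ⟨fun h i => ?_, fun h => ?_⟩
    · exact (hker _).mp (congrArg (fun y : k⸨X⸩ => y.coeff i) h)
    · ext i
      exact (hker _).mpr (h i)

end TwoSidedSeries

/-! ### Completion at `(ℓ)` -/

section

variable {l : ℕ} [Fact l.Prime]
  {L : Type*} [Field L] [Algebra ℚ_[l] L] [FiniteDimensional ℚ_[l] L]
  [Algebra ℤ_[l] L] [IsScalarTower ℤ_[l] ℚ_[l] L]
  {G : Type*} [CommGroup G] [TopologicalSpace G]

open PadicExtension

/-- Under the coefficientwise inclusion the uniformizer of `L` has Gauss value `exp (-1)`, and Gauss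
value below `1` means that it divides every coefficient. The residue field `k⸨X⸩` only needs powers
of `X` as denominators. -/
theorem exists_completion_ringEquiv_twoSidedSeries
    {Θ : (integralClosure ℤ_[l] L)⟦X⟧ ≃ₐ[integralClosure ℤ_[l] L] IwasawaOver l G L}
    (hΘ : @IsFractionRing (integralClosure ℤ_[l] L)⟦X⟧ _ (QuotIwasawaOver l G L) _
        ((iwasawaOverToQuot l G L).comp (Θ : _ →+* IwasawaOver l G L)).toAlgebra)
    {v : Valuation L ℤᵐ⁰} (hv : Function.Surjective v)
    (hint : ∀ x : L, v x ≤ 1 ↔ x ∈ integralClosure ℤ_[l] L)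
    {ϖ : integralClosure ℤ_[l] L} (hϖ : v (ϖ : L) = WithZero.exp (-1)) :
    (Ideal.span {Θ (PowerSeries.C ϖ)}).IsPrime ∧
      (∃ u, IsAdicValuation (iwasawaOverToQuot l G L) (Ideal.span {Θ (PowerSeries.C ϖ)}) u) ∧
      ∀ u, IsAdicValuation (iwasawaOverToQuot l G L) (Ideal.span {Θ (PowerSeries.C ϖ)}) u →
        IsLocalFieldOfDim 2 u.Completion ∧ ∃ e : u.Completion ≃+* TwoSidedSeries v,
          (∀ a : L, e (algebraMap L (QuotIwasawaOver l G L) a) = TwoSidedSeries.monomial v 0 a) ∧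
          e (iwasawaOverToQuot l G L (Θ PowerSeries.X)) = TwoSidedSeries.monomial v 1 1 ∧
          ∀ y, y ∈ completedValuationRing u ↔ ∀ i, v ((e y).coeff i) ≤ 1 := by
  let A := integralClosure ℤ_[l] L
  have : v.IsCompleteDiscrete := ⟨hv, completeSpace_withVal hv hint⟩
  have hA : ∀ a : A, v (algebraMap A L a) ≤ 1 := fun a => (hint _).mpr a.2
  have hϖ0 : ϖ ≠ 0 := fun h => by
    rw [h, Subalgebra.coe_zero, map_zero] at hϖ
    exact WithZero.exp_ne_zero hϖ.symm
  let j : A⟦X⟧ →+* TwoSidedSeries v := TwoSidedSeries.ofPowerSeries (algebraMap A L) hA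
  have hjcoeff : ∀ (f : A⟦X⟧) (n : ℕ), (j f).coeff n = PowerSeries.coeff n f :=
    TwoSidedSeries.coeff_ofPowerSeries_natCast (algebraMap A L) hA
  have hjneg : ∀ (f : A⟦X⟧) (n : ℤ), n < 0 → (j f).coeff n = 0 := fun f n hn =>
    (TwoSidedSeries.coeff_ofPowerSeries (algebraMap A L) hA f n).trans (if_pos hn)
  have hjC : ∀ a, j (PowerSeries.C a) = TwoSidedSeries.monomial v 0 (a : L) :=
    TwoSidedSeries.ofPowerSeries_C (algebraMap A L) hA
  have hjX : ∀ m : ℕ, j (PowerSeries.X ^ m) = TwoSidedSeries.monomial v m 1 :=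
    TwoSidedSeries.ofPowerSeries_X_pow (algebraMap A L) hA
  let jL : L →+* TwoSidedSeries v :=
    { toFun := TwoSidedSeries.monomial v 0
      map_one' := rfl
      map_zero' := by ext n; simp [TwoSidedSeries.coeff_monomial]
      map_add' := fun x y => by
        ext n
        simp only [TwoSidedSeries.coeff_monomial, TwoSidedSeries.coeff_add]
        split_ifs <;> simp
      map_mul' := fun x y => by
        ext n
        simp only [TwoSidedSeries.coeff_monomial_mul, TwoSidedSeries.coeff_monomial, sub_zero]
        split_ifs <;> simp }
  have hj : Function.Injective j := by
    intro f g hfg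
    ext n
    rw [← hjcoeff, ← hjcoeff, hfg]
  have hdvd : ∀ r, TwoSidedSeries.gaussValuation v (j r) < 1 → PowerSeries.C ϖ ∣ r := by
    intro r hr
    have h1 : ∀ n, ϖ ∣ PowerSeries.coeff n r := fun n => by
      rw [dvd_iff hint _ _ hϖ0, hϖ, ← Valuation.lt_one_iff_le, ← hjcoeff]
      exact TwoSidedSeries.gaussValuation_lt_iff.mp hr n
    choose s hs using h1
    refine ⟨PowerSeries.mk s, ?_⟩
    ext n
    rw [PowerSeries.coeff_C_mul, PowerSeries.coeff_mk, hs]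
  have happ : ∀ m, TwoSidedSeries.gaussValuation v m ≤ 1 → ∃ r s : A⟦X⟧,
      TwoSidedSeries.gaussValuation v (j s) = 1 ∧
      TwoSidedSeries.gaussValuation v (j s * m - j r) < 1 := by
    intro m hm
    obtain ⟨N, hN⟩ := m.tendsto 1 one_ne_zero
    -- After multiplication by `X ^ d` every coefficient of negative index has value below `1`.
    let d : ℕ := (-N).toNat
    refine ⟨PowerSeries.mk fun n => ⟨m.coeff (n - d), (hint _).mp
      (TwoSidedSeries.gaussValuation_le_iff.mp hm _)⟩, PowerSeries.X ^ d, ?_, ?_⟩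
    · rw [hjX, TwoSidedSeries.gaussValuation_monomial, map_one]
    · refine TwoSidedSeries.gaussValuation_lt_iff.mpr fun n => ?_
      rw [TwoSidedSeries.coeff_sub, hjX, TwoSidedSeries.coeff_monomial_mul, one_mul]
      rcases lt_or_ge n 0 with hn | hn
      · rw [hjneg _ _ hn, sub_zero]
        exact hN _ (by lia)
      · lift n to ℕ using hn
        rw [hjcoeff, PowerSeries.coeff_mk, sub_self, map_zero]
        exact zero_lt_one
  obtain ⟨h1, h2, h3⟩ := exists_completion_quotIwasawaOver_ringEquiv Θ hΘ
    (TwoSidedSeries.isField v) j hj jL (fun a => (hjC a).symm) (PowerSeries.C ϖ)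
    (TwoSidedSeries.gaussValuation v)
    (TwoSidedSeries.gaussValuation_ofPowerSeries_le_one (algebraMap A L) hA) hdvd
    (by rw [hjC, TwoSidedSeries.gaussValuation_monomial, hϖ]) happ
  refine ⟨h1, h2, fun u hu => ?_⟩
  obtain ⟨e, heL, heR, hy⟩ := h3 u hu
  obtain ⟨k, _, ρ, hρ, hker, hk⟩ := exists_residueField hint
  refine ⟨IsLocalFieldOfDim.congr _ e.symm (TwoSidedSeries.isLocalFieldOfDim ρ hρ hker hk), e, heL,
    ?_, fun y => ?_⟩
  · rw [heR, ← pow_one PowerSeries.X, hjX, Nat.cast_one]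
  · rw [hy, TwoSidedSeries.gaussValuation_le_iff]

end

end

/-! ### Assembly of the three cases -/

theorem lemma2 (l : ℕ) [Fact l.Prime]
    -- a finite extension `L` of `ℚ_l` with its normalized valuation `vL` and a uniformizer `ϖ`
    (L : Type*) [Field L] [Algebra ℚ_[l] L] [FiniteDimensional ℚ_[l] L]
    [Algebra ℤ_[l] L] [IsScalarTower ℤ_[l] ℚ_[l] L]
    (vL : Valuation L ℤᵐ⁰) (hvL : Function.Surjective vL)
    (hvL_int : ∀ x : L, vL x ≤ 1 ↔ x ∈ integralClosure ℤ_[l] L)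
    (ϖ : integralClosure ℤ_[l] L) (hϖ : vL (ϖ : L) = WithZero.exp (-1))
    -- a group `Γ ≅ ℤ_l`, a topological generator `γ` of `Γ`, and the subgroup `Γ^w`
    (Γ : Type*) [CommGroup Γ] [TopologicalSpace Γ] [IsTopologicalGroup Γ]
    (hΓ : Nonempty (Γ ≃ₜ* Multiplicative ℤ_[l]))
    (γ : Γ) (hγ : (Subgroup.zpowers γ).topologicalClosure = ⊤)
    (w : ℕ) (hw : w ≠ 0) (Γw : Subgroup Γ) (hΓw : Γw = (powMonoidHom w : Γ →* Γ).range)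
    -- the generator `γ^w` of `Γ^w` and the element `T = γ^w - 1` of `Λ^{𝔬_L} Γ^w`
    (γw : Γw) (hγw : (γw : Γ) = γ ^ w)
    (T : IwasawaOver l Γw L) (hT : T = iwasawaVar l L γw) :
    let ℓ : IwasawaOver l Γw L := algebraMap _ _ ϖ
    let IsDist : (integralClosure ℤ_[l] L)[X] → Prop := fun f =>
      Irreducible f ∧ f.IsDistinguishedAt (Ideal.span {ϖ})
    let IsPAdic : IwasawaOver l Γw L → Valuation (QuotIwasawaOver l Γw L) ℤᵐ⁰ → Prop :=
      fun π v => IsAdicValuation (iwasawaOverToQuot l Γw L) (Ideal.span {π}) v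
    -- for `𝔭 = (π)` as below, `𝔭` is a prime ideal, the `𝔭`-adic valuation exists, and the
    -- completion is a two-dimensional local field
    (∀ π, (π = T ∨ (∃ f, IsDist f ∧ π = Polynomial.aeval T f) ∨ π = ℓ) →
      (Ideal.span {π}).IsPrime ∧ (∃ v, IsPAdic π v) ∧
        ∀ v, IsPAdic π v → IsLocalFieldOfDim 2 v.Completion) ∧
    -- (i) `𝔭 = (T)`
    (∀ v, IsPAdic T v → ∃ e : v.Completion ≃+* L⸨X⸩,
      (∀ a : L, e (algebraMap L (QuotIwasawaOver l Γw L) a) = HahnSeries.C a) ∧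
      ∀ y, y ∈ completedValuationRing v ↔ e y ∈ (HahnSeries.ofPowerSeries ℤ L).range) ∧
    -- (ii) `𝔭 = (f)`
    (∀ f, IsDist f → ∀ v, IsPAdic (Polynomial.aeval T f) v →
      IsField (ResidueAlgebra f) ∧ ∃ e : v.Completion ≃+* (ResidueAlgebra f)⸨X⸩,
        (∀ a : L, e (algebraMap L (QuotIwasawaOver l Γw L) a) =
          HahnSeries.C (algebraMap L (ResidueAlgebra f) a)) ∧
        ∀ y, y ∈ completedValuationRing v ↔
          e y ∈ (HahnSeries.ofPowerSeries ℤ (ResidueAlgebra f)).range) ∧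
    -- (iii) `𝔭 = (ℓ)`
    (∀ v, IsPAdic ℓ v → ∃ e : v.Completion ≃+* TwoSidedSeries vL,
      (∀ a : L, e (algebraMap L (QuotIwasawaOver l Γw L) a) = TwoSidedSeries.monomial vL 0 a) ∧
      e (iwasawaOverToQuot l Γw L T) = TwoSidedSeries.monomial vL 1 1 ∧
      ∀ y, y ∈ completedValuationRing v ↔ ∀ i, vL ((e y).coeff i) ≤ 1) := by
  intro ℓ IsDist IsPAdic
  obtain ⟨e⟩ := hΓ
  obtain ⟨U, hU⟩ := completedGroupRing.exists_isProcyclicSystem e hγ hw hΓw hγw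
  obtain ⟨Θ, hΘX, hΘ⟩ := hU.exists_powerSeries_algEquiv L
  have := PadicExtension.isAdicComplete hvL hvL_int hϖ
  have hΘf : ∀ f : (integralClosure ℤ_[l] L)[X], Θ f = Polynomial.aeval T f := fun f => by
    rw [hT, ← hΘX]
    exact (Θ : _ →ₐ[integralClosure ℤ_[l] L] IwasawaOver l Γw L).map_polynomial_coe f
  have hΘℓ : Θ (PowerSeries.C ϖ) = ℓ := Θ.commutes ϖ
  -- The ideal `(T)` is treated as `(f)` with `f = X`, whose zero `θ = 0` already lies in `L`.
  have hX : IsDist Polynomial.X := ⟨Polynomial.irreducible_X, ⟨⟨fun {n} hn => by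
    have hn' : n = 0 := by simpa using hn
    rw [hn', Polynomial.coeff_X_zero]
    exact Ideal.zero_mem _⟩, Polynomial.monic_X⟩⟩
  have hT1 := exists_completion_ringEquiv_laurentSeries hΘ hX.2 hX.1 (E := L) (θ := 0) (by simp)
    fun x => ⟨Polynomial.C x, by simp⟩
  rw [hΘf, Polynomial.aeval_X] at hT1
  -- The field structure on the residue algebra depends on the irreducibility of `f`, so it is
  -- supplied explicitly.
  have hf1 : ∀ f (hf : IsDist f), _ := fun f hf =>
    @exists_completion_ringEquiv_laurentSeries _ _ _ _ _ _ _ _ _ _ f _ _ _ Θ hΘ hf.2 hf.1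
      (ResidueAlgebra f) (ResidueAlgebra.isField hf.2 hf.1).toField _ (ResidueAlgebra.root f)
      (ResidueAlgebra.aeval_root f) (ResidueAlgebra.exists_aeval_root_eq hf.2)
  have hℓ1 := exists_completion_ringEquiv_twoSidedSeries hΘ hvL hvL_int hϖ
  rw [hΘℓ] at hℓ1
  refine ⟨?_, fun v hv => (hT1.2.2 v hv).2, fun f hf v hv => ?_, fun v hv => ?_⟩
  · rintro π (rfl | ⟨f, hf, rfl⟩ | rfl)
    · exact ⟨hT1.1, hT1.2.1, fun v hv => (hT1.2.2 v hv).1⟩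
    · have h := hf1 f hf
      rw [hΘf] at h
      exact ⟨h.1, h.2.1, fun v hv => (h.2.2 v hv).1⟩
    · exact ⟨hℓ1.1, hℓ1.2.1, fun v hv => (hℓ1.2.2 v hv).1⟩
  · have h := hf1 f hf
    rw [hΘf] at h
    exact ⟨ResidueAlgebra.isField hf.2 hf.1, (h.2.2 v hv).2⟩
  · rw [hΘX, ← hT] at hℓ1
    exact (hℓ1.2.2 v hv).2
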